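/- Let $M$ be a connected Riemannian symmetric space, let $I(M)$ be its isometry group with the compact-open topology, and let $G=I(M)^o$ be the connected component of the identity. For $p\in M$ let $\sigma_p\in I(M)$ be the geodesic symmetry of $M$ at $p$, and let $K_p$ be the isotropy group of $G$ at $p$. Assume that $M$ is irreducible ($\dim M>0$ and, for every $p\in M$, $K_p$ acts irreducibly on $T_pM$ by differentials), of compact type ($G$ is compact and semisimple), and outer (it is not the case that $\sigma_p\in K_p$ for all $p\in M$; since $M$ is homogeneous, one point suffices to decide this). Totally geodesic submanifolds are understood to be connected, complete and embedded. Let $\Sigma\subset M$ be a maximal totally geodesic submanifold, that is, $\Sigma\neq M$ and no totally geodesic submanifold $\Sigma'$ satisfies $\Sigma\subsetneq\Sigma'\subsetneq M$. Write $\Sigma=G'/K'$, where $G'\subset I(M)$ is the group of glide transformations of $\Sigma$, generated by all transvections $\sigma_p\circ\sigma_q$ with $p,q\in\Sigma$, and $K'=K'_o$ is the isotropy group of $G'$ at $o\in\Sigma$. Assume that $\Sigma=G'/K'$ is an inner symmetric space: for some $o\in\Sigma$ there is an element $\tau\in K'_o$ whose restriction to $\Sigma$ is the geodesic symmetry $\sigma_o|_\Sigma$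 of $\Sigma$ at $o$. Then $\Sigma$ is a reflective submanifold: for every $o\in\Sigma$ the normal space $\nu_o\Sigma=(T_o\Sigma)^\perp$ is the tangent space at $o$ of a totally geodesic submanifold of $M$. Moreover, for every $o\in\Sigma$: (a) there is $\tau\in I(M)$ with $\tau^2=\mathrm{id}$ and $\tau|_\Sigma=\sigma_o|_\Sigma$ such that $\sigma_o\circ\tau$ is an involution and $\Sigma$ is the connected component containing $o$ of the fixed point set of $\sigma_o\circ\tau$; (b) for every $\tau\in K'_o$ with $\tau|_\Sigma=\sigma_o|_\Sigma$, $\Sigma$ is the connected component containing $o$ of the fixed point set of $\sigma_o\circ\tau$. -/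

import Mathlib

open scoped Manifold ContDiff Topology Bundle

/-! ## Isometry group, geodesic symmetries, symmetric spaces -/

/-- The compact-open topology on the isometry group `I(M)` of `M`. -/
instance isometryGroupTopology (M : Type*) [MetricSpace M] : TopologicalSpace (M ≃ᵢ M) :=
  TopologicalSpace.induced (fun f : M ≃ᵢ M => (⟨f, f.continuous⟩ : C(M, M))) inferInstance

/-- The connected component `G = I(M)ᵒ` of the isometry group containing the identity. -/
def isometryIdComponent (M : Type*) [MetricSpace M] : Set (M ≃ᵢ M) :=
  connectedComponent (1 : M ≃ᵢ M)

/-- The isotropy group `K` of `G = I(M)ᵒ` at `o`. -/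
def isotropyGroup {M : Type*} [MetricSpace M] (o : M) : Set (M ≃ᵢ M) :=
  {g | g ∈ isometryIdComponent M ∧ g o = o}

/-- `s` is a geodesic symmetry at `o`: an involutive isometry having `o` as an isolated
fixed point. -/
structure IsGeodesicSymmetry {M : Type*} [MetricSpace M] (o : M) (s : M ≃ᵢ M) : Prop where
  involutive : s * s = 1
  fixes : s o = o
  isolated : ∀ᶠ x in 𝓝[≠] o, s x ≠ x

/-- Symmetric spaces: there is a geodesic symmetry at each point. (This class is used only for
connected Riemannian manifolds `M` with their Riemannian distance; there the geodesic symmetry at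
a point is unique.) -/
class IsSymmetricSpace (M : Type*) [MetricSpace M] : Prop where
  exists_symmetry : ∀ o : M, ∃ s : M ≃ᵢ M, IsGeodesicSymmetry o s

/-- The geodesic symmetry `σ_o` of `M` at `o`. -/
noncomputable def geodesicSymmetry {M : Type*} [MetricSpace M] [IsSymmetricSpace M] (o : M) :
    M ≃ᵢ M :=
  (IsSymmetricSpace.exists_symmetry o).choose

/-- `M = G/K` is inner: the geodesic symmetry `σ_o` belongs to `K`. -/
def IsInnerSymmetricSpace (M : Type*) [MetricSpace M] [IsSymmetricSpace M] : Prop :=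
  ∀ o : M, geodesicSymmetry o ∈ isotropyGroup o

/-- Outer means not inner. -/
def IsOuterSymmetricSpace (M : Type*) [MetricSpace M] [IsSymmetricSpace M] : Prop :=
  ¬ IsInnerSymmetricSpace M

/-- Compact type: `G = I(M)ᵒ` is a compact semisimple group. For a Riemannian symmetric space `M`,
the group `G` is compact if and only if `M` is, and a compact connected Lie group is semisimple if
and only if its centre is finite. -/
structure IsOfCompactType (M : Type*) [MetricSpace M] : Prop where
  compact : CompactSpace M
  finite_center :
    {g | g ∈ isometryIdComponent M ∧ ∀ h ∈ isometryIdComponent M, g * h = h * g}.Finite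

/-- Irreducibility: `dim M > 0` and, for each `o`, the isotropy group `K` of `I(M)ᵒ` at `o` acts
irreducibly on `T_oM` by differentials, i.e. the only linear subspaces `W` of `T_oM` with
`d_ok (W) ⊆ W` for all `k ∈ K` are `0` and `T_oM`. (Equality in the tangent bundle is used to
identify `T_{k(o)}M` with `T_oM`.) -/
structure IsIrreducibleSymmetricSpace (E : Type*) [NormedAddCommGroup E] [NormedSpace ℝ E]
    (M : Type*) [MetricSpace M] [ChartedSpace E M] : Prop where
  nontrivial : Nontrivial E
  irreducible : ∀ (o : M) (W : Submodule ℝ (TangentSpace 𝓘(ℝ, E) o)),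
    (∀ k ∈ isotropyGroup o, ∀ v ∈ W, ∀ w : TangentSpace 𝓘(ℝ, E) o,
      tangentMap 𝓘(ℝ, E) 𝓘(ℝ, E) k ⟨o, v⟩ = (⟨o, w⟩ : TangentBundle 𝓘(ℝ, E) M) → w ∈ W) →
    W = ⊥ ∨ W = ⊤

/-! ## Totally geodesic submanifolds -/

/-- Geodesics (defined on `ℝ`, possibly constant) of a Riemannian manifold with its Riemannian
distance: curves of constant speed `c` that are locally minimizing. -/
def IsGeodesic {M : Type*} [MetricSpace M] (γ : ℝ → M) : Prop :=
  ∃ c : ℝ, ∀ t : ℝ, ∃ ε > 0, ∀ s s' : ℝ, |s - t| < ε → |s' - t| < ε →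
    dist (γ s) (γ s') = c * |s - s'|

/-- The velocity vector `γ'(t)`, as an element of the tangent bundle. -/
noncomputable def velocity (E : Type*) [NormedAddCommGroup E] [NormedSpace ℝ E]
    {M : Type*} [MetricSpace M] [ChartedSpace E M] (γ : ℝ → M) (t : ℝ) :
    TangentBundle 𝓘(ℝ, E) M :=
  ⟨γ t, mfderiv 𝓘(ℝ, ℝ) 𝓘(ℝ, E) γ t (1 : ℝ)⟩

/-- `S` is an (embedded, smooth) submanifold of `M`: around each of its points there is a chart
in which `S` is a linear slice. -/
def IsSubmanifold (E : Type*) [NormedAddCommGroup E] [NormedSpace ℝ E]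
    {M : Type*} [MetricSpace M] [ChartedSpace E M] (S : Set M) : Prop :=
  ∀ p ∈ S, ∃ φ ∈ IsManifold.maximalAtlas 𝓘(ℝ, E) ∞ M, p ∈ φ.source ∧
    ∃ V : Submodule ℝ E, ∀ x ∈ φ.source, x ∈ S ↔ φ x - φ p ∈ V

/-- The tangent space `T_pS`: velocities at `p` of curves in `S` that pass through `p`. -/
def tangentVectors (E : Type*) [NormedAddCommGroup E] [NormedSpace ℝ E]
    {M : Type*} [MetricSpace M] [ChartedSpace E M] (S : Set M) (p : M) :
    Set (TangentSpace 𝓘(ℝ, E) p) :=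
  {v | ∃ c : ℝ → M, (∀ᶠ t in 𝓝 (0 : ℝ), c t ∈ S) ∧ MDifferentiableAt 𝓘(ℝ, ℝ) 𝓘(ℝ, E) c 0 ∧
    velocity E c 0 = ⟨p, v⟩}

/-- Connected complete totally geodesic submanifolds: connected submanifolds `S` such that each
geodesic of `M` that is tangent to `S` at one point stays in `S` for all time. -/
structure IsTotallyGeodesicSubmanifold (E : Type*) [NormedAddCommGroup E] [NormedSpace ℝ E]
    {M : Type*} [MetricSpace M] [ChartedSpace E M] (S : Set M) : Prop where
  connected : IsConnected S
  submanifold : IsSubmanifold E S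
  geodesic : ∀ γ : ℝ → M, IsGeodesic γ → γ 0 ∈ S →
    (∃ v ∈ tangentVectors E S (γ 0), velocity E γ 0 = ⟨γ 0, v⟩) → ∀ t, γ t ∈ S

/-- Maximal totally geodesic submanifolds: maximal with respect to inclusion among the connected
complete totally geodesic submanifolds different from `M`. -/
structure IsMaximalTotallyGeodesic (E : Type*) [NormedAddCommGroup E] [NormedSpace ℝ E]
    {M : Type*} [MetricSpace M] [ChartedSpace E M] (S : Set M) : Prop where
  totallyGeodesic : IsTotallyGeodesicSubmanifold E S
  proper : S ≠ Set.univ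
  maximal : ∀ S' : Set M, IsTotallyGeodesicSubmanifold E S' → S ⊆ S' → S' = S ∨ S' = Set.univ

/-- The group `G'` of glide transformations of a totally geodesic submanifold `S`: the subgroup
of `I(M)` generated by the transvections `σ_p ∘ σ_q` of `M` along the geodesics of `S`. (If `S` is
complete and `o ∈ S`, then these include the one-parameter groups of transvections with initial
velocity in `T_oS`, and the group they generate is the connected Lie subgroup with Lie algebra
`[T_oS, T_oS] ⊕ T_oS`.) -/
def glideGroup {M : Type*} [MetricSpace M] [IsSymmetricSpace M] (S : Set M) :
    Subgroup (M ≃ᵢ M) :=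
  Subgroup.closure {g | ∃ p ∈ S, ∃ q ∈ S, g = geodesicSymmetry p * geodesicSymmetry q}

/-- The glide isotropy group `K'` of `S = G'/K'` at `o`. -/
def glideIsotropyGroup {M : Type*} [MetricSpace M] [IsSymmetricSpace M] (S : Set M) (o : M) :
    Set (M ≃ᵢ M) :=
  {g | g ∈ glideGroup S ∧ g o = o}

/-- `τ` acts on the totally geodesic submanifold `S` through `o` as the geodesic symmetry of `S`
at `o`, which is the restriction of the geodesic symmetry `σ_o` of `M` to `S`. -/
def RestrictsToGeodesicSymmetry {M : Type*} [MetricSpace M] [IsSymmetricSpace M]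
    (τ : M ≃ᵢ M) (S : Set M) (o : M) : Prop :=
  ∀ x ∈ S, τ x = geodesicSymmetry o x

/-- The totally geodesic submanifold `S = G'/K'` is an inner symmetric space: the geodesic symmetry
of `S` at a point `o ∈ S` belongs to `K'`. -/
def IsInnerSubmanifold {M : Type*} [MetricSpace M] [IsSymmetricSpace M] (S : Set M) : Prop :=
  ∃ o ∈ S, ∃ τ ∈ glideIsotropyGroup S o, RestrictsToGeodesicSymmetry τ S o

/-- Reflective submanifolds: `S` is totally geodesic and, at each `o ∈ S`, the normal space of `S`
is also the tangent space of a complete totally geodesic submanifold `S'` through `o` (so that its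
tangent space and its normal space are both Lie triple systems). -/
structure IsReflective (E : Type*) [NormedAddCommGroup E] [NormedSpace ℝ E]
    {M : Type*} [MetricSpace M] [ChartedSpace E M]
    [Bundle.RiemannianBundle (fun x : M => TangentSpace 𝓘(ℝ, E) x)] (S : Set M) : Prop where
  totallyGeodesic : IsTotallyGeodesicSubmanifold E S
  normal : ∀ o ∈ S, ∃ S' : Set M, IsTotallyGeodesicSubmanifold E S' ∧ o ∈ S' ∧
    ∀ v : TangentSpace 𝓘(ℝ, E) o,
      v ∈ tangentVectors E S' o ↔ ∀ w ∈ tangentVectors E S o, inner ℝ v w = 0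

/-! Let τ ∈ K'_o induce σ_o on Σ and put g = σ_o τ, an isometry fixing Σ pointwise. The products σ_p
σ_q lie in the identity component G, because σ_q depends continuously on q and M is connected. So τ
∈ G, while σ_o ∉ G because M is outer; hence g ≠ 1. A component of the fixed point set of an
isometry is totally geodesic, and it is all of M only for the identity. By maximality Σ is therefore
the component of Fix(k) through o for every isometry k ≠ 1 that fixes Σ pointwise. With k = g this
is (b).

For reflectivity and (a) an involution h ≠ 1 fixing Σ pointwise is needed
(`exists_involution_fixing`). All k ≠ 1 fixing Σ pointwise have the same fixed vectors T_oΣ, so such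
an isometry that also fixes a nonzero normal vector is the identity. Choose a normal w ≠ 0 and an
angle θ with ⟨dgⁿ w, w⟩ = cos(nθ)|w|². If cos(nθ) = 1 for some n > 0, then gⁿ fixes w, so g has
finite order. The order is even, because gⁿ = σ_o τⁿ ≠ 1 for odd n, and half of it gives the
involution. Otherwise the multiples of θ are dense modulo 2π, and compactness of M yields a limit h
of powers of g with dh w = -w; then h² fixes w, so h² = 1. At each o ∈ Σ the differential of σ_o h
is -dh, whose fixed vectors form the normal space. So Fix(σ_o h) provides the orthogonal
submanifold, and τ = σ_o h is as required in (a).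

Most of the file prepares the differential geometry. Geodesics, symmetries and isometries are given
by the distance alone, and the link to the smooth metric is that an isometry fixing p is linear in
normal coordinates at p (`exists_isotropyMap`). The exponential map comes from the geodesic
equation, solved by the inverse function theorem in a space of velocity curves (`exists_spray_exp`).
With `gauss_lemma` and the infinitesimal comparison `dist_comparison`, minimizing curves from the
centre are exactly the radial segments (`IsNormalChart.exists_eq_symm_smul`). It follows that an
isometry of a connected M is determined by its differential at a fixed point
(`eq_one_of_isotropyMap`) and that fixed point sets are linear slices in normal charts. -/

/-! ## Superposition operators on spaces of continuous maps -/

section Superposition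

set_option synthInstance.maxHeartbeats 200000
attribute [local instance] ContinuousLinearMap.toNormedAddCommGroup
  ContinuousLinearMap.toNormedSpace

variable {K : Type*} [TopologicalSpace K] [CompactSpace K]

/-- The pointwise extension of a continuous bilinear map to spaces of continuous maps. -/
noncomputable def pointwiseBilin {F₁ F₂ F₃ : Type*} [NormedAddCommGroup F₁] [NormedSpace ℝ F₁]
    [NormedAddCommGroup F₂] [NormedSpace ℝ F₂] [NormedAddCommGroup F₃] [NormedSpace ℝ F₃]
    (B : F₁ →L[ℝ] F₂ →L[ℝ] F₃) : C(K, F₁) →L[ℝ] C(K, F₂) →L[ℝ] C(K, F₃) :=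
  LinearMap.mkContinuous₂
    (LinearMap.mk₂ ℝ (fun (u : C(K, F₁)) (v : C(K, F₂)) =>
      (⟨fun t => B (u t) (v t), by fun_prop⟩ : C(K, F₃)))
      (fun _ _ _ => by ext; simp) (fun _ _ _ => by ext; simp)
      (fun _ _ _ => by ext; simp) (fun _ _ _ => by ext; simp)) ‖B‖
    (fun u v => by
      refine (ContinuousMap.norm_le _ (by positivity)).2 fun t => ?_
      refine (B.le_opNorm₂ _ _).trans ?_
      gcongr
      · exact u.norm_coe_le_norm t
      · exact v.norm_coe_le_norm t)

@[simp] theorem pointwiseBilin_apply {F₁ F₂ F₃ : Type*} [NormedAddCommGroup F₁] [NormedSpace ℝ F₁]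
    [NormedAddCommGroup F₂] [NormedSpace ℝ F₂] [NormedAddCommGroup F₃] [NormedSpace ℝ F₃]
    (B : F₁ →L[ℝ] F₂ →L[ℝ] F₃) (u : C(K, F₁)) (v : C(K, F₂)) (t : K) :
    pointwiseBilin B u v t = B (u t) (v t) := rfl

theorem contDiff_pointwiseBilin {F₁ F₂ F₃ : Type*} [NormedAddCommGroup F₁] [NormedSpace ℝ F₁]
    [NormedAddCommGroup F₂] [NormedSpace ℝ F₂] [NormedAddCommGroup F₃] [NormedSpace ℝ F₃]
    (B : F₁ →L[ℝ] F₂ →L[ℝ] F₃) {n : WithTop ℕ∞} : ContDiff ℝ n (pointwiseBilin (K := K) B) := by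
  have := (pointwiseBilin (K := K) B).contDiff (n := n)
  exact this

/-- The mean value inequality controls the linearization error at each parameter. The bound is
uniform in the parameter because `fderiv ℝ f` is uniformly continuous near the compact range of `u`.
-/
theorem hasFDerivAt_superposition {X Y : Type*} [NormedAddCommGroup X] [NormedSpace ℝ X]
    [NormedAddCommGroup Y] [NormedSpace ℝ Y] (f : C(X, Y)) (hf : ContDiff ℝ 1 f) (u : C(K, X)) :
    HasFDerivAt (fun w : C(K, X) => f.comp w)
      (pointwiseBilin (ContinuousLinearMap.id ℝ (X →L[ℝ] Y))
        ((⟨fderiv ℝ f, hf.continuous_fderiv one_ne_zero⟩ : C(X, X →L[ℝ] Y)).comp u)) u := by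
  have hc : Continuous (fderiv ℝ f) := hf.continuous_fderiv one_ne_zero
  rw [hasFDerivAt_iff_isLittleO_nhds_zero, Asymptotics.isLittleO_iff]
  intro ε hε
  have hcomp : IsCompact (Set.range u) := isCompact_range u.continuous
  have := hcomp.uniformContinuousAt_of_continuousAt (fderiv ℝ f)
    (fun a _ => hc.continuousAt) (Metric.dist_mem_uniformity hε)
  obtain ⟨δ, hδ, hδ'⟩ := Metric.mem_uniformity_dist.1 this
  filter_upwards [Metric.ball_mem_nhds (0 : C(K, X)) hδ] with h hh
  refine (ContinuousMap.norm_le _ (by positivity)).2 fun t => ?_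
  have hht : ‖h t‖ < δ := (h.norm_coe_le_norm t).trans_lt (by simpa using hh)
  have key := (convex_ball (u t) δ).norm_image_sub_le_of_norm_fderiv_le' (𝕜 := ℝ) (f := f)
    (φ := fderiv ℝ f (u t)) (C := ε) (x := u t) (y := u t + h t)
    (fun x _ => (hf.differentiable one_ne_zero) x)
    (fun x hx => by
      have := hδ' (a := u t) (b := x) (by rw [dist_comm]; exact hx) (Set.mem_range_self t)
      simp only [Set.mem_ofPred_eq] at this
      rw [← dist_eq_norm, dist_comm]; exact this.le)
    (Metric.mem_ball_self hδ) (by simpa using hht)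
  simp only [add_sub_cancel_left] at key
  refine le_trans ?_ (key.trans (by gcongr; exact h.norm_coe_le_norm t))
  apply le_of_eq
  simp

universe u

/-- The derivative of superposition with `f` is superposition with `fderiv ℝ f` followed by a
bounded linear map, so each step gains one order. The induction replaces `Y` by `X →L[ℝ] Y`, which
is why both spaces share a universe. -/
theorem contDiff_superposition_nat {X : Type u} [NormedAddCommGroup X] [NormedSpace ℝ X] (n : ℕ) :
    ∀ {Y : Type u} [NormedAddCommGroup Y] [NormedSpace ℝ Y] (f : C(X, Y)), ContDiff ℝ ∞ f →
      ContDiff ℝ n (fun w : C(K, X) => f.comp w) := by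
  induction n with
  | zero =>
    intro Y _ _ f hf
    exact contDiff_zero.2 (ContinuousMap.continuous_postcomp f)
  | succ n ih =>
    intro Y _ _ f hf
    have h1 : ContDiff ℝ 1 f := hf.of_le (by exact_mod_cast le_top)
    have hd := hasFDerivAt_superposition (K := K) f h1
    have hf' : ContDiff ℝ ∞ (fderiv ℝ f) := hf.fderiv_right (by exact_mod_cast le_top)
    push_cast
    refine contDiff_succ_iff_fderiv.2 ⟨fun u => (hd u).differentiableAt, by simp, ?_⟩
    have : fderiv ℝ (fun w : C(K, X) => f.comp w) = fun u =>
      pointwiseBilin (ContinuousLinearMap.id ℝ (X →L[ℝ] Y))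
        ((⟨fderiv ℝ f, h1.continuous_fderiv one_ne_zero⟩ : C(X, X →L[ℝ] Y)).comp u) :=
      funext fun u => (hd u).fderiv
    rw [this]
    exact (pointwiseBilin (ContinuousLinearMap.id ℝ (X →L[ℝ] Y))).contDiff.comp
      (ih ⟨fderiv ℝ f, h1.continuous_fderiv one_ne_zero⟩ hf')

/-- Superposition with a smooth map is a smooth operator between spaces of continuous maps. -/
theorem contDiff_superposition {X Y : Type u} [NormedAddCommGroup X] [NormedSpace ℝ X]
    [NormedAddCommGroup Y] [NormedSpace ℝ Y] (f : C(X, Y)) (hf : ContDiff ℝ ∞ f) :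
    ContDiff ℝ ∞ (fun w : C(K, X) => f.comp w) :=
  contDiff_infty.2 fun n => contDiff_superposition_nat n f hf

end Superposition

/-! ## A smooth local inverse -/

/-- Smoothness of the inverse at a point needs an invertible derivative there. The points with
invertible derivative form an open set, and restricting to it makes the inverse smooth on the whole
target. The lemma serves both the velocity equation in `C(I, E)` and the exponential map itself. -/
theorem exists_smooth_local_inverse {X Y : Type*} [NormedAddCommGroup X] [NormedSpace ℝ X]
    [CompleteSpace X] [NormedAddCommGroup Y] [NormedSpace ℝ Y] [CompleteSpace Y] {Ψ : X → Y}
    {U : Set X} (hU : IsOpen U) (hΨ : ContDiffOn ℝ ∞ Ψ U) {a : X} (ha : a ∈ U) {L : X ≃L[ℝ] Y}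
    (hd : HasFDerivAt Ψ (L : X →L[ℝ] Y) a) :
    ∃ f : OpenPartialHomeomorph X Y, (f : X → Y) = Ψ ∧ a ∈ f.source ∧ f.source ⊆ U ∧
      ContDiffOn ℝ ∞ f.symm f.target := by
  have hat : ∀ x ∈ U, ContDiffAt ℝ ∞ Ψ x := fun x hx => hΨ.contDiffAt (hU.mem_nhds hx)
  have hstrict : HasStrictFDerivAt Ψ (L : X →L[ℝ] Y) a :=
    (hat a ha).hasStrictFDerivAt' hd (by simp)
  have hcont : ContinuousOn (fderiv ℝ Ψ) U :=
    hΨ.continuousOn_fderiv_of_isOpen hU (by simp)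
  let V : Set X := U ∩ fderiv ℝ Ψ ⁻¹' (Set.range ((↑) : (X ≃L[ℝ] Y) → X →L[ℝ] Y))
  have hVopen : IsOpen V := hcont.isOpen_inter_preimage hU ContinuousLinearEquiv.isOpen
  have haV : a ∈ V := ⟨ha, L, hd.fderiv.symm⟩
  let f := (hstrict.toOpenPartialHomeomorph Ψ).restr V
  have hf : (f : X → Y) = Ψ := rfl
  have hsrc : f.source = (hstrict.toOpenPartialHomeomorph Ψ).source ∩ V :=
    OpenPartialHomeomorph.restr_source' _ _ hVopen
  refine ⟨f, rfl, ?_, ?_, ?_⟩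
  · rw [hsrc]; exact ⟨hstrict.mem_toOpenPartialHomeomorph_source, haV⟩
  · rw [hsrc]; exact fun x hx => hx.2.1
  · intro y hy
    have hx : f.symm y ∈ f.source := f.map_target hy
    have hxV : f.symm y ∈ V := by rw [hsrc] at hx; exact hx.2
    obtain ⟨L', hL'⟩ := hxV.2
    refine (f.contDiffAt_symm hy (f₀' := L') ?_ ?_).contDiffWithinAt
    · rw [hf, hL']
      exact ((hat _ hxV.1).differentiableAt (by simp)).hasFDerivAt
    · rw [hf]; exact hat _ hxV.1

/-! ## The exponential map of a spray on a vector space -/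

section Spray

set_option synthInstance.maxHeartbeats 200000
attribute [local instance] ContinuousLinearMap.toNormedAddCommGroup
  ContinuousLinearMap.toNormedSpace

open unitInterval MeasureTheory

universe u

variable {E F G : Type u} [NormedAddCommGroup E] [NormedSpace ℝ E]
  [NormedAddCommGroup F] [NormedSpace ℝ F] [NormedAddCommGroup G] [NormedSpace ℝ G]

/-- The constant extension to `ℝ` of a continuous map on the unit interval. -/
noncomputable def extendIcc (u : C(I, E)) (s : ℝ) : E := u (Set.projIcc 0 1 zero_le_one s)

theorem continuous_extendIcc (u : C(I, E)) : Continuous (extendIcc u) :=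
  u.continuous.comp continuous_projIcc

theorem extendIcc_of_mem (u : C(I, E)) {s : ℝ} (hs : s ∈ I) : extendIcc u s = u ⟨s, hs⟩ := by
  simp [extendIcc, Set.projIcc_of_mem _ hs]

/-- Integration from `0`, as an operator on continuous maps on the unit interval. -/
noncomputable def primitiveCLM : C(I, E) →L[ℝ] C(I, E) :=
  LinearMap.mkContinuous
    { toFun := fun u => ⟨fun t => ∫ s in (0 : ℝ)..t, extendIcc u s,
        (intervalIntegral.continuous_primitive
          (fun a b => (continuous_extendIcc u).intervalIntegrable a b) 0).comp
          continuous_subtype_val⟩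
      map_add' := fun u v => by
        ext t
        exact intervalIntegral.integral_add ((continuous_extendIcc u).intervalIntegrable _ _)
          ((continuous_extendIcc v).intervalIntegrable _ _)
      map_smul' := fun c u => by
        ext t
        exact intervalIntegral.integral_smul c _ } 1
    (fun u => by
      refine (ContinuousMap.norm_le _ (by positivity)).2 fun t => ?_
      have := intervalIntegral.norm_integral_le_of_norm_le_const (a := (0 : ℝ)) (b := t)
        (f := extendIcc u) (C := ‖u‖) (fun s _ => u.norm_coe_le_norm _)
      refine this.trans ?_
      rw [one_mul, sub_zero, abs_of_nonneg t.2.1]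
      exact mul_le_of_le_one_right (norm_nonneg _) t.2.2)

theorem primitiveCLM_apply (u : C(I, E)) (t : I) :
    primitiveCLM u t = ∫ s in (0 : ℝ)..t, extendIcc u s := rfl

/-- Slowing down a map on the unit interval. -/
noncomputable def slowDown (τ : I) (u : C(I, E)) : C(I, E) :=
  u.comp ⟨fun s => τ * s, by fun_prop⟩

theorem slowDown_apply (τ : I) (u : C(I, E)) (s : I) : slowDown τ u s = u (τ * s) := rfl

/-- If u is the velocity of a curve, then s ↦ τ u(τ s) is the velocity of the same curve run at
speed τ: the factor τ is absorbed by the substitution. -/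
theorem primitiveCLM_slowDown (τ : I) (u : C(I, E)) (s : I) :
    primitiveCLM ((τ : ℝ) • slowDown τ u) s = primitiveCLM u (τ * s) := by
  rw [map_smul, ContinuousMap.smul_apply, primitiveCLM_apply, primitiveCLM_apply]
  have : ∫ s' in (0 : ℝ)..s, extendIcc (slowDown τ u) s'
      = ∫ s' in (0 : ℝ)..s, extendIcc u (τ * s') := by
    refine intervalIntegral.integral_congr fun s' hs' => ?_
    rw [Set.uIcc_of_le s.2.1] at hs'
    have hs'' : s' ∈ I := ⟨hs'.1, hs'.2.trans s.2.2⟩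
    have h2 : (τ : ℝ) * s' ∈ I := unitInterval.mul_mem τ.2 hs''
    rw [extendIcc_of_mem _ hs'', extendIcc_of_mem _ h2, slowDown_apply]
    rfl
  rw [this, intervalIntegral.smul_integral_comp_mul_left (extendIcc u) (τ : ℝ)]
  simp

theorem hasDerivAt_primitive (u : C(I, E)) [CompleteSpace E] (t : ℝ) :
    HasDerivAt (fun t => ∫ s in (0 : ℝ)..t, extendIcc u s) (extendIcc u t) t :=
  ((continuous_extendIcc u).integral_hasStrictDerivAt 0 t).hasDerivAt

/-- The acceleration prescribed by the spray `B₂ (B₁ (Q x) v) v` along the curve with velocity `u`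
that starts at `p`. -/
noncomputable def sprayOperator (B₁ : F →L[ℝ] E →L[ℝ] G) (B₂ : G →L[ℝ] E →L[ℝ] E) (Q : C(E, F))
    (p : E) (u : C(I, E)) : C(I, E) :=
  pointwiseBilin B₂ (pointwiseBilin B₁
    (Q.comp (ContinuousMap.const I p + primitiveCLM u)) u) u

theorem sprayOperator_apply (B₁ : F →L[ℝ] E →L[ℝ] G) (B₂ : G →L[ℝ] E →L[ℝ] E) (Q : C(E, F))
    (p : E) (u : C(I, E)) (t : I) :
    sprayOperator B₁ B₂ Q p u t = B₂ (B₁ (Q (p + primitiveCLM u t)) (u t)) (u t) := rfl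

/-- The last factor `u` is left unapplied, so that the product rule exposes the derivative of the
full operator at `u = 0`. -/
theorem contDiff_sprayOperator_aux (B₁ : F →L[ℝ] E →L[ℝ] G) (B₂ : G →L[ℝ] E →L[ℝ] E)
    (Q : C(E, F)) (hQ : ContDiff ℝ ∞ Q) (p : E) :
    ContDiff ℝ ∞ fun u : C(I, E) => pointwiseBilin B₂ (pointwiseBilin B₁
      (Q.comp (ContinuousMap.const I p + primitiveCLM u)) u) := by
  have h1 : ContDiff ℝ ∞ (fun u : C(I, E) => Q.comp (ContinuousMap.const I p + primitiveCLM u)) :=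
    (contDiff_superposition Q hQ).comp (contDiff_const.add (primitiveCLM (E := E)).contDiff)
  have h2 := contDiff_pointwiseBilin (K := I) B₁ (n := ∞)
  have h3 := contDiff_pointwiseBilin (K := I) B₂ (n := ∞)
  exact h3.comp ((h2.comp h1).clm_apply contDiff_id)

theorem contDiff_sprayOperator (B₁ : F →L[ℝ] E →L[ℝ] G) (B₂ : G →L[ℝ] E →L[ℝ] E)
    (Q : C(E, F)) (hQ : ContDiff ℝ ∞ Q) (p : E) : ContDiff ℝ ∞ (sprayOperator B₁ B₂ Q p) :=
  (contDiff_sprayOperator_aux B₁ B₂ Q hQ p).clm_apply contDiff_id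

/-- Two factors of the velocity make the operator vanish to second order at 0. The velocity equation
is thus a perturbation of the identity there. -/
theorem hasFDerivAt_sprayOperator_zero (B₁ : F →L[ℝ] E →L[ℝ] G) (B₂ : G →L[ℝ] E →L[ℝ] E)
    (Q : C(E, F)) (hQ : ContDiff ℝ ∞ Q) (p : E) :
    HasFDerivAt (sprayOperator B₁ B₂ Q p) (0 : C(I, E) →L[ℝ] C(I, E)) 0 := by
  have h2 := contDiff_sprayOperator_aux B₁ B₂ Q hQ p
  have h3 := ((h2.differentiable (by simp)) 0).hasFDerivAt.clm_apply (hasFDerivAt_id (0 : C(I, E)))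
  refine h3.congr_fderiv ?_
  ext u t
  simp

/-- The slowed down velocity of a solution of the spray equation is again a solution. -/
theorem sprayOperator_slowDown (B₁ : F →L[ℝ] E →L[ℝ] G) (B₂ : G →L[ℝ] E →L[ℝ] E) (Q : C(E, F))
    (p : E) (u : C(I, E)) (τ : I) :
    sprayOperator B₁ B₂ Q p ((τ : ℝ) • slowDown τ u)
      = (τ : ℝ) • ((τ : ℝ) • slowDown τ (sprayOperator B₁ B₂ Q p u)) := by
  ext s
  rw [sprayOperator_apply, primitiveCLM_slowDown]
  simp [slowDown_apply, sprayOperator_apply]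

/-- The exponential map at `p` of the spray `B₂ (B₁ (Q x) v) v`. -/
theorem exists_spray_exp [CompleteSpace E] (B₁ : F →L[ℝ] E →L[ℝ] G) (B₂ : G →L[ℝ] E →L[ℝ] E)
    (Q : E → F) (hQ : ContDiff ℝ ∞ Q) (p : E) :
    ∃ e : E → E, ∃ r > 0, ContDiffOn ℝ ∞ e (Metric.ball 0 r) ∧ e 0 = p ∧
      HasFDerivAt e (ContinuousLinearMap.id ℝ E) 0 ∧
      ∀ z ∈ Metric.ball (0 : E) r, fderiv ℝ (fderiv ℝ e) z z z
        = B₂ (B₁ (Q (e z)) (fderiv ℝ e z z)) (fderiv ℝ e z z) := by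
  let Qc : C(E, F) := ⟨Q, hQ.continuous⟩
  let W := sprayOperator B₁ B₂ Qc p
  -- For constant v, `Ψ u = v` is the spray equation integrated once: u is the velocity of the
  -- solution starting at `p` with initial velocity v.
  let Ψ : C(I, E) → C(I, E) := fun u => u - primitiveCLM (W u)
  have hΨ : ContDiff ℝ ∞ Ψ :=
    contDiff_id.sub ((primitiveCLM (E := E)).contDiff.comp (contDiff_sprayOperator B₁ B₂ Qc hQ p))
  have hΨd : HasFDerivAt Ψ ((ContinuousLinearEquiv.refl ℝ C(I, E) : C(I, E) ≃L[ℝ] C(I, E)) :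
      C(I, E) →L[ℝ] C(I, E)) 0 := by
    have := (hasFDerivAt_id (0 : C(I, E))).sub
      ((primitiveCLM (E := E)).hasFDerivAt.comp 0 (hasFDerivAt_sprayOperator_zero B₁ B₂ Qc hQ p))
    refine this.congr_fderiv ?_
    ext; simp
  obtain ⟨f, hfΨ, hf0, -, hfs⟩ := exists_smooth_local_inverse isOpen_univ hΨ.contDiffOn
    (Set.mem_univ 0) hΨd
  have hΨ0 : Ψ 0 = 0 := by
    ext t
    simp only [Ψ, W, ContinuousMap.sub_apply, primitiveCLM_apply]
    simp [extendIcc, sprayOperator_apply]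
  have h0t : (0 : C(I, E)) ∈ f.target := by
    have := f.map_source hf0
    rwa [hfΨ, hΨ0] at this
  have hfs0 : f.symm 0 = 0 := by
    have := f.left_inv hf0
    rwa [hfΨ, hΨ0] at this
  let cst : E →L[ℝ] C(I, E) := LinearMap.mkContinuous
    { toFun := fun v => ContinuousMap.const I v
      map_add' := fun _ _ => rfl
      map_smul' := fun _ _ => rfl } 1
    (fun v => (ContinuousMap.norm_le _ (by positivity)).2 fun t => by simp; rfl)
  have hcst : ∀ v t, cst v t = v := fun _ _ => rfl
  obtain ⟨r₂, hr₂, hr₂s⟩ := Metric.isOpen_iff.1 f.open_source 0 hf0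
  obtain ⟨r, hr, hrball⟩ : ∃ r > 0, ∀ v : E, ‖v‖ < r →
      cst v ∈ f.target ∧ ‖f.symm (cst v)‖ < r₂ := by
    have h1 : ∀ᶠ v in 𝓝 (0 : E), cst v ∈ f.target :=
      cst.continuous.continuousAt.eventually_mem (f.open_target.mem_nhds (by simpa using h0t))
    have h2 : ContinuousAt (fun v => f.symm (cst v)) (0 : E) := by
      refine ContinuousAt.comp (g := f.symm) ?_ cst.continuous.continuousAt
      exact f.continuousAt_symm (by simpa using h0t)
    have h3 : ∀ᶠ v in 𝓝 (0 : E), ‖f.symm (cst v)‖ < r₂ := by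
      refine h2.norm.eventually_lt_const ?_
      simpa [hfs0] using hr₂
    obtain ⟨r, hr, h⟩ := Metric.eventually_nhds_iff_ball.1 (h1.and h3)
    exact ⟨r, hr, fun v hv => h v (by simpa using hv)⟩
  let e : E → E := fun v => p + primitiveCLM (f.symm (cst v)) 1
  let ev : C(I, E) →L[ℝ] E := ContinuousMap.evalCLM ℝ (1 : I)
  have he : e = fun v => p + ev (primitiveCLM (f.symm (cst v))) := rfl
  have hesmooth : ContDiffOn ℝ ∞ e (Metric.ball 0 r) := by
    rw [he]
    refine contDiffOn_const.add (ev.contDiff.comp_contDiffOn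
      ((primitiveCLM (E := E)).contDiff.comp_contDiffOn (hfs.comp cst.contDiff.contDiffOn ?_)))
    intro v hv
    exact (hrball v (by simpa using hv)).1
  have hed : HasFDerivAt e (ContinuousLinearMap.id ℝ E) 0 := by
    have h1 : HasFDerivAt f.symm ((ContinuousLinearEquiv.refl ℝ C(I, E)).symm :
        C(I, E) →L[ℝ] C(I, E)) (cst 0) := by
      refine f.hasFDerivAt_symm (by simpa using h0t) ?_
      rw [map_zero, hfs0, hfΨ]; exact hΨd
    have h2 := (ev.hasFDerivAt.comp (0 : E)
      ((primitiveCLM (E := E)).hasFDerivAt.comp (0 : E)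
      (h1.comp (0 : E) cst.hasFDerivAt))).const_add p
    refine h2.congr_fderiv ?_
    ext v
    simp [ev, primitiveCLM_apply, extendIcc, hcst]
  -- the radial curves
  have hrad : ∀ v : E, ‖v‖ < r → ∃ u : C(I, E), u - primitiveCLM (W u) = cst v ∧
      ∀ τ : I, e ((τ : ℝ) • v) = p + primitiveCLM u τ := by
    intro v hv
    have hu : Ψ (f.symm (cst v)) = cst v := by
      rw [← hfΨ]; exact f.right_inv (hrball v hv).1
    refine ⟨f.symm (cst v), hu, fun τ => ?_⟩
    set u := f.symm (cst v)
    have hW : Ψ ((τ : ℝ) • slowDown τ u) = cst ((τ : ℝ) • v) := by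
      ext s
      have hus : u (τ * s) - primitiveCLM (W u) (τ * s) = v := by
        have := DFunLike.congr_fun hu (τ * s)
        exact this
      simp only [Ψ, W]
      rw [sprayOperator_slowDown, map_smul, ContinuousMap.sub_apply, ContinuousMap.smul_apply,
        ContinuousMap.smul_apply, primitiveCLM_slowDown, slowDown_apply, ← smul_sub, hus, hcst]
    -- The local inverse recognizes solutions only inside `f.source`. Slowing down does not increase
    -- the sup norm, so the slowed solution stays in the ball of radius `r₂`.
    have hmem : (τ : ℝ) • slowDown τ u ∈ f.source := by
      apply hr₂s
      rw [mem_ball_zero_iff]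
      refine lt_of_le_of_lt ?_ (hrball v hv).2
      refine (ContinuousMap.norm_le _ (norm_nonneg _)).2 fun s => ?_
      rw [ContinuousMap.smul_apply, norm_smul, Real.norm_of_nonneg τ.2.1]
      exact (mul_le_of_le_one_left (norm_nonneg _) τ.2.2).trans (u.norm_coe_le_norm _)
    have : f.symm (cst ((τ : ℝ) • v)) = (τ : ℝ) • slowDown τ u := by
      rw [← hW, ← hfΨ]; exact f.left_inv hmem
    simp only [e]
    rw [this, primitiveCLM_slowDown, mul_one]
  -- With the radius halved, `z` is the midpoint of the radial line to `2 • z`, so all derivatives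
  -- along that line are taken at an interior time.
  refine ⟨e, r / 2, half_pos hr, hesmooth.mono (Metric.ball_subset_ball (by linarith)), ?_, hed, ?_⟩
  · simp only [e, map_zero, hfs0]; simp
  intro z hz
  have hv : ‖(2 : ℝ) • z‖ < r := by
    rw [norm_smul, Real.norm_ofNat]; have := mem_ball_zero_iff.1 hz; linarith
  obtain ⟨u, hu, hue⟩ := hrad _ hv
  set v := (2 : ℝ) • z with hvdef
  have hat : ∀ t ∈ Set.Ioo (0 : ℝ) 1, ContDiffAt ℝ ∞ e (t • v) := by
    intro t ht
    refine hesmooth.contDiffAt (Metric.isOpen_ball.mem_nhds ?_)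
    rw [mem_ball_zero_iff, norm_smul, Real.norm_of_nonneg ht.1.le]
    exact (mul_le_of_le_one_left (norm_nonneg _) ht.2.le).trans_lt hv
  have hline : ∀ t : ℝ, HasDerivAt (fun t : ℝ => t • v) v t := fun t => by
    simpa using (hasDerivAt_id t).smul_const v
  have hI : ∀ t ∈ Set.Ioo (0 : ℝ) 1, t ∈ I := fun t ht => ⟨ht.1.le, ht.2.le⟩
  have hvel : ∀ t ∈ Set.Ioo (0 : ℝ) 1, fderiv ℝ e (t • v) v = extendIcc u t := by
    intro t ht
    have h1 : HasDerivAt (fun t : ℝ => e (t • v)) (fderiv ℝ e (t • v) v) t :=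
      HasFDerivAt.comp_hasDerivAt (l := e) t
        ((hat t ht).differentiableAt (by simp)).hasFDerivAt (hline t)
    have h2 := (hasDerivAt_primitive u t).const_add p
    refine h1.unique (h2.congr_of_eventuallyEq ?_)
    filter_upwards [Ioo_mem_nhds ht.1 ht.2] with s hs
    exact hue ⟨s, hI s hs⟩
  have hhalf : (1 / 2 : ℝ) ∈ Set.Ioo (0 : ℝ) 1 := by norm_num
  have hz2 : (1 / 2 : ℝ) • v = z := by rw [hvdef, smul_smul]; norm_num
  have hd2 : HasDerivAt (fun t : ℝ => fderiv ℝ e (t • v) v)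
      (fderiv ℝ (fderiv ℝ e) z v v) (1 / 2) := by
    have h1 : DifferentiableAt ℝ (fderiv ℝ e) ((1 / 2 : ℝ) • v) :=
      ((hat _ hhalf).fderiv_right (m := 1) (by norm_cast)).differentiableAt (by simp)
    have h2 := h1.hasFDerivAt.comp_hasDerivAt (1 / 2 : ℝ) (hline (1 / 2))
    have h3 := h2.clm_apply (hasDerivAt_const (1 / 2 : ℝ) v)
    rw [hz2] at h3
    simpa using h3
  have hd2' : HasDerivAt (fun t : ℝ => fderiv ℝ e (t • v) v)
      (extendIcc (W u) (1 / 2)) (1 / 2) := by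
    have h2 := (hasDerivAt_primitive (W u) (1 / 2)).const_add v
    refine h2.congr_of_eventuallyEq ?_
    filter_upwards [Ioo_mem_nhds hhalf.1 hhalf.2] with s hs
    rw [hvel s hs, extendIcc_of_mem _ (hI s hs)]
    have := DFunLike.congr_fun hu ⟨s, hI s hs⟩
    rw [ContinuousMap.sub_apply, hcst, sub_eq_iff_eq_add] at this
    exact this
  have hkey := hd2.unique hd2'
  have huhalf : u ⟨1 / 2, hI _ hhalf⟩ = (2 : ℝ) • fderiv ℝ e z z := by
    rw [← extendIcc_of_mem, ← hvel _ hhalf, hz2, hvdef, map_smul]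
  rw [extendIcc_of_mem _ (hI _ hhalf)] at hkey
  simp only [W] at hkey
  rw [sprayOperator_apply, ← hue] at hkey
  simp only [hz2, huhalf] at hkey
  rw [hvdef] at hkey
  simp only [map_smul, smul_apply, smul_smul] at hkey
  have := smul_right_injective E (show (2 * 2 : ℝ) ≠ 0 by norm_num) hkey
  exact this

end Spray

/-! ## The Gauss lemma -/

section Gauss

set_option synthInstance.maxHeartbeats 200000
attribute [local instance] ContinuousLinearMap.toNormedAddCommGroup
  ContinuousLinearMap.toNormedSpace

universe u

variable {E : Type u} [NormedAddCommGroup E] [NormedSpace ℝ E] [FiniteDimensional ℝ E]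

/-- A positive definite bilinear form, as an isomorphism onto the dual space. -/
theorem exists_equiv_of_posDef (B : E →L[ℝ] E →L[ℝ] ℝ) (hB : ∀ v, v ≠ 0 → 0 < B v v) :
    ∃ L : E ≃L[ℝ] (E →L[ℝ] ℝ), (L : E →L[ℝ] E →L[ℝ] ℝ) = B := by
  have hinj : Function.Injective (B : E →ₗ[ℝ] E →L[ℝ] ℝ) := by
    rw [← LinearMap.ker_eq_bot, LinearMap.ker_eq_bot']
    intro v hv
    by_contra hne
    have h := hB v hne
    have h0 : B v = 0 := hv
    rw [h0] at h
    simp at h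
  have hdim : Module.finrank ℝ E = Module.finrank ℝ (E →L[ℝ] ℝ) := by
    rw [← (LinearMap.toContinuousLinearMap (𝕜 := ℝ) (E := E) (F' := ℝ)).finrank_eq]
    exact (Subspace.dual_finrank_eq (K := ℝ) (V := E)).symm
  refine ⟨(LinearMap.linearEquivOfInjective _ hinj hdim).toContinuousLinearEquiv, ?_⟩
  ext v w
  rfl

/-- The bilinear map obtained from a trilinear form by raising an index in the combination that
defines the geodesic equation. -/
theorem exists_bilin_christoffel (D : E →L[ℝ] E →L[ℝ] E →L[ℝ] ℝ) (S : (E →L[ℝ] ℝ) →L[ℝ] E)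
    (C : E → E → E →L[ℝ] ℝ) (hC : ∀ v v' w, C v v' w = 1 / 2 * D w v v' - D v v' w) :
    ∃ Γ : E →L[ℝ] E →L[ℝ] E, ∀ v v', Γ v v' = S (C v v') := by
  have h1 : ∀ a b c, C (a + b) c = C a c + C b c := by
    intro a b c
    ext w
    have e1 : D w (a + b) c = D w a c + D w b c := by rw [map_add]; rfl
    have e2 : D (a + b) c w = D a c w + D b c w := by rw [map_add]; rfl
    change _ = C a c w + C b c w
    rw [hC, hC, hC, e1, e2]; ring
  have h2 : ∀ (k : ℝ) a c, C (k • a) c = k • C a c := by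
    intro k a c
    ext w
    have e1 : D w (k • a) c = k * D w a c := by rw [map_smul]; rfl
    have e2 : D (k • a) c w = k * D a c w := by rw [map_smul]; rfl
    change _ = k * C a c w
    rw [hC, hC, e1, e2]; ring
  have h3 : ∀ a b c, C a (b + c) = C a b + C a c := by
    intro a b c
    ext w
    have e1 : D w a (b + c) = D w a b + D w a c := map_add _ _ _
    have e2 : D a (b + c) w = D a b w + D a c w := by rw [map_add]; rfl
    change _ = C a b w + C a c w
    rw [hC, hC, hC, e1, e2]; ring
  have h4 : ∀ (k : ℝ) a c, C a (k • c) = k • C a c := by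
    intro k a c
    ext w
    have e1 : D w a (k • c) = k * D w a c := map_smul _ _ _
    have e2 : D a (k • c) w = k * D a c w := by rw [map_smul]; rfl
    change _ = k * C a c w
    rw [hC, hC, e1, e2]; ring
  exact ⟨LinearMap.toContinuousBilinearMap (LinearMap.mk₂ ℝ (fun v v' => S (C v v'))
    (fun a b c => by rw [h1, map_add]) (fun k a b => by rw [h2, map_smul])
    (fun a b c => by rw [h3, map_add]) (fun k a b => by rw [h4, map_smul])), fun v v' => rfl⟩

/-- The germ of a smooth map extends smoothly to the whole space. -/
theorem exists_smooth_extension {F : Type*} [NormedAddCommGroup F] [NormedSpace ℝ F] {U : Set E}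
    (hU : IsOpen U) {f : E → F} (hf : ContDiffOn ℝ ∞ f U) {p : E} (hp : p ∈ U) :
    ∃ g : E → F, ContDiff ℝ ∞ g ∧ g =ᶠ[𝓝 p] f := by
  obtain ⟨ε, hε, hεU⟩ := Metric.isOpen_iff.1 hU p hp
  let χ : ContDiffBump p := ⟨ε / 4, ε / 2, by linarith, by linarith⟩
  refine ⟨fun x => χ x • f x, ?_, ?_⟩
  · rw [contDiff_iff_contDiffAt]
    intro x
    by_cases hx : x ∈ U
    · exact χ.contDiff.contDiffAt.smul (hf.contDiffAt (hU.mem_nhds hx))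
    · have hx' : x ∉ tsupport χ := by
        rw [χ.tsupport_eq]
        intro h
        exact hx (hεU (Metric.closedBall_subset_ball (by change ε / 2 < ε; linarith) h))
      have h0 : (fun x => χ x • f x) =ᶠ[𝓝 x] fun _ => 0 := by
        have := notMem_tsupport_iff_eventuallyEq.1 hx'
        filter_upwards [this] with y hy
        rw [hy]; simp
      exact contDiffAt_const.congr_of_eventuallyEq h0
  · filter_upwards [Metric.closedBall_mem_nhds p χ.rIn_pos] with x hx
    rw [χ.one_of_mem_closedBall hx, one_smul]

/-- The geodesic spray of a metric, extended smoothly to the whole space. -/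
theorem exists_geodesic_spray {U : Set E} (hU : IsOpen U) (G : E → E →L[ℝ] E →L[ℝ] ℝ)
    (hG : ContDiffOn ℝ ∞ G U) (hpos : ∀ x ∈ U, ∀ v, v ≠ 0 → 0 < G x v v) {p : E} (hp : p ∈ U) :
    ∃ Q : E → E →L[ℝ] E →L[ℝ] E, ContDiff ℝ ∞ Q ∧ ∀ᶠ x in 𝓝 p, ∀ v w,
      G x (Q x v v) w = 1 / 2 * fderiv ℝ G x w v v - fderiv ℝ G x v v w := by
  have hD : ∀ a, ContDiffOn ℝ ∞ (fun x => fderiv ℝ G x a) U := fun a =>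
    (hG.fderiv_of_isOpen hU (m := ∞) (by norm_cast)).clm_apply contDiffOn_const
  -- This is the right side of the Euler–Lagrange equation of the energy, G(c'', w) = ½ D_wG(c', c')
  -- - D_{c'}G(c', w). Only its values on the diagonal matter, so it need not be symmetrized.
  let C : E → E → E → E →L[ℝ] ℝ := fun x v v' =>
    (1 / 2 : ℝ) • (((ContinuousLinearMap.apply ℝ ℝ v').comp
      (ContinuousLinearMap.apply ℝ (E →L[ℝ] ℝ) v)).comp (fderiv ℝ G x)) - fderiv ℝ G x v v'
  have hCv : ∀ x v v' w, C x v v' w = 1 / 2 * fderiv ℝ G x w v v' - fderiv ℝ G x v v' w :=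
    fun x v v' w => rfl
  have hC : ∀ v v', ContDiffOn ℝ ∞ (fun x => C x v v') U := by
    intro v v'
    rw [contDiffOn_clm_apply]
    intro w
    exact (contDiffOn_const.mul (((hD w).clm_apply contDiffOn_const).clm_apply
      contDiffOn_const)).sub (((hD v).clm_apply contDiffOn_const).clm_apply contDiffOn_const)
  -- `inverse` takes the value zero at non-invertible maps; it matters only on `U`, where positivity
  -- makes `G x` invertible.
  choose Γ hΓv using fun x => exists_bilin_christoffel (fderiv ℝ G x) (G x).inverse (C x) (hCv x)
  have hinv : ContDiffOn ℝ ∞ (fun x => (G x).inverse) U := by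
    intro x hx
    obtain ⟨L, hL⟩ := exists_equiv_of_posDef (G x) (hpos x hx)
    have h1 : ContDiffAt ℝ ∞ ContinuousLinearMap.inverse (G x) := by
      rw [← hL]; exact contDiffAt_map_inverse L
    exact h1.comp_contDiffWithinAt x (hG x hx)
  have hΓ : ContDiffOn ℝ ∞ Γ U := by
    rw [contDiffOn_clm_apply]
    intro v
    rw [contDiffOn_clm_apply]
    intro v'
    simp only [hΓv]
    exact hinv.clm_apply (hC v v')
  obtain ⟨Q, hQ, hQΓ⟩ := exists_smooth_extension hU hΓ hp
  refine ⟨Q, hQ, ?_⟩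
  filter_upwards [hQΓ, hU.mem_nhds hp] with x hx hxU v w
  obtain ⟨L, hL⟩ := exists_equiv_of_posDef (G x) (hpos x hxU)
  rw [hx, hΓv, ← hL, ContinuousLinearMap.inverse_equiv]
  have h3 : (L : E →L[ℝ] E →L[ℝ] ℝ) ((L.symm : (E →L[ℝ] ℝ) →L[ℝ] E) (C x v v)) = C x v v :=
    L.apply_symm_apply _
  rw [h3, hCv]

/-- Energy is constant along radial geodesics. -/
theorem radial_energy {U : Set E} (hU : IsOpen U) (G : E → E →L[ℝ] E →L[ℝ] ℝ)
    (hG : ContDiffOn ℝ ∞ G U) (hsymm : ∀ x ∈ U, ∀ v w, G x v w = G x w v)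
    {Q : E → E →L[ℝ] E →L[ℝ] E}
    (hQ : ∀ x ∈ U, ∀ v w, G x (Q x v v) w = 1 / 2 * fderiv ℝ G x w v v - fderiv ℝ G x v v w)
    {e : E → E} {r : ℝ} (he : ContDiffOn ℝ ∞ e (Metric.ball 0 r))
    (heU : Set.MapsTo e (Metric.ball 0 r) U)
    (hed : HasFDerivAt e (ContinuousLinearMap.id ℝ E) 0)
    (hgeo : ∀ z ∈ Metric.ball (0 : E) r, fderiv ℝ (fderiv ℝ e) z z z
        = Q (e z) (fderiv ℝ e z z) (fderiv ℝ e z z)) {z : E} (hz : z ∈ Metric.ball (0 : E) r) :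
    G (e z) (fderiv ℝ e z z) (fderiv ℝ e z z) = G (e 0) z z ∧
    ∀ t ∈ Set.Ioo (0 : ℝ) 1, fderiv ℝ (fderiv ℝ e) (t • z) z z
        = Q (e (t • z)) (fderiv ℝ e (t • z) z) (fderiv ℝ e (t • z) z) := by
  have hball : ∀ t ∈ Set.Icc (0 : ℝ) 1, t • z ∈ Metric.ball (0 : E) r := by
    intro t ht
    rw [mem_ball_zero_iff, norm_smul, Real.norm_of_nonneg ht.1]
    exact (mul_le_of_le_one_left (norm_nonneg _) ht.2).trans_lt (mem_ball_zero_iff.1 hz)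
  have hat : ∀ x ∈ Metric.ball (0 : E) r, ContDiffAt ℝ ∞ e x := fun x hx =>
    he.contDiffAt (Metric.isOpen_ball.mem_nhds hx)
  have hgeo' : ∀ t ∈ Set.Ioo (0 : ℝ) 1, fderiv ℝ (fderiv ℝ e) (t • z) z z
        = Q (e (t • z)) (fderiv ℝ e (t • z) z) (fderiv ℝ e (t • z) z) := by
    intro t ht
    have := hgeo _ (hball t ⟨ht.1.le, ht.2.le⟩)
    simp only [map_smul, smul_apply, smul_smul] at this
    exact smul_right_injective E (mul_ne_zero ht.1.ne' ht.1.ne') this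
  refine ⟨?_, hgeo'⟩
  have hline : ∀ t : ℝ, HasDerivAt (fun t : ℝ => t • z) z t := fun t => by
    simpa using (hasDerivAt_id t).smul_const z
  have hY : ∀ t ∈ Set.Icc (0 : ℝ) 1, HasDerivAt (fun t : ℝ => fderiv ℝ e (t • z) z)
      (fderiv ℝ (fderiv ℝ e) (t • z) z z) t := by
    intro t ht
    have h1 : DifferentiableAt ℝ (fderiv ℝ e) (t • z) :=
      ((hat _ (hball t ht)).fderiv_right (m := 1) (by norm_cast)).differentiableAt (by simp)
    have h2 := h1.hasFDerivAt.comp_hasDerivAt t (hline t)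
    simpa using h2.clm_apply (hasDerivAt_const t z)
  have hc : ∀ t ∈ Set.Icc (0 : ℝ) 1, HasDerivAt (fun t : ℝ => e (t • z))
      (fderiv ℝ e (t • z) z) t := fun t ht =>
    HasFDerivAt.comp_hasDerivAt (l := e) t
      ((hat _ (hball t ht)).differentiableAt (by simp)).hasFDerivAt (hline t)
  have hGc : ∀ t ∈ Set.Icc (0 : ℝ) 1, HasDerivAt (fun t : ℝ => G (e (t • z)))
      (fderiv ℝ G (e (t • z)) (fderiv ℝ e (t • z) z)) t := fun t ht =>
    HasFDerivAt.comp_hasDerivAt (l := G) t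
      ((hG.contDiffAt (hU.mem_nhds (heU (hball t ht)))).differentiableAt (by simp)).hasFDerivAt
      (hc t ht)
  have hk := fun t ht => ((hGc t ht).clm_apply (hY t ht)).clm_apply (hY t ht)
  -- With v the velocity, the derivative of the energy is DG(v)(v, v) + 2 G(Qvv, v), and `hQ` at w =
  -- v makes it vanish. The mean value theorem equates the energies at times 0 and 1.
  obtain ⟨t, ht, hslope⟩ := exists_hasDerivAt_eq_slope _ _ (zero_lt_one (α := ℝ))
    (fun t ht => (hk t ht).continuousAt.continuousWithinAt)
    (fun t ht => hk t ⟨ht.1.le, ht.2.le⟩)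
  have hmem := heU (hball t ⟨ht.1.le, ht.2.le⟩)
  rw [hgeo' t ht] at hslope
  simp only [add_apply] at hslope
  rw [hsymm _ hmem (fderiv ℝ e (t • z) z) (Q _ _ _), hQ _ hmem] at hslope
  simp only [one_smul, zero_smul, sub_zero, div_one, hed.fderiv] at hslope
  simp only [ContinuousLinearMap.id_apply] at hslope
  linarith

/-- The Gauss lemma for solutions of the geodesic equation in exponential form. -/
theorem gauss_lemma {U : Set E} (hU : IsOpen U) (G : E → E →L[ℝ] E →L[ℝ] ℝ)
    (hG : ContDiffOn ℝ ∞ G U) (hsymm : ∀ x ∈ U, ∀ v w, G x v w = G x w v)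
    {Q : E → E →L[ℝ] E →L[ℝ] E}
    (hQ : ∀ x ∈ U, ∀ v w, G x (Q x v v) w = 1 / 2 * fderiv ℝ G x w v v - fderiv ℝ G x v v w)
    {e : E → E} {r : ℝ} (he : ContDiffOn ℝ ∞ e (Metric.ball 0 r))
    (heU : Set.MapsTo e (Metric.ball 0 r) U)
    (hed : HasFDerivAt e (ContinuousLinearMap.id ℝ E) 0)
    (hgeo : ∀ z ∈ Metric.ball (0 : E) r, fderiv ℝ (fderiv ℝ e) z z z
        = Q (e z) (fderiv ℝ e z z) (fderiv ℝ e z z)) {z : E} (hz : z ∈ Metric.ball (0 : E) r)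
    (w : E) : G (e z) (fderiv ℝ e z z) (fderiv ℝ e z w) = G (e 0) z w := by
  have henergy : ∀ z ∈ Metric.ball (0 : E) r,
      G (e z) (fderiv ℝ e z z) (fderiv ℝ e z z) = G (e 0) z z := fun z hz =>
    (radial_energy hU G hG hsymm hQ he heU hed hgeo hz).1
  have hgeo' := (radial_energy hU G hG hsymm hQ he heU hed hgeo hz).2
  have hball : ∀ t ∈ Set.Icc (0 : ℝ) 1, t • z ∈ Metric.ball (0 : E) r := by
    intro t ht
    rw [mem_ball_zero_iff, norm_smul, Real.norm_of_nonneg ht.1]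
    exact (mul_le_of_le_one_left (norm_nonneg _) ht.2).trans_lt (mem_ball_zero_iff.1 hz)
  have hat : ∀ x ∈ Metric.ball (0 : E) r, ContDiffAt ℝ ∞ e x := fun x hx =>
    he.contDiffAt (Metric.isOpen_ball.mem_nhds hx)
  have hline : ∀ (z : E) (t : ℝ), HasDerivAt (fun t : ℝ => t • z) z t := fun z t => by
    simpa using (hasDerivAt_id t).smul_const z
  have hDe : ∀ x ∈ Metric.ball (0 : E) r,
      HasFDerivAt (fderiv ℝ e) (fderiv ℝ (fderiv ℝ e) x) x := fun x hx =>
    (((hat _ hx).fderiv_right (m := 1) (by norm_cast)).differentiableAt (by simp)).hasFDerivAt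
  have hee : ∀ x ∈ Metric.ball (0 : E) r, HasFDerivAt e (fderiv ℝ e x) x := fun x hx =>
    ((hat _ hx).differentiableAt (by simp)).hasFDerivAt
  have hGG : ∀ x ∈ Metric.ball (0 : E) r, HasFDerivAt G (fderiv ℝ G (e x)) (e x) := fun x hx =>
    ((hG.contDiffAt (hU.mem_nhds (heU hx))).differentiableAt (by simp)).hasFDerivAt
  -- the variation of the energy
  have hvar : ∀ x ∈ Metric.ball (0 : E) r, ∀ w,
      fderiv ℝ G (e x) (fderiv ℝ e x w) (fderiv ℝ e x x) (fderiv ℝ e x x)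
        + 2 * G (e x) (fderiv ℝ e x x) (fderiv ℝ (fderiv ℝ e) x w x + fderiv ℝ e x w)
        = 2 * G (e 0) x w := by
    intro x hx w
    have hl : HasDerivAt (fun s : ℝ => x + s • w) w 0 := (hline w 0).const_add x
    have hx0 : x + (0 : ℝ) • w = x := by simp
    have h1 : HasDerivAt (fun s : ℝ => e (x + s • w)) (fderiv ℝ e x w) 0 := by
      refine HasFDerivAt.comp_hasDerivAt (l := e) 0 ?_ hl
      rw [hx0]; exact hee x hx
    have h2 : HasDerivAt (fun s : ℝ => G (e (x + s • w)))
        (fderiv ℝ G (e x) (fderiv ℝ e x w)) 0 := by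
      refine HasFDerivAt.comp_hasDerivAt (l := G) 0 ?_ h1
      rw [hx0]; exact hGG x hx
    have h3 : HasDerivAt (fun s : ℝ => fderiv ℝ e (x + s • w))
        (fderiv ℝ (fderiv ℝ e) x w) 0 := by
      refine HasFDerivAt.comp_hasDerivAt (l := fderiv ℝ e) 0 ?_ hl
      rw [hx0]; exact hDe x hx
    have h4 := h3.clm_apply hl
    have h5 := (h2.clm_apply h4).clm_apply h4
    have h6 : HasDerivAt (fun s : ℝ => G (e 0) (x + s • w) (x + s • w))
        (G (e 0) w x + G (e 0) x w) 0 := by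
      have := ((hasDerivAt_const (0 : ℝ) (G (e 0))).clm_apply hl).clm_apply hl
      simpa using this
    have h7 : (fun s : ℝ => G (e (x + s • w)) (fderiv ℝ e (x + s • w) (x + s • w))
        (fderiv ℝ e (x + s • w) (x + s • w))) =ᶠ[𝓝 0]
        fun s : ℝ => G (e 0) (x + s • w) (x + s • w) := by
      have : ∀ᶠ s in 𝓝 (0 : ℝ), x + s • w ∈ Metric.ball (0 : E) r := by
        refine hl.continuousAt.eventually_mem (Metric.isOpen_ball.mem_nhds ?_)
        rw [hx0]; exact hx
      filter_upwards [this] with s hs using henergy _ hs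
    have h8 := h5.unique (h6.congr_of_eventuallyEq h7)
    have hmem := heU hx
    have hmem0 := heU (hball 0 ⟨le_rfl, zero_le_one⟩)
    rw [zero_smul] at hmem0
    simp only [hx0, add_apply, map_add] at h8
    rw [hsymm _ hmem0 w x, hsymm _ hmem (fderiv ℝ (fderiv ℝ e) x w x),
      hsymm _ hmem (fderiv ℝ e x w)] at h8
    simp only [map_add]
    linarith
  have hc : ∀ t ∈ Set.Icc (0 : ℝ) 1, HasDerivAt (fun t : ℝ => e (t • z))
      (fderiv ℝ e (t • z) z) t := fun t ht =>
    HasFDerivAt.comp_hasDerivAt (l := e) t (hee _ (hball t ht)) (hline z t)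
  have hDc : ∀ t ∈ Set.Icc (0 : ℝ) 1, HasDerivAt (fun t : ℝ => fderiv ℝ e (t • z))
      (fderiv ℝ (fderiv ℝ e) (t • z) z) t := fun t ht =>
    (hDe _ (hball t ht)).comp_hasDerivAt t (hline z t)
  have hGc : ∀ t ∈ Set.Icc (0 : ℝ) 1, HasDerivAt (fun t : ℝ => G (e (t • z)))
      (fderiv ℝ G (e (t • z)) (fderiv ℝ e (t • z) z)) t := fun t ht =>
    HasFDerivAt.comp_hasDerivAt (l := G) t (hGG _ (hball t ht)) (hc t ht)
  have hY := fun t ht => (hDc t ht).clm_apply (hasDerivAt_const t z)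
  have hJ := fun t ht => (hDc t ht).clm_apply (hline w t)
  have hh := fun t ht => ((hGc t ht).clm_apply (hY t ht)).clm_apply (hJ t ht)
  -- The function t ↦ G(∂ₜe(tz), de(tz)(tw)) vanishes at 0 and has the desired left side as its
  -- value at 1. The variation formula `hvar` at tz and the symmetry of the second derivative show
  -- that its derivative is the constant G(z, w) at the base point.
  obtain ⟨t, ht, hslope⟩ := exists_hasDerivAt_eq_slope _ _ (zero_lt_one (α := ℝ))
    (fun t ht => (hh t ht).continuousAt.continuousWithinAt)
    (fun t ht => hh t ⟨ht.1.le, ht.2.le⟩)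
  have htI : t ∈ Set.Icc (0 : ℝ) 1 := ⟨ht.1.le, ht.2.le⟩
  have hmem := heU (hball t htI)
  have hle : (2 : WithTop ℕ∞) ≤ ∞ := WithTop.coe_le_coe.2 (le_top : (2 : ℕ∞) ≤ ⊤)
  have hsnd := ((hat _ (hball t htI)).isSymmSndFDerivAt
    (by rw [minSmoothness_of_isRCLikeNormedField]; exact hle)).eq z w
  have hv := hvar _ (hball t htI) w
  simp only [one_smul, zero_smul, sub_zero, div_one, map_zero, add_zero, add_apply, map_smul,
    smul_apply, smul_eq_mul] at hslope hv
  rw [hgeo' t ht, hQ _ hmem, hsnd] at hslope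
  simp only [map_add, map_smul, smul_eq_mul] at hslope hv
  have ht0 := ht.1.ne'
  rw [← hslope]
  apply mul_left_cancel₀ ht0
  linarith

/-- Normal coordinates for a metric on an open subset of a vector space. -/
theorem exists_normal_coordinates {U : Set E} (hU : IsOpen U) (G : E → E →L[ℝ] E →L[ℝ] ℝ)
    (hG : ContDiffOn ℝ ∞ G U) (hsymm : ∀ x ∈ U, ∀ v w, G x v w = G x w v)
    (hpos : ∀ x ∈ U, ∀ v, v ≠ 0 → 0 < G x v v) {p : E} (hp : p ∈ U) :
    ∃ f : OpenPartialHomeomorph E E, 0 ∈ f.source ∧ f 0 = p ∧ f.target ⊆ U ∧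
      ContDiffOn ℝ ∞ f f.source ∧ ContDiffOn ℝ ∞ f.symm f.target ∧
      HasFDerivAt f (ContinuousLinearMap.id ℝ E) 0 ∧
      ∀ z ∈ f.source, ∀ w, G (f z) (fderiv ℝ f z z) (fderiv ℝ f z w) = G p z w := by
  obtain ⟨Q, hQ, hQG⟩ := exists_geodesic_spray hU G hG hpos hp
  obtain ⟨V, hV, hVopen, hpV⟩ := eventually_nhds_iff.1 hQG
  obtain ⟨e, r, hr, he, he0, hed, hgeo⟩ := exists_spray_exp
    (ContinuousLinearMap.id ℝ (E →L[ℝ] E →L[ℝ] E)) (ContinuousLinearMap.id ℝ (E →L[ℝ] E)) Q hQ p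
  have hcont : ContinuousAt e 0 := hed.continuousAt
  have hnhds : e ⁻¹' (U ∩ V) ∈ 𝓝 (0 : E) := hcont.preimage_mem_nhds (by
    rw [he0]; exact (hU.inter hVopen).mem_nhds ⟨hp, hpV⟩)
  obtain ⟨r', hr', hball⟩ := Metric.mem_nhds_iff.1
    (Filter.inter_mem hnhds (Metric.ball_mem_nhds 0 hr))
  have hsub : Metric.ball (0 : E) r' ⊆ Metric.ball 0 r := fun x hx => (hball hx).2
  have he' := he.mono hsub
  obtain ⟨f, hfe, hf0, hfs, hfsymm⟩ := exists_smooth_local_inverse (L := .refl ℝ E)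
    Metric.isOpen_ball he' (Metric.mem_ball_self hr') hed
  have hUV : IsOpen (U ∩ V) := hU.inter hVopen
  refine ⟨f, hf0, by rw [hfe, he0], ?_, by rw [hfe]; exact he'.mono hfs, hfsymm,
    by rw [hfe]; exact hed, ?_⟩
  · intro y hy
    have h1 := (hball (hfs (f.map_target hy))).1.1
    rwa [← hfe, f.right_inv hy] at h1
  · intro z hz w
    rw [hfe, ← he0]
    exact gauss_lemma hUV G (hG.mono Set.inter_subset_left) (fun x hx => hsymm x hx.1)
      (fun x hx => hV x hx.2) he' (fun x hx => (hball hx).1) hed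
      (fun x hx => hgeo x (hsub hx)) (hfs hz) w

end Gauss

/-! ## The Riemannian metric in charts -/

section ChartMetric

set_option synthInstance.maxHeartbeats 200000

universe u

variable {E : Type u} [NormedAddCommGroup E] [NormedSpace ℝ E]
  {M : Type*} [MetricSpace M] [ChartedSpace E M]
  [Bundle.RiemannianBundle (fun x : M => TangentSpace 𝓘(ℝ, E) x)]

/-- A vector of the model space, as a tangent vector at `x`. -/
def toTangent (x : M) (a : E) : TangentSpace 𝓘(ℝ, E) x := a

/-- The Riemannian metric at `x`, as a function on the model space. -/
noncomputable def metricAt (x : M) (a b : E) : ℝ := inner ℝ (toTangent x a) (toTangent x b)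

/-- The Riemannian norm at `x`, as a function on the model space. -/
noncomputable def normAt (x : M) (a : E) : ℝ := ‖toTangent x a‖

theorem metricAt_comm (x : M) (a b : E) : metricAt x a b = metricAt x b a :=
  real_inner_comm (toTangent x b) (toTangent x a)

theorem metricAt_add_left (x : M) (a b c : E) :
    metricAt x (a + b) c = metricAt x a c + metricAt x b c :=
  inner_add_left (toTangent x a) (toTangent x b) (toTangent x c)

theorem metricAt_smul_left (x : M) (k : ℝ) (a b : E) :
    metricAt x (k • a) b = k * metricAt x a b :=
  real_inner_smul_left (toTangent x a) (toTangent x b) k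

theorem metricAt_self (x : M) (a : E) : metricAt x a a = normAt x a ^ 2 :=
  real_inner_self_eq_norm_sq (toTangent x a)

theorem abs_metricAt_le (x : M) (a b : E) : |metricAt x a b| ≤ normAt x a * normAt x b :=
  abs_real_inner_le_norm (toTangent x a) (toTangent x b)

theorem normAt_nonneg (x : M) (a : E) : 0 ≤ normAt x a := norm_nonneg (toTangent x a)

theorem normAt_eq_zero {x : M} {a : E} : normAt x a = 0 ↔ a = 0 :=
  norm_eq_zero (a := toTangent x a)

theorem normAt_smul (x : M) (k : ℝ) (a : E) : normAt x (k • a) = |k| * normAt x a :=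
  norm_smul k (toTangent x a)

/-- The derivative of the inverse of the chart `φ`. -/
noncomputable def chartSymmDeriv (φ : OpenPartialHomeomorph M E) (y : E) : E →L[ℝ] E :=
  mfderiv 𝓘(ℝ, E) 𝓘(ℝ, E) φ.symm y

/-- The derivative of the chart `φ`. -/
noncomputable def chartDeriv (φ : OpenPartialHomeomorph M E) (x : M) : E →L[ℝ] E :=
  mfderiv 𝓘(ℝ, E) 𝓘(ℝ, E) φ x

/-- The expression of the Riemannian metric in the chart `φ`. -/
noncomputable def chartMetric [FiniteDimensional ℝ E] (φ : OpenPartialHomeomorph M E) (y : E) :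
    E →L[ℝ] E →L[ℝ] ℝ :=
  LinearMap.toContinuousBilinearMap (LinearMap.mk₂ ℝ
    (fun a b => metricAt (φ.symm y) (chartSymmDeriv φ y a) (chartSymmDeriv φ y b))
    (fun a b c => by rw [map_add, metricAt_add_left])
    (fun k a b => by rw [map_smul, metricAt_smul_left, smul_eq_mul])
    (fun a b c => by
      rw [map_add, metricAt_comm, metricAt_add_left, metricAt_comm, add_right_inj, metricAt_comm])
    (fun k a b => by rw [map_smul, metricAt_comm, metricAt_smul_left, smul_eq_mul, metricAt_comm]))

variable [FiniteDimensional ℝ E]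

theorem chartMetric_apply (φ : OpenPartialHomeomorph M E) (y a b : E) :
    chartMetric φ y a b
      = metricAt (φ.symm y) (chartSymmDeriv φ y a) (chartSymmDeriv φ y b) := rfl

theorem chartMetric_comm (φ : OpenPartialHomeomorph M E) (y a b : E) :
    chartMetric φ y a b = chartMetric φ y b a := metricAt_comm _ _ _

theorem chartMetric_self (φ : OpenPartialHomeomorph M E) (y a : E) :
    chartMetric φ y a a = normAt (φ.symm y) (chartSymmDeriv φ y a) ^ 2 := metricAt_self _ _

theorem chartMetric_self_nonneg (φ : OpenPartialHomeomorph M E) (y a : E) :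
    0 ≤ chartMetric φ y a a := by rw [chartMetric_self]; positivity

theorem sqrt_chartMetric_self (φ : OpenPartialHomeomorph M E) (y a : E) :
    √(chartMetric φ y a a) = normAt (φ.symm y) (chartSymmDeriv φ y a) := by
  rw [chartMetric_self, Real.sqrt_sq (normAt_nonneg _ _)]

theorem abs_chartMetric_le (φ : OpenPartialHomeomorph M E) (y a b : E) :
    |chartMetric φ y a b| ≤ √(chartMetric φ y a a) * √(chartMetric φ y b b) := by
  rw [sqrt_chartMetric_self, sqrt_chartMetric_self]
  exact abs_metricAt_le _ _ _

variable [IsManifold 𝓘(ℝ, E) ∞ M]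

theorem mem_maximalAtlas_one {φ : OpenPartialHomeomorph M E}
    (hφ : φ ∈ IsManifold.maximalAtlas 𝓘(ℝ, E) ∞ M) : φ ∈ IsManifold.maximalAtlas 𝓘(ℝ, E) 1 M :=
  IsManifold.maximalAtlas_subset_of_le (by simp) hφ

theorem mdifferentiable_of_mem_maximalAtlas {φ : OpenPartialHomeomorph M E}
    (hφ : φ ∈ IsManifold.maximalAtlas 𝓘(ℝ, E) ∞ M) : φ.MDifferentiable 𝓘(ℝ, E) 𝓘(ℝ, E) :=
  ⟨fun _ hx => (mdifferentiableAt_of_mem_maximalAtlas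
      (mem_maximalAtlas_one hφ) hx).mdifferentiableWithinAt,
    fun _ hx => (mdifferentiableAt_symm_of_mem_maximalAtlas
      (mem_maximalAtlas_one hφ) hx).mdifferentiableWithinAt⟩

theorem chartDeriv_chartSymmDeriv {φ : OpenPartialHomeomorph M E}
    (hφ : φ ∈ IsManifold.maximalAtlas 𝓘(ℝ, E) ∞ M) {y : E} (hy : y ∈ φ.target) (a : E) :
    chartDeriv φ (φ.symm y) (chartSymmDeriv φ y a) = a :=
  DFunLike.congr_fun ((mdifferentiable_of_mem_maximalAtlas hφ).comp_symm_deriv hy) a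

theorem chartSymmDeriv_chartDeriv {φ : OpenPartialHomeomorph M E}
    (hφ : φ ∈ IsManifold.maximalAtlas 𝓘(ℝ, E) ∞ M) {x : M} (hx : x ∈ φ.source) (a : E) :
    chartSymmDeriv φ (φ x) (chartDeriv φ x a) = a :=
  DFunLike.congr_fun ((mdifferentiable_of_mem_maximalAtlas hφ).symm_comp_deriv hx) a

theorem chartMetric_pos {φ : OpenPartialHomeomorph M E}
    (hφ : φ ∈ IsManifold.maximalAtlas 𝓘(ℝ, E) ∞ M) {y : E} (hy : y ∈ φ.target) {a : E}
    (ha : a ≠ 0) : 0 < chartMetric φ y a a := by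
  rw [chartMetric_self]
  refine pow_pos (lt_of_le_of_ne (normAt_nonneg _ _) fun h => ha ?_) 2
  rw [← chartDeriv_chartSymmDeriv hφ hy a, normAt_eq_zero.1 h.symm, map_zero]

theorem chartMetric_chartDeriv {φ : OpenPartialHomeomorph M E}
    (hφ : φ ∈ IsManifold.maximalAtlas 𝓘(ℝ, E) ∞ M) {x : M} (hx : x ∈ φ.source) (a b : E) :
    chartMetric φ (φ x) (chartDeriv φ x a) (chartDeriv φ x b) = metricAt x a b := by
  rw [chartMetric_apply, chartSymmDeriv_chartDeriv hφ hx, chartSymmDeriv_chartDeriv hφ hx,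
    φ.left_inv hx]

/-- The coordinate fields are smooth along `φ.symm`, so their inner products are smooth. In finite
dimension smoothness of the form can be tested on fixed vectors. -/
theorem contDiffOn_chartMetric [IsContMDiffRiemannianBundle 𝓘(ℝ, E) ∞ E
      (fun x : M => TangentSpace 𝓘(ℝ, E) x)] {φ : OpenPartialHomeomorph M E}
    (hφ : φ ∈ IsManifold.maximalAtlas 𝓘(ℝ, E) ∞ M) :
    ContDiffOn ℝ ∞ (chartMetric φ) φ.target := by
  have hsec : ∀ a : E, ContMDiffOn 𝓘(ℝ, E) (𝓘(ℝ, E).prod 𝓘(ℝ, E)) ∞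
      (fun y : E => (⟨φ.symm y, mfderiv 𝓘(ℝ, E) 𝓘(ℝ, E) φ.symm y a⟩ : TangentBundle 𝓘(ℝ, E) M))
      φ.target := by
    intro a
    have h1 := (contMDiffOn_symm_of_mem_maximalAtlas hφ).contMDiffOn_tangentMapWithin
      (m := ∞) (by norm_cast) φ.open_target.uniqueMDiffOn
    have h2 : ContMDiff 𝓘(ℝ, E) (𝓘(ℝ, E).prod 𝓘(ℝ, E)) ∞
        (fun y : E => (⟨y, a⟩ : TangentBundle 𝓘(ℝ, E) E)) := by
      rw [← contMDiffOn_univ]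
      exact contMDiffOn_vectorSpace_iff_contDiffOn.2 contDiffOn_const
    refine (h1.comp h2.contMDiffOn (s := φ.target) fun y hy => hy).congr fun y hy => ?_
    simp only [Function.comp, tangentMapWithin]
    rw [mfderivWithin_of_isOpen φ.open_target hy]
  rw [contDiffOn_clm_apply]
  intro a
  rw [contDiffOn_clm_apply]
  intro b
  rw [← contMDiffOn_iff_contDiffOn]
  exact ContMDiffOn.inner_bundle (F := E) (E := fun x : M => TangentSpace 𝓘(ℝ, E) x)
    (v := fun y => mfderiv 𝓘(ℝ, E) 𝓘(ℝ, E) φ.symm y a)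
    (w := fun y => mfderiv 𝓘(ℝ, E) 𝓘(ℝ, E) φ.symm y b) (hsec a) (hsec b)

end ChartMetric

/-! ## Comparison of the Riemannian distance with the metric in charts -/

section DistanceComparison

open Set MeasureTheory Manifold

set_option synthInstance.maxHeartbeats 200000
set_option linter.unusedSectionVars false

universe u

variable {E : Type u} [NormedAddCommGroup E] [NormedSpace ℝ E]
  {M : Type*} [MetricSpace M] [ChartedSpace E M]
  [Bundle.RiemannianBundle (fun x : M => TangentSpace 𝓘(ℝ, E) x)]

/-- The differential of a real function. -/
noncomputable def realDeriv (f : M → ℝ) (x : M) : E →L[ℝ] ℝ := mfderiv 𝓘(ℝ, E) 𝓘(ℝ, ℝ) f x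

theorem ContDiffAt.eventually_norm_sub_lt {X F : Type*} [NormedAddCommGroup X]
    [NormedSpace ℝ X] [NormedAddCommGroup F] [NormedSpace ℝ F] {f : X → F} {x : X} {n : WithTop ℕ∞}
    (hf : ContDiffAt ℝ n f x) {ε : ℝ} (hε : 0 < ε) : ∀ᶠ y in 𝓝 x, ‖f y - f x‖ < ε := by
  simp only [← dist_eq_norm]
  exact hf.continuousAt.eventually (Metric.ball_mem_nhds _ hε)

/-- A function whose differential is bounded by `K` is `K`-Lipschitz at the centre of a ball. -/
theorem abs_sub_le_of_mfderiv_le [IsRiemannianManifold 𝓘(ℝ, E) M] {p : M} {R K : ℝ} {f : M → ℝ}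
    (hf : ContMDiffOn 𝓘(ℝ, E) 𝓘(ℝ, ℝ) 1 f (Metric.ball p R)) (hK : 0 ≤ K)
    (hgrad : ∀ x ∈ Metric.ball p R, ∀ a : E, |realDeriv f x a| ≤ K * normAt x a)
    {x : M} (hx : x ∈ Metric.ball p R) : |f x - f p| ≤ K * dist p x := by
  -- A path from `p` to `x` of length less than `L` has initial pieces of length less than `L`, so
  -- it stays in the ball, where the gradient bound can be integrated along it.
  have main : ∀ L, dist p x < L → L < R → |f x - f p| ≤ K * L := by
    intro L hL hLR
    have hL0 : 0 < L := dist_nonneg.trans_lt hL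
    have h1 : riemannianEDist 𝓘(ℝ, E) p x < ENNReal.ofReal L := by
      rw [← IsRiemannianManifold.out (I := 𝓘(ℝ, E)) p x, edist_dist]
      exact (ENNReal.ofReal_lt_ofReal_iff hL0).2 hL
    obtain ⟨γ, hγ0, hγ1, hγ, hlen⟩ := exists_lt_of_riemannianEDist_lt h1
    have hmem : ∀ t ∈ Icc (0 : ℝ) 1, γ t ∈ Metric.ball p R := by
      intro t ht
      have h2 : edist p (γ t) < ENNReal.ofReal L := by
        rw [IsRiemannianManifold.out (I := 𝓘(ℝ, E)) p (γ t)]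
        refine lt_of_le_of_lt (riemannianEDist_le_pathELength
          (hγ.mono (Icc_subset_Icc_right ht.2)) hγ0 rfl ht.1) ?_
        exact (pathELength_mono le_rfl ht.2).trans_lt hlen
      rw [edist_dist, ENNReal.ofReal_lt_ofReal_iff hL0] at h2
      rw [Metric.mem_ball, dist_comm]
      exact h2.trans hLR
    have hg : ContDiffOn ℝ 1 (f ∘ γ) (Icc 0 1) := contMDiffOn_iff_contDiffOn.1 (hf.comp hγ hmem)
    have h3 : ‖f x - f p‖ₑ ≤ ENNReal.ofReal K * ENNReal.ofReal L := by
      calc ‖f x - f p‖ₑ = ‖(f ∘ γ) 1 - (f ∘ γ) 0‖ₑ := by simp [hγ0, hγ1]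
        _ ≤ ∫⁻ t in Icc 0 1, ‖derivWithin (f ∘ γ) (Icc 0 1) t‖ₑ :=
          enorm_sub_le_lintegral_derivWithin_Icc_of_contDiffOn_Icc hg zero_le_one
        _ ≤ ∫⁻ t in Icc 0 1, ENNReal.ofReal K *
            ‖mfderivWithin 𝓘(ℝ, ℝ) 𝓘(ℝ, E) γ (Icc 0 1) t 1‖ₑ := by
          apply setLIntegral_mono' measurableSet_Icc (fun t ht => ?_)
          have h4 : mfderivWithin 𝓘(ℝ, ℝ) 𝓘(ℝ, ℝ) (f ∘ γ) (Icc 0 1) t =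
              (mfderiv 𝓘(ℝ, E) 𝓘(ℝ, ℝ) f (γ t)).comp
                (mfderivWithin 𝓘(ℝ, ℝ) 𝓘(ℝ, E) γ (Icc 0 1) t) := by
            apply mfderiv_comp_mfderivWithin
            · exact (hf.contMDiffAt (Metric.isOpen_ball.mem_nhds (hmem t ht))).mdifferentiableAt
                one_ne_zero
            · exact (hγ t ht).mdifferentiableWithinAt one_ne_zero
            · rw [uniqueMDiffWithinAt_iff_uniqueDiffWithinAt]
              exact uniqueDiffOn_Icc zero_lt_one t ht
          have h5 : derivWithin (f ∘ γ) (Icc 0 1) t =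
              realDeriv (E := E) f (γ t) (mfderivWithin 𝓘(ℝ, ℝ) 𝓘(ℝ, E) γ (Icc 0 1) t 1) := by
            rw [← fderivWithin_derivWithin, ← mfderivWithin_eq_fderivWithin]
            exact DFunLike.congr_fun h4 1
          rw [h5]
          have h6 := hgrad (γ t) (hmem t ht) (mfderivWithin 𝓘(ℝ, ℝ) 𝓘(ℝ, E) γ (Icc 0 1) t 1)
          have h7 := ENNReal.ofReal_le_ofReal h6
          rw [ENNReal.ofReal_mul hK, ← Real.norm_eq_abs, ofReal_norm] at h7
          refine h7.trans (le_of_eq ?_)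
          congr 1
          exact ofReal_norm (toTangent (E := E) (γ t)
            (mfderivWithin 𝓘(ℝ, ℝ) 𝓘(ℝ, E) γ (Icc 0 1) t 1))
        _ = ENNReal.ofReal K * pathELength 𝓘(ℝ, E) γ 0 1 := by
          rw [lintegral_const_mul' _ _ ENNReal.ofReal_ne_top,
            pathELength_eq_lintegral_mfderivWithin_Icc]
        _ ≤ ENNReal.ofReal K * ENNReal.ofReal L := by gcongr
    rw [← ENNReal.ofReal_mul hK, ← ofReal_norm,
      ENNReal.ofReal_le_ofReal_iff (by positivity)] at h3
    exact h3
  have hxR : dist p x < R := by rw [dist_comm]; exact hx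
  -- The distance need not be attained by a path, so `L` is let decrease to it.
  have hlim : Filter.Tendsto (fun L => K * L) (𝓝[>] dist p x) (𝓝 (K * dist p x)) :=
    (Filter.tendsto_id.const_mul K).mono_left nhdsWithin_le_nhds
  refine ge_of_tendsto hlim ?_
  filter_upwards [Ioo_mem_nhdsGT hxR] with L hL using main L hL.1 hL.2

variable [FiniteDimensional ℝ E] [IsManifold 𝓘(ℝ, E) ∞ M]

theorem realDeriv_comp_chart {φ : OpenPartialHomeomorph M E}
    (hφ : φ ∈ IsManifold.maximalAtlas 𝓘(ℝ, E) ∞ M) {x : M} (hx : x ∈ φ.source) {F : E → ℝ}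
    (hF : DifferentiableAt ℝ F (φ x)) (a : E) :
    realDeriv (F ∘ φ) x a = fderiv ℝ F (φ x) (chartDeriv φ x a) := by
  have := mfderiv_comp x hF.mdifferentiableAt
    ((mdifferentiable_of_mem_maximalAtlas hφ).mdifferentiableAt hx)
  refine (DFunLike.congr_fun this a).trans ?_
  rw [mfderiv_eq_fderiv]
  rfl

/-- Upper bound for the distance between the ends of a segment in a chart. -/
theorem dist_le_of_segment [IsRiemannianManifold 𝓘(ℝ, E) M] {φ : OpenPartialHomeomorph M E}
    (hφ : φ ∈ IsManifold.maximalAtlas 𝓘(ℝ, E) ∞ M) {y Δ : E} {L : ℝ} (hL : 0 ≤ L)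
    (hmem : ∀ t ∈ Icc (0 : ℝ) 1, y + t • Δ ∈ φ.target)
    (hspeed : ∀ t ∈ Icc (0 : ℝ) 1, √(chartMetric φ (y + t • Δ) Δ Δ) ≤ L) :
    dist (φ.symm y) (φ.symm (y + Δ)) ≤ L := by
  let c : ℝ → E := fun t => y + t • Δ
  have hcd : ContDiff ℝ 1 c := contDiff_const.add (contDiff_id.smul contDiff_const)
  have hγ : ContMDiffOn 𝓘(ℝ, ℝ) 𝓘(ℝ, E) 1 (φ.symm ∘ c) (Icc 0 1) :=
    (contMDiffOn_symm_of_mem_maximalAtlas (mem_maximalAtlas_one hφ)).comp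
      hcd.contMDiff.contMDiffOn hmem
  have h1 : edist (φ.symm y) (φ.symm (y + Δ)) ≤ pathELength 𝓘(ℝ, E) (φ.symm ∘ c) 0 1 := by
    rw [IsRiemannianManifold.out (I := 𝓘(ℝ, E))]
    exact riemannianEDist_le_pathELength hγ (by simp [c]) (by simp [c]) zero_le_one
  have h2 : pathELength 𝓘(ℝ, E) (φ.symm ∘ c) 0 1 ≤ ENNReal.ofReal L := by
    rw [pathELength_eq_lintegral_mfderiv_Icc]
    calc ∫⁻ t in Icc (0 : ℝ) 1, ‖mfderiv 𝓘(ℝ, ℝ) 𝓘(ℝ, E) (φ.symm ∘ c) t 1‖ₑ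
        ≤ ∫⁻ t in Icc (0 : ℝ) 1, ENNReal.ofReal L := by
          apply setLIntegral_mono' measurableSet_Icc (fun t ht => ?_)
          have hct : HasDerivAt c Δ t := by
            have := ((hasDerivAt_id t).smul_const Δ).const_add y
            rwa [one_smul] at this
          have h4 : mfderiv 𝓘(ℝ, ℝ) 𝓘(ℝ, E) (φ.symm ∘ c) t =
              (mfderiv 𝓘(ℝ, E) 𝓘(ℝ, E) φ.symm (c t)).comp (mfderiv 𝓘(ℝ, ℝ) 𝓘(ℝ, E) c t) :=
            mfderiv_comp t ((mdifferentiable_of_mem_maximalAtlas hφ).mdifferentiableAt_symm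
              (hmem t ht)) hct.differentiableAt.mdifferentiableAt
          have h5 : mfderiv 𝓘(ℝ, ℝ) 𝓘(ℝ, E) c t 1 = Δ := by
            rw [mfderiv_eq_fderiv]
            exact hct.hasFDerivAt.fderiv ▸ one_smul ℝ Δ
          have h6 : mfderiv 𝓘(ℝ, ℝ) 𝓘(ℝ, E) (φ.symm ∘ c) t 1 =
              toTangent (φ.symm (c t)) (chartSymmDeriv φ (c t) Δ) := by
            have := DFunLike.congr_fun h4 1
            refine this.trans ?_
            rw [ContinuousLinearMap.comp_apply, h5]
            rfl
          rw [h6, ← ofReal_norm]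
          apply ENNReal.ofReal_le_ofReal
          have := hspeed t ht
          rwa [sqrt_chartMetric_self] at this
      _ = ENNReal.ofReal L := by simp
  have h3 := h1.trans h2
  rwa [edist_dist, ENNReal.ofReal_le_ofReal_iff hL] at h3

/-- The constant is the inverse of the minimum of the form on the unit sphere. The sphere is empty
when the space is zero, hence the separate case. -/
theorem exists_norm_sq_le_of_posDef {E : Type*} [NormedAddCommGroup E] [NormedSpace ℝ E]
    [FiniteDimensional ℝ E] (B : E →L[ℝ] E →L[ℝ] ℝ) (hB : ∀ v, v ≠ 0 → 0 < B v v) :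
    ∃ C > 0, ∀ a, ‖a‖ ^ 2 ≤ C * B a a := by
  rcases (Metric.sphere (0 : E) 1).eq_empty_or_nonempty with h | h
  · refine ⟨1, one_pos, fun a => ?_⟩
    have ha : a = 0 := by
      by_contra hne
      have : ‖a‖⁻¹ • a ∈ Metric.sphere (0 : E) 1 := by
        simp [norm_smul, inv_mul_cancel₀ (norm_ne_zero_iff.2 hne)]
      rw [h] at this
      exact this
    simp [ha]
  · have hcont : Continuous fun a => B a a := by fun_prop
    obtain ⟨a₀, ha₀, hmin⟩ := (isCompact_sphere (0 : E) 1).exists_isMinOn h hcont.continuousOn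
    have ha₀0 : a₀ ≠ 0 := by
      rintro rfl
      simp at ha₀
    have hm := hB a₀ ha₀0
    refine ⟨(B a₀ a₀)⁻¹, inv_pos.2 hm, fun a => ?_⟩
    by_cases hne : a = 0
    · simp [hne]
    · have hn : 0 < ‖a‖ := norm_pos_iff.2 hne
      have h1 : ‖a‖⁻¹ • a ∈ Metric.sphere (0 : E) 1 := by
        simp [norm_smul, inv_mul_cancel₀ hn.ne']
      have h2 := isMinOn_iff.1 hmin _ h1
      simp only [map_smul, smul_apply, smul_eq_mul] at h2
      rw [inv_mul_eq_div, le_div_iff₀ hm]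
      calc ‖a‖ ^ 2 * B a₀ a₀ ≤ ‖a‖ ^ 2 * (‖a‖⁻¹ * (‖a‖⁻¹ * B a a)) := by gcongr
        _ = B a a := by field_simp

variable [IsContMDiffRiemannianBundle 𝓘(ℝ, E) ∞ E (fun x : M => TangentSpace 𝓘(ℝ, E) x)]

/-- Continuity of the metric gives an absolute error ‖·‖² · ε/C, and positivity at `y₀` turns it
into the relative error ε, uniformly in the vector. Taking roots costs nothing, since (1 - ε)² ≤ 1 -
ε and 1 + ε ≤ (1 + ε)². -/
theorem eventually_chartMetric_near {φ : OpenPartialHomeomorph M E}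
    (hφ : φ ∈ IsManifold.maximalAtlas 𝓘(ℝ, E) ∞ M) {y₀ : E} (hy₀ : y₀ ∈ φ.target) {ε : ℝ}
    (hε : 0 < ε) (hε1 : ε < 1) :
    ∀ᶠ y in 𝓝 y₀, ∀ a, (1 - ε) * √(chartMetric φ y₀ a a) ≤ √(chartMetric φ y a a) ∧
      √(chartMetric φ y a a) ≤ (1 + ε) * √(chartMetric φ y₀ a a) := by
  obtain ⟨C, hC, hCa⟩ := exists_norm_sq_le_of_posDef (chartMetric φ y₀)
    (fun v hv => chartMetric_pos hφ hy₀ hv)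
  have hcont : ContDiffAt ℝ ∞ (chartMetric φ) y₀ :=
    (contDiffOn_chartMetric hφ).contDiffAt (φ.open_target.mem_nhds hy₀)
  have hev : ∀ᶠ y in 𝓝 y₀, ‖chartMetric φ y - chartMetric φ y₀‖ < ε / C :=
    hcont.eventually_norm_sub_lt (div_pos hε hC)
  filter_upwards [hev] with y hy a
  set b := chartMetric φ y₀ a a
  set g := chartMetric φ y a a
  have hb : 0 ≤ b := chartMetric_self_nonneg _ _ _
  have h1 : |g - b| ≤ ε * b := by
    have h2 : |g - b| ≤ ‖chartMetric φ y - chartMetric φ y₀‖ * ‖a‖ * ‖a‖ :=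
      (chartMetric φ y - chartMetric φ y₀).le_opNorm₂ a a
    calc |g - b| ≤ ‖chartMetric φ y - chartMetric φ y₀‖ * ‖a‖ * ‖a‖ := h2
      _ = ‖chartMetric φ y - chartMetric φ y₀‖ * ‖a‖ ^ 2 := by ring
      _ ≤ ε / C * (C * b) := by gcongr; exact hCa a
      _ = ε * b := by field_simp
  obtain ⟨h3, h4⟩ := abs_le.1 h1
  constructor
  · apply Real.le_sqrt_of_sq_le
    rw [mul_pow, Real.sq_sqrt hb]
    nlinarith
  · rw [Real.sqrt_le_left (by have := Real.sqrt_nonneg b; positivity), mul_pow, Real.sq_sqrt hb]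
    nlinarith

/-- The distance is infinitesimally given by the metric. -/
theorem dist_comparison [IsRiemannianManifold 𝓘(ℝ, E) M] {φ : OpenPartialHomeomorph M E}
    (hφ : φ ∈ IsManifold.maximalAtlas 𝓘(ℝ, E) ∞ M) {x₀ : M} (hx₀ : x₀ ∈ φ.source) {ε : ℝ}
    (hε : 0 < ε) (hε1 : ε < 1) :
    ∃ δ > 0, Metric.ball x₀ δ ⊆ φ.source ∧ ∀ x ∈ Metric.ball x₀ δ, ∀ x' ∈ Metric.ball x₀ δ,
      (1 - ε) * √(chartMetric φ (φ x₀) (φ x' - φ x) (φ x' - φ x)) ≤ dist x x' ∧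
      dist x x' ≤ (1 + ε) * √(chartMetric φ (φ x₀) (φ x' - φ x) (φ x' - φ x)) := by
  have hy₀ := φ.map_source hx₀
  have hev := (eventually_chartMetric_near hφ hy₀ hε hε1).and (φ.open_target.mem_nhds hy₀)
  obtain ⟨s, hs, hball⟩ := Metric.eventually_nhds_iff_ball.1 hev
  have hpre : ∀ᶠ x in 𝓝 x₀, φ x ∈ Metric.ball (φ x₀) s ∧ x ∈ φ.source :=
    ((φ.continuousAt hx₀).eventually_mem (Metric.ball_mem_nhds _ hs)).and
      (φ.open_source.mem_nhds hx₀)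
  obtain ⟨δ, hδ, hδball⟩ := Metric.eventually_nhds_iff_ball.1 hpre
  -- The third leaves room: the ball of radius 2δ/3 about `x` contains `x'` and lies inside the ball
  -- of radius δ about `x₀`.
  have hsub : Metric.ball x₀ (δ / 3) ⊆ Metric.ball x₀ δ := Metric.ball_subset_ball (by linarith)
  refine ⟨δ / 3, by positivity, fun x hx => (hδball x (hsub hx)).2, ?_⟩
  intro x hx x' hx'
  have hxφ := hδball x (hsub hx)
  have hx'φ := hδball x' (hsub hx')
  set Δ := φ x' - φ x with hΔ
  set B := chartMetric φ (φ x₀)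
  have hB0 : 0 ≤ √(B Δ Δ) := Real.sqrt_nonneg _
  constructor
  · -- lower bound, by means of a linear function
    let F : E →L[ℝ] ℝ := B Δ
    have hsub2 : Metric.ball x (2 * δ / 3) ⊆ Metric.ball x₀ δ := by
      intro z hz
      have h1 : dist z x < 2 * δ / 3 := hz
      have h2 : dist x x₀ < δ / 3 := hx
      have := dist_triangle z x x₀
      rw [Metric.mem_ball]; linarith
    have hf : ContMDiffOn 𝓘(ℝ, E) 𝓘(ℝ, ℝ) 1 (F ∘ φ) (Metric.ball x (2 * δ / 3)) :=
      F.contMDiff.comp_contMDiffOn ((contMDiffOn_of_mem_maximalAtlas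
        (mem_maximalAtlas_one hφ)).mono fun z hz => (hδball z (hsub2 hz)).2)
    have hgrad : ∀ z ∈ Metric.ball x (2 * δ / 3), ∀ a : E,
        |realDeriv (F ∘ φ) z a| ≤ (√(B Δ Δ) / (1 - ε)) * normAt z a := by
      intro z hz a
      have hzφ := hδball z (hsub2 hz)
      rw [realDeriv_comp_chart hφ hzφ.2 F.differentiableAt, F.fderiv]
      have h2 : |F (chartDeriv φ z a)| ≤
          √(B Δ Δ) * √(B (chartDeriv φ z a) (chartDeriv φ z a)) := abs_chartMetric_le _ _ _ _
      have h3 := ((hball _ hzφ.1).1 (chartDeriv φ z a)).1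
      have h4 : √(chartMetric φ (φ z) (chartDeriv φ z a) (chartDeriv φ z a)) = normAt z a := by
        rw [chartMetric_chartDeriv hφ hzφ.2, metricAt_self, Real.sqrt_sq (normAt_nonneg _ _)]
      rw [h4] at h3
      have hε' : 0 < 1 - ε := by linarith
      calc |F (chartDeriv φ z a)| ≤ √(B Δ Δ) * √(B (chartDeriv φ z a) (chartDeriv φ z a)) := h2
        _ ≤ √(B Δ Δ) * (normAt z a / (1 - ε)) := by
          gcongr
          rw [le_div_iff₀ hε']; linarith
        _ = _ := by ring
    have hx'mem : x' ∈ Metric.ball x (2 * δ / 3) := by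
      have h1 : dist x' x₀ < δ / 3 := hx'
      have h2 : dist x x₀ < δ / 3 := hx
      have := dist_triangle_right x' x x₀
      rw [Metric.mem_ball]; linarith
    have hε' : 0 < 1 - ε := by linarith
    have key := abs_sub_le_of_mfderiv_le hf (by positivity) hgrad hx'mem
    have h5 : (F ∘ φ) x' - (F ∘ φ) x = √(B Δ Δ) ^ 2 := by
      rw [Real.sq_sqrt (chartMetric_self_nonneg _ _ _)]
      simp only [Function.comp, F, ← map_sub]
      rw [← hΔ]
    rw [h5, abs_of_nonneg (sq_nonneg _)] at key
    rcases hB0.eq_or_lt with h0 | h0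
    · rw [← h0]; simp
    · rw [div_mul_eq_mul_div, le_div_iff₀ hε'] at key
      have : √(B Δ Δ) * (√(B Δ Δ) * (1 - ε)) ≤ √(B Δ Δ) * dist x x' := by nlinarith
      linarith [le_of_mul_le_mul_left this h0]
  · have hseg : ∀ t ∈ Icc (0 : ℝ) 1, φ x + t • Δ ∈ Metric.ball (φ x₀) s := by
      intro t ht
      have := (convex_ball (φ x₀) s).add_smul_sub_mem hxφ.1 hx'φ.1 ht
      exact this
    have := dist_le_of_segment hφ (y := φ x) (Δ := Δ) (L := (1 + ε) * √(B Δ Δ)) (by positivity)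
      (fun t ht => (hball _ (hseg t ht)).2) (fun t ht => ((hball _ (hseg t ht)).1 Δ).2)
    rwa [hΔ, add_sub_cancel, φ.left_inv hxφ.2, φ.left_inv hx'φ.2] at this

end DistanceComparison

/-! ## Normal charts -/

section NormalCharts

open Set

set_option synthInstance.maxHeartbeats 200000
set_option linter.unusedSectionVars false

universe u

variable {E : Type u} [NormedAddCommGroup E] [NormedSpace ℝ E]
  {M : Type*} [MetricSpace M] [ChartedSpace E M]
  [Bundle.RiemannianBundle (fun x : M => TangentSpace 𝓘(ℝ, E) x)]
  [FiniteDimensional ℝ E] [IsManifold 𝓘(ℝ, E) ∞ M]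

theorem chartSymmDeriv_trans {φ : OpenPartialHomeomorph M E}
    (hφ : φ ∈ IsManifold.maximalAtlas 𝓘(ℝ, E) ∞ M) {f : OpenPartialHomeomorph E E} {z : E}
    (hf : DifferentiableAt ℝ f z) (hz : f z ∈ φ.target) (a : E) :
    chartSymmDeriv (φ.trans f.symm) z a = chartSymmDeriv φ (f z) (fderiv ℝ f z a) := by
  have h := mfderiv_comp z
    ((mdifferentiable_of_mem_maximalAtlas hφ).mdifferentiableAt_symm hz) hf.mdifferentiableAt
  refine (DFunLike.congr_fun h a).trans ?_
  rw [mfderiv_eq_fderiv]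
  rfl

theorem chartMetric_trans {φ : OpenPartialHomeomorph M E}
    (hφ : φ ∈ IsManifold.maximalAtlas 𝓘(ℝ, E) ∞ M) {f : OpenPartialHomeomorph E E} {z : E}
    (hf : DifferentiableAt ℝ f z) (hz : f z ∈ φ.target) (a b : E) :
    chartMetric (φ.trans f.symm) z a b
      = chartMetric φ (f z) (fderiv ℝ f z a) (fderiv ℝ f z b) := by
  rw [chartMetric_apply, chartMetric_apply, chartSymmDeriv_trans hφ hf hz,
    chartSymmDeriv_trans hφ hf hz]
  rfl

theorem trans_mem_maximalAtlas {φ : OpenPartialHomeomorph M E}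
    (hφ : φ ∈ IsManifold.maximalAtlas 𝓘(ℝ, E) ∞ M) {f : OpenPartialHomeomorph E E}
    (hf : ContDiffOn ℝ ∞ f f.source) (hf' : ContDiffOn ℝ ∞ f.symm f.target) :
    φ.trans f ∈ IsManifold.maximalAtlas 𝓘(ℝ, E) ∞ M := by
  rw [IsManifold.mem_maximalAtlas_iff_contMDiffOn]
  constructor
  · refine (contMDiffOn_iff_contDiffOn.2 hf).comp
      ((contMDiffOn_of_mem_maximalAtlas hφ).mono ?_) ?_
    · exact fun x hx => hx.1
    · exact fun x hx => hx.2
  · refine (contMDiffOn_symm_of_mem_maximalAtlas hφ).comp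
      ((contMDiffOn_iff_contDiffOn.2 hf').mono ?_) ?_
    · exact fun x hx => hx.1
    · exact fun x hx => hx.2

/-- The tangent space at `p` is identified with `E` through the preferred chart at `p`. Normalizing
other charts to have this derivative lets coordinate vectors and tangent vectors at `p` be used
interchangeably. -/
theorem chartDeriv_chartAt_self (p : M) (a : E) : chartDeriv (chartAt E p) p a = a := by
  have h := mfderiv_chartAt_eq_tangentCoordChange (I := 𝓘(ℝ, E)) (mem_chart_source E p)
  refine (DFunLike.congr_fun h a).trans ?_
  exact tangentCoordChange_self (I := 𝓘(ℝ, E)) (mem_extChartAt_source p)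

theorem chartDeriv_trans {φ : OpenPartialHomeomorph M E}
    (hφ : φ ∈ IsManifold.maximalAtlas 𝓘(ℝ, E) ∞ M) {f : OpenPartialHomeomorph E E} {x : M}
    (hx : x ∈ φ.source) (hf : DifferentiableAt ℝ f (φ x)) (a : E) :
    chartDeriv (φ.trans f) x a = fderiv ℝ f (φ x) (chartDeriv φ x a) := by
  have h := mfderiv_comp x hf.mdifferentiableAt
    ((mdifferentiable_of_mem_maximalAtlas hφ).mdifferentiableAt hx)
  refine (DFunLike.congr_fun h a).trans ?_
  rw [mfderiv_eq_fderiv]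
  rfl

/-- A chart centred at `p` which satisfies the conclusion of the Gauss lemma. -/
theorem exists_gauss_chart [IsContMDiffRiemannianBundle 𝓘(ℝ, E) ∞ E
    (fun x : M => TangentSpace 𝓘(ℝ, E) x)] (p : M) :
    ∃ φ ∈ IsManifold.maximalAtlas 𝓘(ℝ, E) ∞ M, p ∈ φ.source ∧ φ p = 0 ∧
      (∀ a, chartDeriv φ p a = a) ∧
      ∀ z ∈ φ.target, ∀ w, chartMetric φ z z w = metricAt p z w := by
  set φ₀ := chartAt E p
  have hφ₀ : φ₀ ∈ IsManifold.maximalAtlas 𝓘(ℝ, E) ∞ M := IsManifold.chart_mem_maximalAtlas p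
  have hp : p ∈ φ₀.source := mem_chart_source E p
  obtain ⟨f, h0, hf0, htgt, hf, hf', hd, hgauss⟩ := exists_normal_coordinates φ₀.open_target
    (chartMetric φ₀) (contDiffOn_chartMetric hφ₀) (fun x _ v w => chartMetric_comm φ₀ x v w)
    (fun x hx v hv => chartMetric_pos hφ₀ hx hv) (φ₀.map_source hp)
  have hp' : φ₀ p ∈ f.target := hf0 ▸ f.map_source h0
  have hsymm0 : f.symm (φ₀ p) = 0 := by rw [← hf0, f.left_inv h0]
  have hdsymm : HasFDerivAt f.symm (ContinuousLinearMap.id ℝ E) (φ₀ p) := by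
    have := f.hasFDerivAt_symm (f' := ContinuousLinearEquiv.refl ℝ E) hp' (hsymm0 ▸ hd)
    exact this
  refine ⟨φ₀.trans f.symm, trans_mem_maximalAtlas hφ₀ hf' hf, ?_, hsymm0, ?_, ?_⟩
  · exact ⟨hp, hp'⟩
  · intro a
    rw [chartDeriv_trans hφ₀ hp hdsymm.differentiableAt, hdsymm.fderiv]
    exact chartDeriv_chartAt_self p a
  · intro z hz w
    have hz' : z ∈ f.source := hz.1
    have hfz : DifferentiableAt ℝ f z :=
      (hf.contDiffAt (f.open_source.mem_nhds hz')).differentiableAt (by simp)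
    rw [chartMetric_trans hφ₀ hfz (htgt (f.map_source hz')), hgauss z hz' w]
    have h := chartMetric_chartDeriv hφ₀ hp z w
    rwa [chartDeriv_chartAt_self, chartDeriv_chartAt_self] at h

/-- Normal charts of radius `ρ` at `p`. -/
structure IsNormalChart (φ : OpenPartialHomeomorph M E) (p : M) (ρ : ℝ) : Prop where
  mem_atlas : φ ∈ IsManifold.maximalAtlas 𝓘(ℝ, E) ∞ M
  radius_pos : 0 < ρ
  source_eq : φ.source = Metric.ball p ρ
  target_eq : φ.target = {z | normAt p z < ρ}
  map_center : φ p = 0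
  deriv_center : ∀ a, chartDeriv φ p a = a
  gauss : ∀ z ∈ φ.target, ∀ w, chartMetric φ z z w = metricAt p z w
  normAt_map : ∀ x ∈ φ.source, normAt p (φ x) = dist p x

theorem chartMetric_center {φ : OpenPartialHomeomorph M E}
    (hφ : φ ∈ IsManifold.maximalAtlas 𝓘(ℝ, E) ∞ M) {p : M} (hp : p ∈ φ.source)
    (hd : ∀ a, chartDeriv φ p a = a) (a b : E) : chartMetric φ (φ p) a b = metricAt p a b := by
  have := chartMetric_chartDeriv hφ hp a b
  rwa [hd, hd] at this

/-- The given norm of `E` and the Riemannian norm at `p` are a priori unrelated; finite dimension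
makes them comparable. -/
theorem exists_norm_sq_le_normAt_sq (p : M) : ∃ C > 0, ∀ a : E, ‖a‖ ^ 2 ≤ C * normAt p a ^ 2 := by
  have hφ : chartAt E p ∈ IsManifold.maximalAtlas 𝓘(ℝ, E) ∞ M :=
    IsManifold.chart_mem_maximalAtlas p
  have hp := mem_chart_source E p
  obtain ⟨C, hC, h⟩ := exists_norm_sq_le_of_posDef (chartMetric (chartAt E p) (chartAt E p p))
    (fun v hv => chartMetric_pos hφ ((chartAt E p).map_source hp) hv)
  refine ⟨C, hC, fun a => ?_⟩
  rw [← metricAt_self, ← chartMetric_center hφ hp (chartDeriv_chartAt_self p)]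
  exact h a

/-- The Riemannian metric at `p` as a continuous bilinear form on the model space. -/
noncomputable def metricForm (p : M) : E →L[ℝ] E →L[ℝ] ℝ :=
  chartMetric (chartAt E p) (chartAt E p p)

theorem metricForm_apply (p : M) (a b : E) : metricForm p a b = metricAt p a b :=
  chartMetric_center (IsManifold.chart_mem_maximalAtlas p) (mem_chart_source E p)
    (chartDeriv_chartAt_self p) a b

theorem normAt_eq_sqrt (p : M) (a : E) : normAt p a = √(metricForm p a a) := by
  rw [metricForm_apply, metricAt_self, Real.sqrt_sq (normAt_nonneg _ _)]

theorem continuous_normAt (p : M) : Continuous fun a : E => normAt p a := by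
  simp only [normAt_eq_sqrt]
  fun_prop

theorem normAt_zero (p : M) : normAt p (0 : E) = 0 := normAt_eq_zero.2 rfl

theorem metricAt_smul_right (x : M) (k : ℝ) (a b : E) :
    metricAt x a (k • b) = k * metricAt x a b := by
  rw [metricAt_comm, metricAt_smul_left, metricAt_comm]

/-- In a Gauss chart, the coordinate norm is bounded by the distance to the centre. -/
theorem normAt_le_dist_of_gauss [IsRiemannianManifold 𝓘(ℝ, E) M] {φ : OpenPartialHomeomorph M E}
    (hφ : φ ∈ IsManifold.maximalAtlas 𝓘(ℝ, E) ∞ M) {p : M} (h0 : φ p = 0) {ρ : ℝ}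
    (hball : Metric.ball p ρ ⊆ φ.source)
    (hgauss : ∀ z ∈ φ.target, ∀ w, chartMetric φ z z w = metricAt p z w) {x : M}
    (hx : x ∈ Metric.ball p ρ) : normAt p (φ x) ≤ dist p x := by
  refine le_of_forall_pos_le_add fun ε hε => ?_
  -- The coordinate norm is not differentiable at 0, so it is replaced by √(ε² + |z|²). By the Gauss
  -- lemma the gradient of this function has length at most 1.
  set F : E → ℝ := fun z => √(ε ^ 2 + metricForm (E := E) p z z) with hF
  have hpos : ∀ z, 0 < ε ^ 2 + metricForm (E := E) p z z := fun z => by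
    rw [metricForm_apply, metricAt_self]; positivity
  have hFd : ContDiff ℝ 1 F := ContDiff.sqrt (by fun_prop) fun z => (hpos z).ne'
  have hnF : ∀ z, normAt p z ≤ F z := fun z => by
    rw [normAt_eq_sqrt]
    exact Real.sqrt_le_sqrt (by nlinarith)
  have hFpos : ∀ z, 0 < F z := fun z => Real.sqrt_pos.2 (hpos z)
  have hderiv : ∀ z w, fderiv ℝ F z w = metricAt p z w / F z := by
    intro z w
    have h1 : HasFDerivAt (fun z => ε ^ 2 + metricForm (E := E) p z z)
        ((metricForm p z) + (metricForm p).flip z) z := by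
      have := ((metricForm p).hasFDerivAt (x := z)).clm_apply (hasFDerivAt_id z)
      refine (this.const_add (ε ^ 2)).congr_fderiv ?_
      ext w
      simp
    rw [(h1.sqrt (hpos z).ne').fderiv]
    simp only [smul_apply, add_apply, ContinuousLinearMap.flip_apply, metricForm_apply,
      metricAt_comm p w z, smul_eq_mul, hF]
    field_simp
    ring
  have key := abs_sub_le_of_mfderiv_le (f := F ∘ φ) (K := 1)
    (hFd.contMDiff.comp_contMDiffOn
      ((contMDiffOn_of_mem_maximalAtlas (mem_maximalAtlas_one hφ)).mono hball)) zero_le_one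
    (fun z hz a => by
      have hzs := hball hz
      rw [realDeriv_comp_chart hφ hzs (hFd.differentiable one_ne_zero _), hderiv,
        abs_div, abs_of_pos (hFpos _), one_mul,
        div_le_iff₀ (hFpos _)]
      have h1 := abs_chartMetric_le φ (φ z) (φ z) (chartDeriv φ z a)
      rw [chartMetric_chartDeriv hφ hzs, hgauss _ (φ.map_source hzs), metricAt_self,
        hgauss _ (φ.map_source hzs), metricAt_self, Real.sqrt_sq (normAt_nonneg _ _),
        Real.sqrt_sq (normAt_nonneg _ _)] at h1
      have h2 := hnF (φ z)
      have h3 := normAt_nonneg z a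
      nlinarith) hx
  have hF0 : F (φ p) = ε := by
    rw [h0, hF]
    simp [Real.sqrt_sq hε.le]
  rw [Function.comp, Function.comp, hF0, one_mul] at key
  linarith [hnF (φ x), (abs_le.1 key).2]

/-- The Gauss identity at `t • v` is divided by t; at t = 0 the normalized derivative at the centre
takes its place. -/
theorem chartMetric_smul_self_of_gauss {φ : OpenPartialHomeomorph M E}
    (hφ : φ ∈ IsManifold.maximalAtlas 𝓘(ℝ, E) ∞ M) {p : M} (hp : p ∈ φ.source) (h0 : φ p = 0)
    (hd : ∀ a, chartDeriv φ p a = a)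
    (hgauss : ∀ z ∈ φ.target, ∀ w, chartMetric φ z z w = metricAt p z w) {t : ℝ} {v : E}
    (ht : t • v ∈ φ.target) (w : E) : chartMetric φ (t • v) v w = metricAt p v w := by
  rcases eq_or_ne t 0 with rfl | h
  · rw [zero_smul, ← h0, chartMetric_center hφ hp hd]
  · have := hgauss _ ht w
    rw [map_smul, smul_apply, smul_eq_mul, metricAt_smul_left] at this
    exact mul_left_cancel₀ h this

/-- By the Gauss identity radial segments have constant speed `normAt p v`, which determines their
length. -/
theorem dist_le_of_gauss [IsRiemannianManifold 𝓘(ℝ, E) M] {φ : OpenPartialHomeomorph M E}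
    (hφ : φ ∈ IsManifold.maximalAtlas 𝓘(ℝ, E) ∞ M) {p : M} (hp : p ∈ φ.source) (h0 : φ p = 0)
    (hd : ∀ a, chartDeriv φ p a = a)
    (hgauss : ∀ z ∈ φ.target, ∀ w, chartMetric φ z z w = metricAt p z w) {v : E}
    (hseg : ∀ t ∈ Icc (0 : ℝ) 1, t • v ∈ φ.target) {s s' : ℝ} (hs : s ∈ Icc (0 : ℝ) 1)
    (hs' : s' ∈ Icc (0 : ℝ) 1) :
    dist (φ.symm (s • v)) (φ.symm (s' • v)) ≤ |s - s'| * normAt p v := by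
  have hmem : ∀ t ∈ Icc (0 : ℝ) 1, s • v + t • (s' - s) • v = (s + t * (s' - s)) • v ∧
      s + t * (s' - s) ∈ Icc (0 : ℝ) 1 := by
    intro t ht
    refine ⟨by module, ?_⟩
    have := (convex_Icc (0 : ℝ) 1).add_smul_sub_mem hs hs' ht
    simpa using this
  have := dist_le_of_segment hφ (y := s • v) (Δ := (s' - s) • v) (L := |s - s'| * normAt p v)
    (mul_nonneg (abs_nonneg _) (normAt_nonneg _ _))
    (fun t ht => by rw [(hmem t ht).1]; exact hseg _ (hmem t ht).2)
    (fun t ht => by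
      have h1 := hseg _ (hmem t ht).2
      rw [(hmem t ht).1, map_smul, map_smul, smul_apply, smul_eq_mul, smul_eq_mul,
        chartMetric_smul_self_of_gauss hφ hp h0 hd hgauss h1, metricAt_self, ← mul_assoc, ← sq,
        ← mul_pow, Real.sqrt_sq_eq_abs, abs_mul, abs_of_nonneg (normAt_nonneg _ _), abs_sub_comm])
  rwa [show s • v + (s' - s) • v = s' • v by module] at this

variable [IsRiemannianManifold 𝓘(ℝ, E) M]
  [IsContMDiffRiemannianBundle 𝓘(ℝ, E) ∞ E (fun x : M => TangentSpace 𝓘(ℝ, E) x)]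

/-- In a Gauss chart the gradient bound gives `hle` and the length of radial segments gives `hge`,
so near `p` the coordinate norm equals the distance to `p`. Restricting to a small metric ball then
makes the target exactly the coordinate ball of the same radius. -/
theorem exists_isNormalChart (p : M) :
    ∃ (φ : OpenPartialHomeomorph M E) (ρ : ℝ), IsNormalChart φ p ρ := by
  obtain ⟨φ, hφ, hp, h0, hd, hgauss⟩ := exists_gauss_chart (E := E) p
  obtain ⟨C, hC, hCa⟩ := exists_norm_sq_le_normAt_sq (E := E) p
  have h0t : (0 : E) ∈ φ.target := h0 ▸ φ.map_source hp
  obtain ⟨r₀, hr₀, hr₀t⟩ := Metric.mem_nhds_iff.1 (φ.open_target.mem_nhds h0t)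
  obtain ⟨r, hr, hrt⟩ : ∃ r > 0, ∀ z : E, normAt p z < r → z ∈ φ.target := by
    refine ⟨r₀ / √C, by positivity, fun z hz => hr₀t ?_⟩
    rw [mem_ball_zero_iff]
    rw [lt_div_iff₀ (by positivity)] at hz
    refine lt_of_le_of_lt ?_ hz
    apply le_of_sq_le_sq _ (mul_nonneg (normAt_nonneg _ _) (Real.sqrt_nonneg _))
    rw [mul_pow, Real.sq_sqrt hC.le, mul_comm]
    exact hCa z
  have hev : ∀ᶠ x in 𝓝 p, x ∈ φ.source ∧ normAt p (φ x) < r := by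
    refine Filter.Eventually.and (φ.open_source.mem_nhds hp) ?_
    refine ((continuous_normAt p).continuousAt.comp (φ.continuousAt hp)).eventually_lt_const ?_
    simp [h0, normAt_zero, hr]
  obtain ⟨ρ₀, hρ₀, hball⟩ := Metric.eventually_nhds_iff_ball.1 hev
  set ρ := min ρ₀ r
  have hρ : 0 < ρ := lt_min hρ₀ hr
  have hρs : ∀ x ∈ Metric.ball p ρ, x ∈ φ.source ∧ normAt p (φ x) < r := fun x hx =>
    hball x (Metric.ball_subset_ball (min_le_left _ _) hx)
  have hle : ∀ x ∈ Metric.ball p ρ, normAt p (φ x) ≤ dist p x := fun x hx =>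
    normAt_le_dist_of_gauss hφ h0 (fun y hy => (hρs y hy).1) hgauss hx
  have hge : ∀ z : E, normAt p z < r → dist p (φ.symm z) ≤ normAt p z := by
    intro z hz
    have := dist_le_of_gauss hφ hp h0 hd hgauss (v := z) (s := 0) (s' := 1) (fun t ht => hrt _ (by
      rw [normAt_smul, abs_of_nonneg ht.1]
      nlinarith [ht.1, ht.2, normAt_nonneg p z])) (by simp) (by simp)
    simpa [← h0, φ.left_inv hp] using this
  have hsource : (φ.restr (Metric.ball p ρ)).source = Metric.ball p ρ := by
    rw [φ.restr_source' _ Metric.isOpen_ball]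
    exact inter_eq_right.2 fun x hx => (hρs x hx).1
  have htarget : (φ.restr (Metric.ball p ρ)).target = {z | normAt p z < ρ} := by
    ext z
    constructor
    · intro hz
      have h1 : φ.symm z ∈ Metric.ball p ρ := by
        have := (φ.restr (Metric.ball p ρ)).map_target hz
        rwa [hsource] at this
      have h2 : z ∈ φ.target := hz.1
      have h3 := hle _ h1
      rw [φ.right_inv h2] at h3
      exact h3.trans_lt (by rw [dist_comm]; exact h1)
    · intro hz
      have hz' : normAt p z < ρ := hz
      have hzr : normAt p z < r := hz'.trans_le (min_le_right _ _)
      have h1 : φ.symm z ∈ (φ.restr (Metric.ball p ρ)).source := by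
        rw [hsource, Metric.mem_ball, dist_comm]
        exact (hge z hzr).trans_lt hz'
      have h2 := (φ.restr (Metric.ball p ρ)).map_source h1
      rwa [φ.restr_apply, φ.right_inv (hrt z hzr)] at h2
  refine ⟨φ.restr (Metric.ball p ρ), ρ, ?_, hρ, hsource, htarget, h0, hd, fun z hz w =>
    hgauss z hz.1 w, ?_⟩
  · exact restr_mem_maximalAtlas _ hφ Metric.isOpen_ball
  · intro x hx
    rw [hsource] at hx
    refine le_antisymm (hle x hx) ?_
    have := hge (φ x) (hρs x hx).2
    rwa [φ.left_inv (hρs x hx).1] at this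

namespace IsNormalChart

variable {φ : OpenPartialHomeomorph M E} {p : M} {ρ : ℝ}

theorem center_mem (h : IsNormalChart φ p ρ) : p ∈ φ.source := by
  rw [h.source_eq]
  exact Metric.mem_ball_self h.radius_pos

theorem symm_zero (h : IsNormalChart φ p ρ) : φ.symm 0 = p := by
  rw [← h.map_center, φ.left_inv h.center_mem]

theorem mem_target (h : IsNormalChart φ p ρ) {z : E} (hz : normAt p z < ρ) : z ∈ φ.target := by
  rw [h.target_eq]; exact hz

theorem dist_center (h : IsNormalChart φ p ρ) {z : E} (hz : normAt p z < ρ) :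
    dist p (φ.symm z) = normAt p z := by
  have hz' := h.mem_target hz
  rw [← h.normAt_map _ (φ.map_target hz'), φ.right_inv hz']

theorem _root_.normAt_smul_lt {v : E} (hv : normAt p v < ρ) {t : ℝ}
    (ht : t ∈ Icc (0 : ℝ) 1) : normAt p (t • v) < ρ := by
  rw [normAt_smul, abs_of_nonneg ht.1]
  nlinarith [ht.1, ht.2, normAt_nonneg p v]

/-- Radial segments are minimizing. -/
theorem dist_radial (h : IsNormalChart φ p ρ) {v : E} (hv : normAt p v < ρ) {s s' : ℝ}
    (hs : s ∈ Icc (0 : ℝ) 1) (hs' : s' ∈ Icc (0 : ℝ) 1) :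
    dist (φ.symm (s • v)) (φ.symm (s' • v)) = |s - s'| * normAt p v := by
  refine le_antisymm (dist_le_of_gauss h.mem_atlas h.center_mem h.map_center h.deriv_center h.gauss
    (fun t ht => h.mem_target (normAt_smul_lt hv ht)) hs hs') ?_
  have h1 := h.dist_center (normAt_smul_lt hv hs)
  have h2 := h.dist_center (normAt_smul_lt hv hs')
  rw [normAt_smul, abs_of_nonneg hs.1] at h1
  rw [normAt_smul, abs_of_nonneg hs'.1] at h2
  have h3 := dist_triangle p (φ.symm (s • v)) (φ.symm (s' • v))
  have h4 := dist_triangle_right p (φ.symm (s • v)) (φ.symm (s' • v))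
  have h5 := normAt_nonneg p v
  rcases abs_cases (s - s') with ⟨h6, -⟩ | ⟨h6, -⟩ <;> rw [h6] <;> linarith

/-- The distance at the centre is infinitesimally Euclidean. -/
theorem dist_infinitesimal (h : IsNormalChart φ p ρ) {ε : ℝ} (hε : 0 < ε) (hε1 : ε < 1) :
    ∃ δ > 0, δ ≤ ρ ∧ ∀ v w : E, normAt p v < δ → normAt p w < δ →
      (1 - ε) * normAt p (w - v) ≤ dist (φ.symm v) (φ.symm w) ∧
      dist (φ.symm v) (φ.symm w) ≤ (1 + ε) * normAt p (w - v) := by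
  obtain ⟨δ, hδ, -, hcomp⟩ := dist_comparison h.mem_atlas h.center_mem hε hε1
  refine ⟨min δ ρ, lt_min hδ h.radius_pos, min_le_right _ _, fun v w hv hw => ?_⟩
  have hvρ := hv.trans_le (min_le_right _ _)
  have hwρ := hw.trans_le (min_le_right _ _)
  have h1 : φ.symm v ∈ Metric.ball p δ := by
    rw [Metric.mem_ball, dist_comm, h.dist_center hvρ]
    exact hv.trans_le (min_le_left _ _)
  have h2 : φ.symm w ∈ Metric.ball p δ := by
    rw [Metric.mem_ball, dist_comm, h.dist_center hwρ]
    exact hw.trans_le (min_le_left _ _)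
  have h3 := hcomp _ h1 _ h2
  rwa [φ.right_inv (h.mem_target hvρ), φ.right_inv (h.mem_target hwρ),
    chartMetric_center h.mem_atlas h.center_mem h.deriv_center, metricAt_self,
    Real.sqrt_sq (normAt_nonneg _ _)] at h3

/-- The coordinate expression of a minimizing curve starting at the centre has radial
derivative. -/
theorem hasDerivAt_minimizing (h : IsNormalChart φ p ρ) {γ : ℝ → M} {a c : ℝ} (hc : 0 < c)
    (hγ0 : γ 0 = p) (hca : c * a < ρ)
    (hγ : ∀ s ∈ Icc 0 a, ∀ s' ∈ Icc 0 a, dist (γ s) (γ s') = c * |s - s'|) {t : ℝ}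
    (ht : t ∈ Ioo 0 a) : HasDerivAt (fun s => φ (γ s)) (t⁻¹ • φ (γ t)) t := by
  have ht0 : 0 < t := ht.1
  have hsrc : ∀ s ∈ Icc 0 a, γ s ∈ φ.source := by
    intro s hs
    rw [h.source_eq, Metric.mem_ball, dist_comm, ← hγ0, hγ 0 ⟨le_rfl, hs.1.trans hs.2⟩ s hs,
      zero_sub, abs_neg, abs_of_nonneg hs.1]
    exact (mul_le_mul_of_nonneg_left hs.2 hc.le).trans_lt hca
  have hnorm : ∀ s ∈ Icc 0 a, normAt p (φ (γ s)) = c * s := by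
    intro s hs
    rw [h.normAt_map _ (hsrc s hs), ← hγ0, hγ 0 ⟨le_rfl, hs.1.trans hs.2⟩ s hs,
      zero_sub, abs_neg, abs_of_nonneg hs.1]
  have htI : t ∈ Icc 0 a := ⟨ht.1.le, ht.2.le⟩
  set y := φ (γ t) with hy
  have hyt : y ∈ φ.target := φ.map_source (hsrc t htI)
  obtain ⟨C, hC, hCa⟩ := exists_norm_sq_le_of_posDef (chartMetric φ y)
    (fun v hv => chartMetric_pos h.mem_atlas hyt hv)
  obtain ⟨D, hD, hDa⟩ : ∃ D > 0, ∀ v : E, normAt p v ^ 2 ≤ D * ‖v‖ ^ 2 := by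
    refine ⟨‖metricForm (E := E) p‖ + 1, by positivity, fun v => ?_⟩
    rw [← metricAt_self, ← metricForm_apply]
    have := (le_abs_self _).trans ((metricForm (E := E) p).le_opNorm₂ v v)
    nlinarith [sq_nonneg ‖v‖]
  -- A difference quotient u has squared length at most about c². Expanding |y(s)| = cs and applying
  -- the Gauss lemma gives G(y, u) ≈ c²t, while G(y, y) = c²t². This is near equality in
  -- Cauchy–Schwarz and forces u ≈ y/t. The choice of ε and the bound on |s - t| each use half of
  -- the allowance η²/C.
  rw [hasDerivAt_iff_tendsto_slope, Metric.tendsto_nhds]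
  intro η hη
  obtain ⟨ε, hε, hε1, hεη⟩ : ∃ ε > 0, ε < 1 ∧
      c ^ 2 / (1 - ε) ^ 2 - c ^ 2 < η ^ 2 / (2 * C) := by
    have h1 : ContinuousAt (fun ε : ℝ => c ^ 2 / (1 - ε) ^ 2 - c ^ 2) 0 := by
      apply ContinuousAt.sub _ continuousAt_const
      exact ContinuousAt.div continuousAt_const (by fun_prop) (by norm_num)
    have h2 : ∀ᶠ ε in 𝓝[>] (0 : ℝ), c ^ 2 / (1 - ε) ^ 2 - c ^ 2 < η ^ 2 / (2 * C) :=
      nhdsWithin_le_nhds (h1.eventually_lt_const (by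
        simp only [sub_zero, one_pow, div_one, sub_self]; positivity))
    obtain ⟨ε, h3, h4⟩ := (h2.and (Ioo_mem_nhdsGT one_pos)).exists
    exact ⟨ε, h4.1, h4.2, h3⟩
  obtain ⟨δ, hδ, hδs, hcomp⟩ := dist_comparison h.mem_atlas (hsrc t htI) hε hε1
  set κ := c ^ 2 / (1 - ε) ^ 2
  set R := (c ^ 2 + D * (C * κ)) / t with hR
  have hκ : 0 ≤ κ := by positivity
  have hR0 : 0 ≤ R := by positivity
  have hm : 0 < min (δ / c) (η ^ 2 / (2 * C) / (R + 1)) := by positivity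
  have hev : ∀ᶠ s in 𝓝 t, s ∈ Ioo 0 a ∧ |s - t| < min (δ / c) (η ^ 2 / (2 * C) / (R + 1)) :=
    Filter.Eventually.and (Ioo_mem_nhds ht.1 ht.2) (Metric.ball_mem_nhds t hm)
  filter_upwards [nhdsWithin_le_nhds hev, self_mem_nhdsWithin] with s hs hst
  have hsI : s ∈ Icc 0 a := ⟨hs.1.1.le, hs.1.2.le⟩
  have hne : s - t ≠ 0 := sub_ne_zero.2 hst
  have hdist := hγ s hsI t htI
  have hsδ : γ s ∈ Metric.ball (γ t) δ := by
    rw [Metric.mem_ball, hdist, mul_comm, ← lt_div_iff₀ hc]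
    exact hs.2.trans_le (min_le_left _ _)
  have h1 := (hcomp _ (Metric.mem_ball_self hδ) _ hsδ).1
  set u := slope (fun s => φ (γ s)) t s with hu
  have hu' : φ (γ s) = y + (s - t) • u := by
    rw [hu, slope_def_module, smul_smul, mul_inv_cancel₀ hne, one_smul, add_sub_cancel]
  have hΔ : φ (γ s) - y = (s - t) • u := by rw [hu', add_sub_cancel_left]
  have hG : chartMetric φ y u u ≤ κ := by
    rw [← hy, hΔ, map_smul, map_smul, smul_apply, smul_eq_mul, smul_eq_mul, ← mul_assoc, ← sq,
      Real.sqrt_mul (sq_nonneg _), Real.sqrt_sq_eq_abs, dist_comm, hdist] at h1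
    have h2 : (1 - ε) * √(chartMetric φ y u u) ≤ c :=
      le_of_mul_le_mul_left (by linarith) (abs_pos.2 hne)
    have h3 : 0 < 1 - ε := by linarith
    have h4 : √(chartMetric φ y u u) ≤ c / (1 - ε) := by rw [le_div_iff₀ h3]; linarith
    rw [Real.sqrt_le_left (by positivity), div_pow] at h4
    exact h4
  have hup : normAt p u ^ 2 ≤ D * (C * κ) :=
    (hDa u).trans (mul_le_mul_of_nonneg_left
      ((hCa u).trans (mul_le_mul_of_nonneg_left hG hC.le)) hD.le)
  have hyy : chartMetric φ y y y = (c * t) ^ 2 := by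
    rw [h.gauss y hyt, metricAt_self, hnorm t htI]
  have hyu : 2 * chartMetric φ y y u = 2 * c ^ 2 * t + (s - t) * (c ^ 2 - normAt p u ^ 2) := by
    rw [h.gauss y hyt]
    have h2 : normAt p (φ (γ s)) ^ 2 = (c * s) ^ 2 := by rw [hnorm s hsI]
    have h3 : normAt p y ^ 2 = (c * t) ^ 2 := by rw [hnorm t htI]
    rw [hu', ← metricAt_self, metricAt_add_left, metricAt_comm p y, metricAt_comm p ((s - t) • u),
      metricAt_add_left, metricAt_add_left, metricAt_self, h3, metricAt_smul_left,
      metricAt_smul_left, metricAt_smul_right, metricAt_smul_right, metricAt_self,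
      metricAt_comm p u y] at h2
    have h4 : (s - t) * (2 * metricAt p y u) =
        (s - t) * (2 * c ^ 2 * t + (s - t) * (c ^ 2 - normAt p u ^ 2)) := by linarith
    exact mul_left_cancel₀ hne h4
  have hfinal : chartMetric φ y (u - t⁻¹ • y) (u - t⁻¹ • y) < η ^ 2 / C := by
    have h2 : chartMetric φ y (u - t⁻¹ • y) (u - t⁻¹ • y) = chartMetric φ y u u -
        t⁻¹ * (2 * chartMetric φ y y u) + t⁻¹ ^ 2 * chartMetric φ y y y := by
      simp only [map_sub, map_smul, sub_apply, smul_apply, smul_eq_mul,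
        chartMetric_comm φ y u y]
      ring
    have h3 : t⁻¹ * (2 * chartMetric φ y y u) =
        2 * c ^ 2 + (s - t) * ((c ^ 2 - normAt p u ^ 2) / t) := by
      rw [hyu]; field_simp
    have h4 : t⁻¹ ^ 2 * chartMetric φ y y y = c ^ 2 := by rw [hyy]; field_simp
    have h5 : |(s - t) * ((c ^ 2 - normAt p u ^ 2) / t)| ≤ |s - t| * R := by
      rw [abs_mul, abs_div, abs_of_pos ht0, hR]
      gcongr
      refine (abs_sub _ _).trans ?_
      rw [abs_of_nonneg (sq_nonneg _), abs_of_nonneg (sq_nonneg _)]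
      linarith
    have h6 : |s - t| * R < η ^ 2 / (2 * C) := by
      have h7 := hs.2.trans_le (min_le_right _ _)
      rw [lt_div_iff₀ (by positivity)] at h7
      nlinarith [abs_nonneg (s - t)]
    have h8 : η ^ 2 / C = η ^ 2 / (2 * C) + η ^ 2 / (2 * C) := by field_simp; ring
    rw [h2, h3, h4, h8]
    have := (abs_le.1 h5).1
    linarith
  have h9 := hCa (u - t⁻¹ • y)
  rw [dist_eq_norm]
  refine lt_of_pow_lt_pow_left₀ 2 hη.le (h9.trans_lt ?_)
  rwa [lt_div_iff₀ hC, mul_comm] at hfinal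

/-- Minimizing curves starting at the centre are radial. -/
theorem exists_eq_symm_smul (h : IsNormalChart φ p ρ) {γ : ℝ → M} {a c : ℝ} (ha : 0 < a)
    (hγ0 : γ 0 = p) (hca : c * a < ρ)
    (hγ : ∀ s ∈ Icc 0 a, ∀ s' ∈ Icc 0 a, dist (γ s) (γ s') = c * |s - s'|) :
    ∃ v : E, normAt p v = c ∧ ∀ s ∈ Icc 0 a, γ s = φ.symm (s • v) := by
  have hc : 0 ≤ c := by
    have := hγ 0 ⟨le_rfl, ha.le⟩ a ⟨ha.le, le_rfl⟩
    rw [zero_sub, abs_neg, abs_of_pos ha] at this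
    exact nonneg_of_mul_nonneg_left (this ▸ dist_nonneg) ha
  rcases hc.eq_or_lt with rfl | hc
  · refine ⟨0, normAt_zero p, fun s hs => ?_⟩
    have := hγ 0 ⟨le_rfl, ha.le⟩ s hs
    rw [zero_mul, dist_eq_zero] at this
    rw [← this, hγ0, smul_zero, h.symm_zero]
  have hsrc : ∀ s ∈ Icc 0 a, γ s ∈ φ.source := by
    intro s hs
    rw [h.source_eq, Metric.mem_ball, dist_comm, ← hγ0, hγ 0 ⟨le_rfl, hs.1.trans hs.2⟩ s hs,
      zero_sub, abs_neg, abs_of_nonneg hs.1]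
    exact (mul_le_mul_of_nonneg_left hs.2 hc.le).trans_lt hca
  have hγc : ContinuousOn γ (Icc 0 a) := by
    have : LipschitzOnWith ⟨c, hc.le⟩ γ (Icc 0 a) :=
      LipschitzOnWith.of_dist_le_mul fun s hs s' hs' => (hγ s hs s' hs').le
    exact this.continuousOn
  have hyc : ContinuousOn (fun s => φ (γ s)) (Icc 0 a) := φ.continuousOn.comp hγc hsrc
  refine ⟨a⁻¹ • φ (γ a), ?_, ?_⟩
  · have haI : a ∈ Icc 0 a := ⟨ha.le, le_rfl⟩
    rw [normAt_smul, h.normAt_map _ (hsrc a haI), ← hγ0, hγ 0 ⟨le_rfl, ha.le⟩ a haI, zero_sub,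
      abs_neg, abs_of_pos ha, abs_of_pos (inv_pos.2 ha)]
    field_simp
  · intro s hs
    rcases hs.1.eq_or_lt with rfl | hs0
    · rw [zero_smul, h.symm_zero, hγ0]
    -- A curve with y' = y/s has y/s constant, so it is a radial line.
    have hder : ∀ t ∈ Ioo 0 a, HasDerivAt (fun s => s⁻¹ • φ (γ s)) 0 t := by
      intro t ht
      have h1 := (hasDerivAt_inv ht.1.ne').smul (h.hasDerivAt_minimizing hc hγ0 hca hγ ht)
      refine h1.congr_deriv ?_
      rw [smul_smul, ← add_smul, sq, mul_inv, add_neg_cancel, zero_smul]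
    have h2 : a⁻¹ • φ (γ a) = s⁻¹ • φ (γ s) :=
      constant_of_has_deriv_right_zero (f := fun s => s⁻¹ • φ (γ s)) (a := s) (b := a)
      (ContinuousOn.smul (continuousOn_inv₀.mono fun t ht => (hs0.trans_le ht.1).ne')
        (hyc.mono (Icc_subset_Icc_left hs.1)))
      (fun t ht => (hder t ⟨hs0.trans_le ht.1, ht.2⟩).hasDerivWithinAt) a ⟨hs.2, le_rfl⟩
    rw [h2, smul_smul, mul_inv_cancel₀ hs0.ne', one_smul, φ.left_inv (hsrc s hs)]

end IsNormalChart

end NormalCharts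

/-! ## Isometries and geodesics in normal charts -/

section Isotropy

open Set Filter

set_option synthInstance.maxHeartbeats 200000
set_option linter.unusedSectionVars false

universe u

variable {E : Type u} [NormedAddCommGroup E] [NormedSpace ℝ E]
  {M : Type*} [MetricSpace M] [ChartedSpace E M]
  [Bundle.RiemannianBundle (fun x : M => TangentSpace 𝓘(ℝ, E) x)]
  [FiniteDimensional ℝ E] [IsManifold 𝓘(ℝ, E) ∞ M] [IsRiemannianManifold 𝓘(ℝ, E) M]
  [IsContMDiffRiemannianBundle 𝓘(ℝ, E) ∞ E (fun x : M => TangentSpace 𝓘(ℝ, E) x)]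

variable (E) in
/-- A normal chart at `p`. -/
noncomputable def normalChart (p : M) : OpenPartialHomeomorph M E :=
  (exists_isNormalChart (E := E) p).choose

variable (E) in
/-- The radius of the normal chart at `p`. -/
noncomputable def normalRadius (p : M) : ℝ := (exists_isNormalChart (E := E) p).choose_spec.choose

theorem isNormalChart_normalChart (p : M) :
    IsNormalChart (normalChart E p) p (normalRadius E p) :=
  (exists_isNormalChart (E := E) p).choose_spec.choose_spec

/-- The exponential map at `p` (used for small vectors only). -/
noncomputable def expAt (p : M) (v : E) : M := (normalChart E p).symm v

theorem normalRadius_pos (p : M) : 0 < normalRadius E p :=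
  (isNormalChart_normalChart (E := E) p).radius_pos

theorem expAt_zero (p : M) : expAt p (0 : E) = p := (isNormalChart_normalChart p).symm_zero

theorem dist_expAt {p : M} {v : E} (hv : normAt p v < normalRadius E p) :
    dist p (expAt p v) = normAt p v := (isNormalChart_normalChart p).dist_center hv

theorem expAt_injOn {p : M} {v w : E} (hv : normAt p v < normalRadius E p)
    (hw : normAt p w < normalRadius E p) (h : expAt p v = expAt p w) : v = w :=
  (normalChart E p).symm.injOn ((isNormalChart_normalChart p).mem_target hv)
    ((isNormalChart_normalChart p).mem_target hw) h

theorem normalChart_expAt {p : M} {v : E} (hv : normAt p v < normalRadius E p) :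
    normalChart E p (expAt p v) = v :=
  (normalChart E p).right_inv ((isNormalChart_normalChart p).mem_target hv)

theorem expAt_normalChart {p x : M} (hx : dist p x < normalRadius E p) :
    expAt p (normalChart E p x) = x ∧ normAt p (normalChart E p x) = dist p x := by
  have h : x ∈ (normalChart E p).source := by
    rw [(isNormalChart_normalChart p).source_eq, Metric.mem_ball, dist_comm]
    exact hx
  exact ⟨(normalChart E p).left_inv h, (isNormalChart_normalChart p).normAt_map x h⟩

theorem continuousOn_expAt (p : M) :
    ContinuousOn (expAt p : E → M) {v | normAt p v < normalRadius E p} :=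
  (isNormalChart_normalChart (E := E) p).target_eq ▸ (normalChart E p).continuousOn_symm

theorem eventually_normAt_smul_lt (p : M) (v : E) {r : ℝ} (hr : 0 < r) :
    ∀ᶠ s in 𝓝 (0 : ℝ), normAt p (s • v) < r := by
  have : Continuous fun s : ℝ => normAt p (s • v) :=
    (continuous_normAt p).comp (by fun_prop)
  exact this.continuousAt.eventually_lt_const (by simpa only [zero_smul, normAt_zero] using hr)

theorem eventually_normAt_smul_lt_right (p : M) (v : E) {r : ℝ} (hr : 0 < r) :
    ∀ᶠ s in 𝓝[>] (0 : ℝ), 0 < s ∧ normAt p (s • v) < r := by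
  filter_upwards [self_mem_nhdsWithin, nhdsWithin_le_nhds (eventually_normAt_smul_lt p v hr)]
    with s h1 h2 using ⟨h1, h2⟩

/-- The norm on the tangent space is recovered from the distance function. Through this limit,
preservation of distance becomes preservation of the norm of differences. -/
theorem tendsto_dist_expAt_div (p : M) (v w : E) :
    Tendsto (fun s : ℝ => dist (expAt p (s • v)) (expAt p (s • w)) / s) (𝓝[>] 0)
      (𝓝 (normAt p (w - v))) := by
  rw [Metric.tendsto_nhds]
  intro η hη
  set n := normAt p (w - v)
  have hn : 0 ≤ n := normAt_nonneg _ _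
  set ε := min (1 / 2) (η / (n + 1) / 2) with hε'
  have hε : 0 < ε := by positivity
  have hε1 : ε < 1 := (min_le_left _ _).trans_lt (by norm_num)
  have hεn : ε * n < η := by
    have h1 : ε ≤ η / (n + 1) / 2 := min_le_right _ _
    have h2 : ε * (2 * (n + 1)) ≤ η := by
      rw [div_div, le_div_iff₀ (by positivity)] at h1
      linarith
    nlinarith
  obtain ⟨δ, hδ, -, h⟩ := (isNormalChart_normalChart (E := E) p).dist_infinitesimal hε hε1
  filter_upwards [nhdsWithin_le_nhds (eventually_normAt_smul_lt p v hδ),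
    nhdsWithin_le_nhds (eventually_normAt_smul_lt p w hδ), self_mem_nhdsWithin] with s hv hw hs
  have hs : 0 < s := hs
  obtain ⟨h1, h2⟩ := h _ _ hv hw
  rw [← smul_sub, normAt_smul, abs_of_pos hs] at h1 h2
  change _ ≤ dist (expAt p (s • v)) (expAt p (s • w)) at h1
  change dist (expAt p (s • v)) (expAt p (s • w)) ≤ _ at h2
  rw [Real.dist_eq, abs_lt]
  constructor
  · rw [lt_sub_iff_add_lt, lt_div_iff₀ hs]
    nlinarith
  · rw [sub_lt_iff_lt_add, div_lt_iff₀ hs]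
    nlinarith

/-- Polarization shows that `L` preserves inner products; then the squared norms of L(v + w) - Lv -
Lw and L(kv) - kLv expand to zero. -/
theorem linear_of_normAt_sub {p q : M} {L : E → E}
    (hL : ∀ v w, normAt q (L w - L v) = normAt p (w - v)) (h0 : ∀ v, normAt q (L v) = normAt p v) :
    (∀ v w, L (v + w) = L v + L w) ∧ ∀ (k : ℝ) v, L (k • v) = k • L v := by
  have hin : ∀ v w : E, metricForm q (L v) (L w) = metricForm p v w := by
    intro v w
    have h1 : metricForm q (L w - L v) (L w - L v) = metricForm p (w - v) (w - v) := by
      rw [metricForm_apply, metricForm_apply, metricAt_self, metricAt_self, hL]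
    have h2 : ∀ v : E, metricForm q (L v) (L v) = metricForm p v v := fun v => by
      rw [metricForm_apply, metricForm_apply, metricAt_self, metricAt_self, h0]
    have hc : ∀ (x : M) (a b : E), metricForm x a b = metricForm x b a := fun x a b => by
      rw [metricForm_apply, metricForm_apply, metricAt_comm]
    simp only [map_sub, sub_apply, h2] at h1
    rw [hc q (L w) (L v), hc p w v] at h1
    linarith
  have hz : ∀ a : E, metricForm q a a = 0 → a = 0 := fun a ha => by
    rw [metricForm_apply, metricAt_self] at ha
    exact normAt_eq_zero.1 (pow_eq_zero_iff two_ne_zero |>.1 ha)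
  constructor
  · intro v w
    rw [← sub_eq_zero]
    apply hz
    simp only [map_sub, map_add, sub_apply, add_apply, hin]
    ring
  · intro k v
    rw [← sub_eq_zero]
    apply hz
    simp only [map_sub, map_smul, sub_apply, smul_apply, smul_eq_mul, hin]
    ring

/-- An isometry fixing `p` is linear in normal coordinates at `p`. -/
theorem exists_isotropyMap {g : M ≃ᵢ M} {p : M} (hg : g p = p) :
    ∃ L : E →ₗ[ℝ] E, (∀ v, normAt p (L v) = normAt p v) ∧
      ∀ v, normAt p v < normalRadius E p → g (expAt p v) = expAt p (L v) := by
  -- The image of a radial segment is again a minimizing curve from `p`, hence radial.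
  have step : ∀ v : E, normAt p v < normalRadius E p → ∃ w : E, normAt p w = normAt p v ∧
      ∀ s ∈ Icc (0 : ℝ) 1, g (expAt p (s • v)) = expAt p (s • w) := by
    intro v hv
    refine (isNormalChart_normalChart p).exists_eq_symm_smul (γ := fun s => g (expAt p (s • v)))
      one_pos ?_ (by rwa [mul_one]) ?_
    · rw [zero_smul, expAt_zero, hg]
    · intro s hs s' hs'
      rw [g.isometry.dist_eq, mul_comm]
      exact (isNormalChart_normalChart p).dist_radial hv hs hs'
  have ex : ∀ v : E, ∃ w : E, normAt p w = normAt p v ∧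
      ∀ᶠ s in 𝓝[>] (0 : ℝ), g (expAt p (s • v)) = expAt p (s • w) := by
    intro v
    obtain ⟨t, ht0, ht⟩ := (eventually_normAt_smul_lt_right p v
      (normalRadius_pos (E := E) p)).exists
    obtain ⟨w, hw, hgw⟩ := step _ ht
    refine ⟨t⁻¹ • w, ?_, ?_⟩
    · rw [normAt_smul, hw, normAt_smul, ← mul_assoc, ← abs_mul, inv_mul_cancel₀ ht0.ne', abs_one,
        one_mul]
    · filter_upwards [Ioc_mem_nhdsGT ht0] with s hs
      have := hgw (s / t) ⟨by have := hs.1; positivity, (div_le_one ht0).2 hs.2⟩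
      rwa [smul_smul, div_mul_cancel₀ _ ht0.ne', div_eq_mul_inv, ← smul_smul] at this
  choose L hLn hL using ex
  -- Compare the distance between the endpoints of two short radial segments with that of their
  -- images, at the same scale s → 0.
  have hLsub : ∀ v w, normAt p (L w - L v) = normAt p (w - v) := by
    intro v w
    refine tendsto_nhds_unique (tendsto_dist_expAt_div p (L v) (L w))
      ((tendsto_dist_expAt_div p v w).congr' ?_)
    filter_upwards [hL v, hL w] with s h1 h2
    rw [← h1, ← h2, g.isometry.dist_eq]
  obtain ⟨hadd, hsmul⟩ := linear_of_normAt_sub hLsub hLn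
  refine ⟨{ toFun := L, map_add' := hadd, map_smul' := hsmul }, hLn, fun v hv => ?_⟩
  obtain ⟨w, hw, hgw⟩ := step v hv
  obtain ⟨s, h1, h2⟩ := ((hL v).and (Ioc_mem_nhdsGT one_pos)).exists
  have h3 : L v = w := by
    have h4 := hgw s ⟨h2.1.le, h2.2⟩
    rw [h1] at h4
    have h5 := expAt_injOn (normAt_smul_lt (by rwa [hLn v]) ⟨h2.1.le, h2.2⟩)
      (normAt_smul_lt (hw ▸ hv) ⟨h2.1.le, h2.2⟩) h4
    exact smul_right_injective E h2.1.ne' h5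
  have := hgw 1 ⟨zero_le_one, le_rfl⟩
  rw [one_smul, one_smul, ← h3] at this
  exact this

open Classical in
variable (E) in
/-- The differential at `p` of an isometry `g` that fixes `p` (the identity if `g` does not fix
`p`). -/
noncomputable def isotropyMap (p : M) (g : M ≃ᵢ M) : E →ₗ[ℝ] E :=
  if h : g p = p then (exists_isotropyMap (E := E) h).choose else LinearMap.id

theorem normAt_isotropyMap (p : M) (g : M ≃ᵢ M) (v : E) :
    normAt p (isotropyMap E p g v) = normAt p v := by
  unfold isotropyMap
  split_ifs with h
  · exact (exists_isotropyMap (E := E) h).choose_spec.1 v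
  · rfl

theorem map_expAt {p : M} {g : M ≃ᵢ M} (hg : g p = p) {v : E}
    (hv : normAt p v < normalRadius E p) : g (expAt p v) = expAt p (isotropyMap E p g v) := by
  unfold isotropyMap
  rw [dif_pos hg]
  exact (exists_isotropyMap (E := E) hg).choose_spec.2 v hv

theorem metricForm_isotropyMap (p : M) (g : M ≃ᵢ M) (v w : E) :
    metricForm p (isotropyMap E p g v) (isotropyMap E p g w) = metricForm p v w := by
  have h : ∀ v, metricForm p (isotropyMap E p g v) (isotropyMap E p g v) = metricForm p v v :=
    fun v => by
      rw [metricForm_apply, metricForm_apply, metricAt_self, metricAt_self, normAt_isotropyMap]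
  have hc : ∀ (a b : E), metricForm p a b = metricForm p b a := fun a b => by
    rw [metricForm_apply, metricForm_apply, metricAt_comm]
  have h1 := h (v + w)
  simp only [map_add, add_apply, h] at h1
  rw [hc w v, hc (isotropyMap E p g w)] at h1
  linarith

/-- The differential is determined by the values of the isometry on small vectors. -/
theorem isotropyMap_apply_eq {p : M} {g : M ≃ᵢ M} (hg : g p = p) {v w : E}
    (h : ∃ᶠ s in 𝓝[>] (0 : ℝ), g (expAt p (s • v)) = expAt p (s • w)) :
    isotropyMap E p g v = w := by
  obtain ⟨s, h1, ⟨h4, h2⟩, -, h3⟩ := (h.and_eventually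
    ((eventually_normAt_smul_lt_right p v (normalRadius_pos (E := E) p)).and
    (eventually_normAt_smul_lt_right p w (normalRadius_pos (E := E) p)))).exists
  rw [map_expAt hg h2] at h1
  have := expAt_injOn (by rwa [normAt_isotropyMap]) h3 h1
  rw [map_smul] at this
  exact smul_right_injective E h4.ne' this

theorem isotropyMap_mul {p : M} {g h : M ≃ᵢ M} (hg : g p = p) (hh : h p = p) (v : E) :
    isotropyMap E p (g * h) v = isotropyMap E p g (isotropyMap E p h v) := by
  have hgh : (g * h) p = p := by rw [IsometryEquiv.mul_apply, hh, hg]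
  refine isotropyMap_apply_eq hgh (Eventually.frequently ?_)
  filter_upwards [eventually_normAt_smul_lt_right p v (normalRadius_pos (E := E) p)]
    with s ⟨_, hs⟩
  rw [IsometryEquiv.mul_apply, map_expAt hh hs, map_expAt hg (by rwa [normAt_isotropyMap]),
    map_smul, map_smul]

theorem isotropyMap_one (p : M) (v : E) : isotropyMap E p 1 v = v :=
  isotropyMap_apply_eq rfl (Eventually.frequently (.of_forall fun _ => rfl))

theorem isotropyMap_pow {p : M} {g : M ≃ᵢ M} (hg : g p = p) (n : ℕ) :
    (g ^ n) p = p ∧ isotropyMap E p (g ^ n) = isotropyMap E p g ^ n := by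
  induction n with
  | zero => exact ⟨rfl, by ext v; rw [pow_zero, isotropyMap_one]; rfl⟩
  | succ n ih =>
    refine ⟨by rw [pow_succ, IsometryEquiv.mul_apply, hg, ih.1], ?_⟩
    ext v
    rw [pow_succ, isotropyMap_mul ih.1 hg, ih.2, pow_succ]
    rfl

/-- Thus near `p` the fixed point set of `g` is a linear slice in normal coordinates. -/
theorem map_expAt_eq_self_iff {p : M} {g : M ≃ᵢ M} (hg : g p = p) {v : E}
    (hv : normAt p v < normalRadius E p) :
    g (expAt p v) = expAt p v ↔ isotropyMap E p g v = v := by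
  rw [map_expAt hg hv]
  exact ⟨expAt_injOn (by rwa [normAt_isotropyMap]) hv, fun h => by rw [h]⟩

theorem isotropyMap_eq_of_smul {p : M} {g : M ≃ᵢ M} {s : ℝ} (hs : s ≠ 0) {v : E}
    (h : isotropyMap E p g (s • v) = s • v) : isotropyMap E p g v = v := by
  rw [map_smul] at h
  exact smul_right_injective E hs h

/-- An isometry of a connected manifold is determined by its differential at a fixed point. -/
theorem eq_one_of_isotropyMap [ConnectedSpace M] {p : M} {g : M ≃ᵢ M} (hg : g p = p)
    (h : ∀ v : E, isotropyMap E p g v = v) : g = 1 := by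
  -- The interior of the fixed point set is also closed. At a limit point x, an open set of fixed
  -- points lies in the normal ball about x, so the linear differential at x fixes a nonempty open
  -- set of vectors and is the identity.
  let T : Set M := {x | ∀ᶠ y in 𝓝 x, g y = y}
  have hopen : IsOpen T := isOpen_setOfPred_eventually_nhds
  have hlocal : ∀ x : M, g x = x → (∀ v : E, isotropyMap E x g v = v) → x ∈ T := by
    intro x hx hL
    filter_upwards [Metric.ball_mem_nhds x (normalRadius_pos (E := E) x)] with y hy
    rw [Metric.mem_ball, dist_comm] at hy
    obtain ⟨h1, h2⟩ := expAt_normalChart hy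
    rw [← h1, map_expAt hx (by rwa [h2]), hL]
  have hclosed : IsClosed T := by
    rw [← closure_subset_iff_isClosed]
    intro x hx
    have hgx : g x = x := by
      have : T ⊆ {y | g y = y} := fun y hy => hy.self_of_nhds
      exact (isClosed_eq g.continuous continuous_id).closure_subset_iff.2 this hx
    refine hlocal x hgx ?_
    obtain ⟨y, hy, hyT⟩ := mem_closure_iff_nhds.1 hx _
      (Metric.ball_mem_nhds x (normalRadius_pos (E := E) x))
    rw [Metric.mem_ball, dist_comm] at hy
    obtain ⟨h1, h2⟩ := expAt_normalChart hy
    have hlt : normAt x (normalChart E x y) < normalRadius E x := by rwa [h2]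
    have hcont : ContinuousAt (expAt x : E → M) (normalChart E x y) :=
      (continuousOn_expAt x).continuousAt
        ((isOpen_lt (continuous_normAt x) continuous_const).mem_nhds hlt)
    have hev : ∀ᶠ w in 𝓝 (normalChart E x y), isotropyMap E x g w = w := by
      have h3 : ∀ᶠ z in 𝓝 (expAt x (normalChart E x y)), g z = z := by rw [h1]; exact hyT
      filter_upwards [hcont.eventually h3,
        (isOpen_lt (continuous_normAt x) continuous_const).mem_nhds hlt] with w hw hw'
      exact (map_expAt_eq_self_iff hgx hw').1 hw
    intro v
    have hc : Tendsto (fun s : ℝ => normalChart E x y + s • v) (𝓝[>] 0)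
        (𝓝 (normalChart E x y)) := by
      have : Continuous fun s : ℝ => normalChart E x y + s • v := by fun_prop
      have := this.tendsto 0
      rw [zero_smul, add_zero] at this
      exact this.mono_left nhdsWithin_le_nhds
    obtain ⟨s, hs, hs0⟩ := ((hc.eventually hev).and self_mem_nhdsWithin).exists
    have hs0 : 0 < s := hs0
    rw [map_add, hev.self_of_nhds, add_right_inj] at hs
    exact isotropyMap_eq_of_smul hs0.ne' hs
  have huniv : T = univ := IsClopen.eq_univ ⟨hclosed, hopen⟩ ⟨p, hlocal p hg h⟩
  ext x
  have : x ∈ T := huniv ▸ mem_univ x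
  exact this.self_of_nhds

end Isotropy

/-! ## Minimizing curves and geodesics -/

section Geodesics

open Set Filter

set_option synthInstance.maxHeartbeats 200000
set_option linter.unusedSectionVars false

universe u

variable {E : Type u} [NormedAddCommGroup E] [NormedSpace ℝ E]
  {M : Type*} [MetricSpace M] [ChartedSpace E M]
  [Bundle.RiemannianBundle (fun x : M => TangentSpace 𝓘(ℝ, E) x)]
  [FiniteDimensional ℝ E] [IsManifold 𝓘(ℝ, E) ∞ M] [IsRiemannianManifold 𝓘(ℝ, E) M]
  [IsContMDiffRiemannianBundle 𝓘(ℝ, E) ∞ E (fun x : M => TangentSpace 𝓘(ℝ, E) x)]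

variable (E) in
theorem exists_expAt_of_minimizing {γ : ℝ → M} {p : M} {a c : ℝ} (ha : 0 < a) (hγ0 : γ 0 = p)
    (hγ : ∀ s ∈ Icc 0 a, ∀ s' ∈ Icc 0 a, dist (γ s) (γ s') = c * |s - s'|) :
    ∃ v : E, normAt p v = c ∧ ∃ b > 0, ∀ s ∈ Icc 0 b, γ s = expAt p (s • v) := by
  have hR := normalRadius_pos (E := E) p
  set b := min a (normalRadius E p / (2 * (|c| + 1)))
  have hb : 0 < b := by positivity
  have hcb : c * b < normalRadius E p := by
    have h1 : b * (2 * (|c| + 1)) ≤ normalRadius E p := by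
      rw [← le_div_iff₀ (by positivity)]
      exact min_le_right _ _
    nlinarith [le_abs_self c, abs_nonneg c]
  have hsub : Icc 0 b ⊆ Icc 0 a := Icc_subset_Icc_right (min_le_left _ _)
  obtain ⟨v, hv, hv'⟩ := (isNormalChart_normalChart (E := E) p).exists_eq_symm_smul hb hγ0 hcb
    fun s hs s' hs' => hγ s (hsub hs) s' (hsub hs')
  exact ⟨v, hv, b, hb, hv'⟩

/-- By the parallelogram law |w + v|² = 2c² + 2c² - 4c² = 0. This excludes a corner of a minimizing
curve at an interior point. -/
theorem eq_neg_of_normAt_sub {p : M} {v w : E} {c : ℝ} (hv : normAt p v = c) (hw : normAt p w = c)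
    (h : normAt p (w - v) = 2 * c) : w = -v := by
  have h1 : metricForm p (w - v) (w - v) = 4 * c ^ 2 := by
    rw [metricForm_apply, metricAt_self, h]; ring
  have h2 : metricForm p v v = c ^ 2 := by rw [metricForm_apply, metricAt_self, hv]
  have h3 : metricForm p w w = c ^ 2 := by rw [metricForm_apply, metricAt_self, hw]
  have h4 : metricForm p (w + v) (w + v) = 0 := by
    simp only [map_sub, map_add, sub_apply, add_apply] at h1 ⊢
    linarith
  rw [metricForm_apply, metricAt_self] at h4
  exact eq_neg_of_add_eq_zero_left (normAt_eq_zero.1 (pow_eq_zero_iff two_ne_zero |>.1 h4))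

variable (E) in
/-- Around an interior point of its domain, a minimizing curve is a geodesic line in normal
coordinates. -/
theorem exists_expAt_of_minimizing_nhds {γ : ℝ → M} {t a c : ℝ} (ha : 0 < a)
    (hγ : ∀ s ∈ Icc (t - a) (t + a), ∀ s' ∈ Icc (t - a) (t + a),
      dist (γ s) (γ s') = c * |s - s'|) :
    ∃ v : E, normAt (γ t) v = c ∧ ∀ᶠ s in 𝓝 (0 : ℝ), γ (t + s) = expAt (γ t) (s • v) := by
  obtain ⟨v, hv, b, hb, hvb⟩ := exists_expAt_of_minimizing E (γ := fun s => γ (t + s)) ha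
    (by rw [add_zero]) (fun s hs s' hs' => by
      rw [hγ _ ⟨by linarith [hs.1], by linarith [hs.2]⟩ _
        ⟨by linarith [hs'.1], by linarith [hs'.2]⟩, add_sub_add_left_eq_sub])
  obtain ⟨w, hw, b', hb', hwb⟩ := exists_expAt_of_minimizing E (γ := fun s => γ (t - s)) ha
    (by rw [sub_zero]) (fun s hs s' hs' => by
      rw [hγ _ ⟨by linarith [hs.2], by linarith [hs.1]⟩ _
        ⟨by linarith [hs'.2], by linarith [hs'.1]⟩, sub_sub_sub_cancel_left, abs_sub_comm])
  have hc : 0 ≤ c := hv ▸ normAt_nonneg _ _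
  -- The points at times t + s and t - s are 2cs apart, so the directions of the two halves differ
  -- by a vector of norm 2c.
  have hwv : w = -v := by
    refine eq_neg_of_normAt_sub hv hw (tendsto_nhds_unique (tendsto_dist_expAt_div _ v w) ?_)
    refine tendsto_const_nhds.congr' ?_
    filter_upwards [Ioc_mem_nhdsGT hb, Ioc_mem_nhdsGT hb', Ioc_mem_nhdsGT ha] with s h1 h2 h3
    rw [← hvb s ⟨h1.1.le, h1.2⟩, ← hwb s ⟨h2.1.le, h2.2⟩,
      hγ _ ⟨by linarith [h3.1], by linarith [h3.2]⟩ _ ⟨by linarith [h3.2], by linarith [h3.1]⟩,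
      show t + s - (t - s) = 2 * s by ring, abs_of_pos (by linarith [h1.1])]
    have := h1.1.ne'
    field_simp
  refine ⟨v, hv, ?_⟩
  filter_upwards [Ioo_mem_nhds (neg_lt_zero.2 hb') hb] with s hs
  rcases le_total 0 s with h | h
  · exact hvb s ⟨h, hs.2.le⟩
  · have := hwb (-s) ⟨by linarith, by linarith [hs.1]⟩
    rwa [sub_neg_eq_add, hwv, neg_smul_neg] at this

variable (E) in
theorem IsGeodesic.exists_expAt {γ : ℝ → M} (hγ : IsGeodesic γ) (t : ℝ) :
    ∃ v : E, ∀ᶠ s in 𝓝 (0 : ℝ), γ (t + s) = expAt (γ t) (s • v) := by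
  obtain ⟨c, hc⟩ := hγ
  obtain ⟨ε, hε, h⟩ := hc t
  obtain ⟨v, -, hv⟩ := exists_expAt_of_minimizing_nhds E (γ := γ) (t := t) (c := c) (half_pos hε)
    fun s hs s' hs' => h s s' (by rw [abs_lt]; constructor <;> linarith [hs.1, hs.2])
      (by rw [abs_lt]; constructor <;> linarith [hs'.1, hs'.2])
  exact ⟨v, hv⟩

/-- Unique continuation of minimizing curves. -/
theorem minimizing_unique (E : Type u) [NormedAddCommGroup E] [NormedSpace ℝ E]
    [FiniteDimensional ℝ E]
    {M : Type*} [MetricSpace M] [ChartedSpace E M] [IsManifold 𝓘(ℝ, E) ∞ M]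
    [Bundle.RiemannianBundle (fun x : M => TangentSpace 𝓘(ℝ, E) x)]
    [IsContMDiffRiemannianBundle 𝓘(ℝ, E) ∞ E (fun x : M => TangentSpace 𝓘(ℝ, E) x)]
    [IsRiemannianManifold 𝓘(ℝ, E) M]
    {α β : ℝ → M} {a c : ℝ}
    (hα : ∀ s ∈ Icc 0 a, ∀ s' ∈ Icc 0 a, dist (α s) (α s') = c * |s - s'|)
    (hβ : ∀ s ∈ Icc 0 a, ∀ s' ∈ Icc 0 a, dist (β s) (β s') = c * |s - s'|) {b : ℝ} (hb : 0 < b)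
    (h : ∀ s ∈ Icc 0 b, α s = β s) : ∀ s ∈ Icc 0 a, α s = β s := by
  let T : Set ℝ := {t | ∀ s ∈ Icc 0 t, α s = β s}
  have hsub : Icc 0 a ⊆ T := by
    apply IsClosed.Icc_subset_of_forall_exists_gt
    · rw [← closure_subset_iff_isClosed]
      intro t ht
      have htI : t ∈ Icc 0 a :=
        closure_minimal inter_subset_right isClosed_Icc ht
      refine ⟨fun s hs => ?_, htI⟩
      have hsI : s ∈ Icc 0 a := ⟨hs.1, hs.2.trans htI.2⟩
      by_contra hne
      have hpos : 0 < dist (α s) (β s) := dist_pos.2 hne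
      obtain ⟨t', ⟨ht'T, ht'I⟩, htt'⟩ := Metric.mem_closure_iff.1 ht
        (dist (α s) (β s) / (2 * (|c| + 1))) (by positivity)
      rcases le_or_gt s t' with hst | hst
      · exact hne (ht'T s ⟨hs.1, hst⟩)
      · have h1 := dist_triangle4_right (α s) (β s) (α t') (β t')
        rw [hα s hsI t' ht'I, hβ s hsI t' ht'I, ht'T t' ⟨ht'I.1, le_rfl⟩, dist_self, add_zero,
          abs_of_pos (sub_pos.2 hst)] at h1
        rw [lt_div_iff₀ (by positivity), Real.dist_eq, abs_of_pos (by linarith [hs.2])] at htt'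
        have h2 : c * (s - t') ≤ |c| * (t - t') :=
          mul_le_mul (le_abs_self c) (by linarith [hs.2]) (by linarith) (abs_nonneg c)
        linarith [hs.2]
    · intro s hs
      have : s = 0 := le_antisymm hs.2 hs.1
      exact h s ⟨hs.1, this ▸ hb.le⟩
    · rintro x ⟨hxT, hxI⟩ y hy
      have hy : x < y := hy
      rcases hxI.1.eq_or_lt with rfl | hx0
      · exact ⟨min b y, fun s hs => h s ⟨hs.1, hs.2.trans (min_le_left _ _)⟩,
          lt_min hb hy, min_le_right _ _⟩
      -- Around an interior time both curves are geodesic lines through the same point. Their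
      -- agreement to the left of `x` forces equal directions, hence agreement to the right as well.
      · set r := min x (a - x)
        have hr : 0 < r := lt_min hx0 (sub_pos.2 hxI.2)
        have hIcc : Icc (x - r) (x + r) ⊆ Icc 0 a := by
          have h1 : r ≤ x := min_le_left _ _
          have h2 : r ≤ a - x := min_le_right _ _
          exact Icc_subset_Icc (by linarith) (by linarith)
        obtain ⟨v, -, hv⟩ := exists_expAt_of_minimizing_nhds E hr
          fun s hs s' hs' => hα s (hIcc hs) s' (hIcc hs')
        obtain ⟨w, -, hw⟩ := exists_expAt_of_minimizing_nhds E hr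
          fun s hs s' hs' => hβ s (hIcc hs) s' (hIcc hs')
        have hxx : α x = β x := hxT x ⟨hx0.le, le_rfl⟩
        rw [← hxx] at hw
        have hR := normalRadius_pos (E := E) (α x)
        have hvw : v = w := by
          have hev : ∀ᶠ s in 𝓝[<] (0 : ℝ), s < 0 ∧ -x < s := by
            filter_upwards [self_mem_nhdsWithin,
              nhdsWithin_le_nhds (Ioi_mem_nhds (neg_lt_zero.2 hx0))] with s h1 h2 using ⟨h1, h2⟩
          obtain ⟨s, ⟨h1, h2⟩, h3, h4, h5, h6⟩ := (hev.and (Eventually.filter_mono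
            nhdsWithin_le_nhds (hv.and (hw.and ((eventually_normAt_smul_lt (α x) v hR).and
              (eventually_normAt_smul_lt (α x) w hR)))))).exists
          rw [hxT (x + s) ⟨by linarith, by linarith⟩, h4] at h3
          exact smul_right_injective E h1.ne (expAt_injOn h6 h5 h3).symm
        have hev : ∀ᶠ s in 𝓝 (0 : ℝ), α (x + s) = β (x + s) := by
          filter_upwards [hv, hw] with s h1 h2
          rw [h1, h2, hvw]
        obtain ⟨δ, hδ, hball⟩ := Metric.eventually_nhds_iff_ball.1 hev
        refine ⟨min (x + δ / 2) y, fun s hs => ?_, lt_min (by linarith) hy, min_le_right _ _⟩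
        rcases le_total s x with hsx | hsx
        · exact hxT s ⟨hs.1, hsx⟩
        · have := hball (s - x) (by
            rw [Metric.mem_ball, dist_zero_right, Real.norm_eq_abs, abs_of_nonneg (by linarith)]
            have := hs.2.trans (min_le_left _ _)
            linarith)
          rwa [add_sub_cancel] at this
  exact fun s hs => hsub hs s ⟨hs.1, le_rfl⟩

/-! ## Tangent vectors -/

theorem velocity_eq_iff {γ : ℝ → M} {t : ℝ} {p : M} {v : E} :
    velocity E γ t = ⟨p, v⟩ ↔
      γ t = p ∧ (mfderiv 𝓘(ℝ, ℝ) 𝓘(ℝ, E) γ t : ℝ → E) 1 = v := by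
  constructor
  · intro h
    have h1 : γ t = p := congrArg Bundle.TotalSpace.proj h
    subst h1
    exact ⟨rfl, eq_of_heq (Bundle.TotalSpace.mk.inj h).2⟩
  · rintro ⟨rfl, rfl⟩
    rfl

theorem mdifferentiableAt_expAt_smul (p : M) (v : E) :
    MDifferentiableAt 𝓘(ℝ, ℝ) 𝓘(ℝ, E) (fun s : ℝ => expAt p (s • v)) 0 ∧
      velocity E (fun s : ℝ => expAt p (s • v)) 0 = ⟨p, v⟩ := by
  have hφ := isNormalChart_normalChart (E := E) p
  have h0 : (0 : ℝ) • v ∈ (normalChart E p).target := by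
    rw [zero_smul]; exact hφ.mem_target (by rw [normAt_zero]; exact hφ.radius_pos)
  have hd : HasDerivAt (fun s : ℝ => s • v) v 0 := by
    have := (hasDerivAt_id (0 : ℝ)).smul_const v
    rwa [one_smul] at this
  have hsymm := (mdifferentiable_of_mem_maximalAtlas hφ.mem_atlas).mdifferentiableAt_symm h0
  refine ⟨hsymm.comp (0 : ℝ) hd.differentiableAt.mdifferentiableAt, ?_⟩
  rw [velocity_eq_iff]
  refine ⟨by simp only [zero_smul, expAt_zero], ?_⟩
  have h1 := mfderiv_comp (0 : ℝ) hsymm hd.differentiableAt.mdifferentiableAt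
  refine (DFunLike.congr_fun h1 1).trans ?_
  have h5 : mfderiv 𝓘(ℝ, ℝ) 𝓘(ℝ, E) (fun s : ℝ => s • v) 0 1 = v := by
    rw [mfderiv_eq_fderiv]
    exact hd.hasFDerivAt.fderiv ▸ one_smul ℝ v
  rw [ContinuousLinearMap.comp_apply, h5]
  have h6 := chartSymmDeriv_chartDeriv hφ.mem_atlas hφ.center_mem v
  rw [hφ.deriv_center, hφ.map_center, ← zero_smul ℝ v] at h6
  exact h6

theorem hasDerivAt_normalChart_comp {p : M} {v : E} {c : ℝ → M}
    (hc : MDifferentiableAt 𝓘(ℝ, ℝ) 𝓘(ℝ, E) c 0) (hv : velocity E c 0 = ⟨p, v⟩) :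
    HasDerivAt (fun t => normalChart E p (c t)) v 0 := by
  have hφ := isNormalChart_normalChart (E := E) p
  obtain ⟨h0, h1⟩ := velocity_eq_iff.1 hv
  subst h0
  have hmd := (mdifferentiable_of_mem_maximalAtlas hφ.mem_atlas).mdifferentiableAt hφ.center_mem
  have h2 := (hmd.comp (0 : ℝ) hc).differentiableAt.hasDerivAt
  refine h2.congr_deriv ?_
  have h3 := mfderiv_comp (0 : ℝ) hmd hc
  rw [← fderiv_apply_one_eq_deriv, ← mfderiv_eq_fderiv]
  refine (DFunLike.congr_fun h3 1).trans ?_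
  rw [ContinuousLinearMap.comp_apply]
  refine (congrArg _ h1).trans ?_
  exact hφ.deriv_center v

/-- The tangent space of a set which is a linear slice in the normal chart at `p`. -/
theorem tangentVectors_eq {S : Set M} {p : M} {V : Submodule ℝ E}
    (h : ∀ x, dist p x < normalRadius E p → (x ∈ S ↔ normalChart E p x ∈ V)) :
    tangentVectors E S p = {v | (v : E) ∈ V} := by
  have hR := normalRadius_pos (E := E) p
  have hφ := isNormalChart_normalChart (E := E) p
  ext v
  constructor
  · rintro ⟨c, hcS, hc, hv⟩
    have h0 : c 0 = p := (velocity_eq_iff.1 hv).1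
    have hd := hasDerivAt_normalChart_comp hc hv
    have hmem : ∀ᶠ t in 𝓝 (0 : ℝ), normalChart E p (c t) ∈ V := by
      have h1 : ∀ᶠ t in 𝓝 (0 : ℝ), c t ∈ Metric.ball p (normalRadius E p) :=
        hc.continuousAt.eventually_mem (by rw [h0]; exact Metric.ball_mem_nhds _ hR)
      filter_upwards [hcS, h1] with t h2 h3
      rw [Metric.mem_ball, dist_comm] at h3
      exact (h _ h3).1 h2
    have hVc : IsClosed (V : Set E) := V.closed_of_finiteDimensional
    refine hVc.mem_of_tendsto (hasDerivAt_iff_tendsto_slope.1 hd) ?_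
    filter_upwards [nhdsWithin_le_nhds hmem] with t ht
    rw [slope_def_module]
    exact V.smul_mem _ (V.sub_mem ht hmem.self_of_nhds)
  · intro hv
    obtain ⟨u, rfl⟩ : ∃ u : E, u = v := ⟨v, rfl⟩
    refine ⟨fun s => expAt p (s • u), ?_, mdifferentiableAt_expAt_smul p u⟩
    filter_upwards [eventually_normAt_smul_lt p u hR] with s hs
    rw [h _ (by rwa [dist_expAt hs]), normalChart_expAt hs]
    exact V.smul_mem _ hv

/-! ## Fixed point sets of isometries -/

variable (E) in
/-- The space of tangent vectors at `p` that are fixed by the differential of `g`. -/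
noncomputable def fixedVectors (p : M) (g : M ≃ᵢ M) : Submodule ℝ E :=
  LinearMap.ker (isotropyMap E p g - LinearMap.id)

theorem mem_fixedVectors {p : M} {g : M ≃ᵢ M} {v : E} :
    v ∈ fixedVectors E p g ↔ isotropyMap E p g v = v := by
  rw [fixedVectors, LinearMap.mem_ker, LinearMap.sub_apply, LinearMap.id_apply, sub_eq_zero]

-- The radial segment from `p` to a nearby fixed point consists of fixed points. So all fixed points
-- in the normal ball at `p` belong to the component of `p`.
variable (E) in
theorem mem_connectedComponentIn_fixed_iff {g : M ≃ᵢ M} {o p : M}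
    (hp : p ∈ connectedComponentIn {x | g x = x} o) {x : M} (hx : dist p x < normalRadius E p) :
    x ∈ connectedComponentIn {x | g x = x} o ↔ normalChart E p x ∈ fixedVectors E p g := by
  have hgp : g p = p := connectedComponentIn_subset {x | g x = x} _ hp
  obtain ⟨h1, h2⟩ := expAt_normalChart hx
  set v := normalChart E p x
  have hv : normAt p v < normalRadius E p := by rwa [h2]
  rw [mem_fixedVectors]
  constructor
  · intro hxC
    have hgx : g x = x := connectedComponentIn_subset {x | g x = x} _ hxC
    rw [← h1] at hgx
    exact (map_expAt_eq_self_iff hgp hv).1 hgx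
  · intro hL
    have hcont : ContinuousOn (fun s : ℝ => expAt p (s • v)) (Icc 0 1) :=
      (continuousOn_expAt p).comp (by fun_prop) fun s hs => normAt_smul_lt hv hs
    have hsub : (fun s : ℝ => expAt p (s • v)) '' Icc 0 1 ⊆ {x | g x = x} := by
      rintro _ ⟨s, hs, rfl⟩
      exact (map_expAt_eq_self_iff hgp (normAt_smul_lt hv hs)).2 (by rw [map_smul, hL])
    rw [connectedComponentIn_eq hp]
    refine (isPreconnected_Icc.image _ hcont).subset_connectedComponentIn ⟨0, by simp, ?_⟩ hsub
      ⟨1, by simp, ?_⟩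
    · simp only [zero_smul, expAt_zero]
    · simp only [one_smul, h1]

variable (E) in
theorem tangentVectors_connectedComponentIn_fixed {g : M ≃ᵢ M} {o p : M}
    (hp : p ∈ connectedComponentIn {x | g x = x} o) :
    tangentVectors E (connectedComponentIn {x | g x = x} o) p =
      {v | (v : E) ∈ fixedVectors E p g} :=
  tangentVectors_eq fun _ hx => mem_connectedComponentIn_fixed_iff E hp hx

variable (E) in
/-- The components of the fixed point set of an isometry are totally geodesic. -/
theorem isTotallyGeodesicSubmanifold_connectedComponentIn_fixed {g : M ≃ᵢ M} {o : M}
    (ho : g o = o) :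
    IsTotallyGeodesicSubmanifold E (connectedComponentIn {x | g x = x} o) where
  connected := isConnected_connectedComponentIn_iff.2 ho
  submanifold := by
    intro p hp
    have hφ := isNormalChart_normalChart (E := E) p
    refine ⟨normalChart E p, hφ.mem_atlas, hφ.center_mem, fixedVectors E p g, fun x hx => ?_⟩
    rw [hφ.source_eq, Metric.mem_ball, dist_comm] at hx
    rw [hφ.map_center, sub_zero]
    exact mem_connectedComponentIn_fixed_iff E hp hx
  geodesic := by
    intro γ hγ h0 ⟨v, hv, hvel⟩
    have hcont : Continuous γ := by
      obtain ⟨c, hc⟩ := hγ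
      rw [continuous_iff_continuousAt]
      intro t
      obtain ⟨ε, hε, h⟩ := hc t
      rw [ContinuousAt, tendsto_iff_dist_tendsto_zero]
      have h1 : Tendsto (fun s : ℝ => c * |s - t|) (𝓝 t) (𝓝 0) := by
        have : Continuous fun s : ℝ => c * |s - t| := by fun_prop
        simpa using this.tendsto t
      refine h1.congr' ?_
      filter_upwards [Metric.ball_mem_nhds t hε] with s hs
      exact (h s t hs (by simpa using hε)).symm
    have hlocal : ∀ t, ∃ w : E, ∀ᶠ s in 𝓝 t, γ s = expAt (γ t) ((s - t) • w) ∧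
        normAt (γ t) ((s - t) • w) < normalRadius E (γ t) := by
      intro t
      obtain ⟨w, hw⟩ := hγ.exists_expAt E t
      have hlim : Tendsto (fun s : ℝ => s - t) (𝓝 t) (𝓝 0) := by
        have : Continuous fun s : ℝ => s - t := by fun_prop
        simpa using this.tendsto t
      refine ⟨w, ?_⟩
      filter_upwards [hlim.eventually hw,
        hlim.eventually (eventually_normAt_smul_lt (γ t) w (normalRadius_pos (E := E) (γ t)))]
        with s h1 h2
      rw [add_sub_cancel] at h1
      exact ⟨h1, h2⟩
    have hfix : ∀ t, g (γ t) = γ t → ∀ w : E, isotropyMap E (γ t) g w = w →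
        (∀ᶠ s in 𝓝 t, γ s = expAt (γ t) ((s - t) • w) ∧
          normAt (γ t) ((s - t) • w) < normalRadius E (γ t)) → ∀ᶠ s in 𝓝 t, g (γ s) = γ s := by
      intro t ht w hL hw
      filter_upwards [hw] with s hs
      rw [hs.1, map_expAt_eq_self_iff ht hs.2, map_smul, hL]
    let T : Set ℝ := {t | ∀ᶠ s in 𝓝 t, g (γ s) = γ s}
    have hopen : IsOpen T := isOpen_setOfPred_eventually_nhds
    have hclosed : IsClosed T := by
      rw [← closure_subset_iff_isClosed]
      intro t ht
      have htg : g (γ t) = γ t := by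
        have h1 : IsClosed {t | g (γ t) = γ t} := isClosed_eq (g.continuous.comp hcont) hcont
        exact h1.closure_subset_iff.2 (fun s hs => Eventually.self_of_nhds hs) ht
      -- A time s ≠ t is needed: there (s - t) • w is a fixed vector, and dividing by s - t shows
      -- that the direction `w` itself is fixed.
      have hfreq : ∃ᶠ s in 𝓝 t, s ∈ T ∩ {t}ᶜ :=
        mem_closure_iff_frequently.1 (closure_minimal
          ((dense_compl_singleton t).open_subset_closure_inter hopen) isClosed_closure ht)
      obtain ⟨w, hw⟩ := hlocal t
      obtain ⟨s, ⟨hsT, hst⟩, h1, h2⟩ := (hfreq.and_eventually hw).exists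
      have hsT : ∀ᶠ r in 𝓝 s, g (γ r) = γ r := hsT
      have hs := hsT.self_of_nhds
      rw [h1, map_expAt_eq_self_iff htg h2] at hs
      exact hfix t htg w (isotropyMap_eq_of_smul (sub_ne_zero.2 hst) hs) hw
    have h0T : (0 : ℝ) ∈ T := by
      have hg0 : g (γ 0) = γ 0 := connectedComponentIn_subset {x | g x = x} _ h0
      obtain ⟨w, hw⟩ := hlocal 0
      refine hfix 0 hg0 w ?_ hw
      rw [tangentVectors_connectedComponentIn_fixed E h0] at hv
      have hwv : w = v := by
        have h2 : γ =ᶠ[𝓝 0] fun s => expAt (γ 0) (s • w) := by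
          filter_upwards [hw] with s hs
          rw [sub_zero] at hs
          exact hs.1
        have h3 := (velocity_eq_iff.1 (mdifferentiableAt_expAt_smul (γ 0) w).2).2
        have h4 := (velocity_eq_iff.1 hvel).2
        rw [← h3, ← h4]
        exact (DFunLike.congr_fun h2.mfderiv_eq 1).symm
      rw [hwv]
      exact mem_fixedVectors.1 hv
    have huniv : T = univ := IsClopen.eq_univ ⟨hclosed, hopen⟩ ⟨0, h0T⟩
    have hsub : range γ ⊆ {x | g x = x} := by
      rintro _ ⟨t, rfl⟩
      have : t ∈ T := huniv ▸ mem_univ t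
      exact this.self_of_nhds
    intro t
    rw [connectedComponentIn_eq h0]
    exact (isPreconnected_range hcont).subset_connectedComponentIn ⟨0, rfl⟩ hsub ⟨t, rfl⟩

end Geodesics

/-! ## Isometries of compact spaces and geodesic symmetries -/

section MetricPart

open Set Filter

theorem IsGeodesicSymmetry.conj {M : Type*} [MetricSpace M] {o : M} {s : M ≃ᵢ M}
    (hs : IsGeodesicSymmetry o s) (g : M ≃ᵢ M) : IsGeodesicSymmetry (g o) (g * s * g⁻¹) where
  involutive := by
    have := hs.involutive
    calc g * s * g⁻¹ * (g * s * g⁻¹) = g * (s * s) * g⁻¹ := by group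
      _ = 1 := by rw [this]; group
  fixes := by
    simp only [IsometryEquiv.mul_apply, IsometryEquiv.inv_apply_self, hs.fixes]
  isolated := by
    have h1 : Tendsto (fun x => g⁻¹ x) (𝓝[≠] (g o)) (𝓝[≠] o) := by
      refine tendsto_nhdsWithin_iff.2 ⟨?_, ?_⟩
      · have := (g⁻¹).continuous.tendsto (g o)
        rw [IsometryEquiv.inv_apply_self] at this
        exact this.mono_left nhdsWithin_le_nhds
      · filter_upwards [self_mem_nhdsWithin] with x hx h
        refine hx ?_
        rw [mem_singleton_iff] at h
        rw [mem_singleton_iff, ← h, IsometryEquiv.apply_inv_self]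
    filter_upwards [h1.eventually hs.isolated] with x hx h
    refine hx ?_
    rw [IsometryEquiv.mul_apply, IsometryEquiv.mul_apply] at h
    conv_rhs => rw [← h]
    rw [IsometryEquiv.inv_apply_self]

theorem isGeodesicSymmetry_geodesicSymmetry {M : Type*} [MetricSpace M] [IsSymmetricSpace M]
    (o : M) : IsGeodesicSymmetry o (geodesicSymmetry o) :=
  (IsSymmetricSpace.exists_symmetry o).choose_spec

/-- Isometries of a compact space converge pointwise along any ultrafilter. -/
theorem exists_isometryEquiv_tendsto {M : Type*} [MetricSpace M] [CompactSpace M] {ι : Type*}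
    (𝒰 : Ultrafilter ι) (f : ι → M ≃ᵢ M) :
    ∃ h : M ≃ᵢ M, ∀ x, Tendsto (fun i => f i x) 𝒰 (𝓝 (h x)) := by
  have hlim : ∀ u : ι → M, ∃ y, Tendsto u 𝒰 (𝓝 y) := by
    intro u
    obtain ⟨y, -, hy⟩ := isCompact_univ.ultrafilter_le_nhds (𝒰.map u) (by simp)
    exact ⟨y, hy⟩
  choose h hh using fun x => hlim fun i => f i x
  -- The limit of the inverses supplies the inverse of the limit, which makes it surjective.
  choose k hk using fun x => hlim fun i => (f i)⁻¹ x
  have hiso : Isometry h := Isometry.of_dist_eq fun x y => by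
    refine tendsto_nhds_unique ((hh x).dist (hh y)) ?_
    simp only [(f _).isometry.dist_eq]
    exact tendsto_const_nhds
  have hinv : ∀ x, h (k x) = x := fun x => by
    refine tendsto_nhds_unique (hh (k x)) (tendsto_iff_dist_tendsto_zero.2 ?_)
    refine (tendsto_iff_dist_tendsto_zero.1 (hk x)).congr fun i => ?_
    rw [← (f i).isometry.dist_eq, (f i).apply_inv_self, dist_comm]
  exact ⟨IsometryEquiv.mk' h k hinv hiso, hh⟩

theorem continuous_isometryEquiv_mul_left {M : Type*} [MetricSpace M] (g : M ≃ᵢ M) :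
    Continuous fun f : M ≃ᵢ M => g * f := by
  refine continuous_induced_rng.2 ?_
  have h1 : Continuous fun f : M ≃ᵢ M => (⟨f, f.continuous⟩ : C(M, M)) := continuous_induced_dom
  exact (ContinuousMap.continuous_postcomp ⟨g, g.continuous⟩).comp h1

/-- Isometries are equicontinuous, so pointwise continuity in the parameter implies joint
continuity, and hence continuity for the compact-open topology. -/
theorem continuous_isometryEquiv_of_pointwise {M X : Type*} [MetricSpace M] [TopologicalSpace X]
    {F : X → M ≃ᵢ M} (hF : ∀ x, Continuous fun q => F q x) : Continuous F := by
  refine continuous_induced_rng.2 ?_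
  refine ContinuousMap.continuous_of_continuous_uncurry _ ?_
  rw [continuous_iff_continuousAt]
  rintro ⟨p, x⟩
  rw [ContinuousAt, tendsto_iff_dist_tendsto_zero]
  have h1 : Tendsto (fun z : X × M => dist z.2 x + dist (F z.1 x) (F p x)) (𝓝 (p, x)) (𝓝 0) := by
    have : Continuous fun z : X × M => dist z.2 x + dist (F z.1 x) (F p x) :=
      (continuous_snd.dist continuous_const).add
        (((hF x).comp continuous_fst).dist continuous_const)
    simpa using this.tendsto (p, x)
  refine squeeze_zero (fun _ => dist_nonneg) (fun z => ?_) h1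
  change dist (F z.1 z.2) (F p x) ≤ _
  refine (dist_triangle _ (F z.1 x) _).trans ?_
  rw [(F z.1).isometry.dist_eq]

end MetricPart

/-! ### Geodesic symmetries, homogeneity and the identity component -/

section Symmetries

open Set Filter

set_option synthInstance.maxHeartbeats 200000
set_option linter.unusedSectionVars false

universe u

variable {E : Type u} [NormedAddCommGroup E] [NormedSpace ℝ E]
  {M : Type*} [MetricSpace M] [ChartedSpace E M]
  [Bundle.RiemannianBundle (fun x : M => TangentSpace 𝓘(ℝ, E) x)]
  [FiniteDimensional ℝ E] [IsManifold 𝓘(ℝ, E) ∞ M] [IsRiemannianManifold 𝓘(ℝ, E) M]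
  [IsContMDiffRiemannianBundle 𝓘(ℝ, E) ∞ E (fun x : M => TangentSpace 𝓘(ℝ, E) x)]

theorem tendsto_expAt_smul (p : M) {v : E} (hv : v ≠ 0) :
    Tendsto (fun s : ℝ => expAt p (s • v)) (𝓝[>] 0) (𝓝[≠] p) := by
  refine tendsto_nhdsWithin_iff.2 ⟨?_, ?_⟩
  · have := (mdifferentiableAt_expAt_smul p v).1.continuousAt.tendsto
    simp only [zero_smul, expAt_zero] at this
    exact this.mono_left nhdsWithin_le_nhds
  · filter_upwards [eventually_normAt_smul_lt_right p v (normalRadius_pos (E := E) p)] with s hs h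
    have h1 := dist_expAt hs.2
    rw [show expAt p (s • v) = p from h, dist_self, eq_comm, normAt_eq_zero, smul_eq_zero] at h1
    exact h1.elim hs.1.ne' hv

/-- The differential of a geodesic symmetry is `-1`. -/
theorem IsGeodesicSymmetry.isotropyMap_eq {o : M} {s : M ≃ᵢ M} (hs : IsGeodesicSymmetry o s)
    (v : E) : isotropyMap E o s v = -v := by
  have hsq : isotropyMap E o s (isotropyMap E o s v) = v := by
    rw [← isotropyMap_mul hs.fixes hs.fixes, hs.involutive, isotropyMap_one]
  by_contra hne
  -- For an involution L, the vector Lv + v is fixed. Were it nonzero, its radial curve would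
  -- consist of fixed points accumulating at `o`.
  have hu : isotropyMap E o s v + v ≠ 0 := fun h => hne (eq_neg_of_add_eq_zero_left h)
  have hfix : isotropyMap E o s (isotropyMap E o s v + v) = isotropyMap E o s v + v := by
    rw [map_add, hsq, add_comm]
  obtain ⟨t, h1, h2⟩ := (((tendsto_expAt_smul o hu).eventually hs.isolated).and
    (eventually_normAt_smul_lt_right o (isotropyMap E o s v + v)
      (normalRadius_pos (E := E) o))).exists
  exact h1 ((map_expAt_eq_self_iff hs.fixes h2.2).2 (by rw [map_smul, hfix]))

/-- The product of two symmetries at `o` has differential (-1)(-1) = 1, so it is the identity. -/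
theorem IsGeodesicSymmetry.unique (E : Type u) [NormedAddCommGroup E] [NormedSpace ℝ E]
    [FiniteDimensional ℝ E]
    {M : Type*} [MetricSpace M] [ChartedSpace E M] [IsManifold 𝓘(ℝ, E) ∞ M]
    [Bundle.RiemannianBundle (fun x : M => TangentSpace 𝓘(ℝ, E) x)]
    [IsContMDiffRiemannianBundle 𝓘(ℝ, E) ∞ E (fun x : M => TangentSpace 𝓘(ℝ, E) x)]
    [IsRiemannianManifold 𝓘(ℝ, E) M]
    [ConnectedSpace M] {o : M} {s s' : M ≃ᵢ M} (hs : IsGeodesicSymmetry o s)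
    (hs' : IsGeodesicSymmetry o s') : s = s' := by
  have h : s * s' = 1 := by
    refine eq_one_of_isotropyMap (E := E) (p := o) ?_ fun v => ?_
    · rw [IsometryEquiv.mul_apply, hs'.fixes, hs.fixes]
    · rw [isotropyMap_mul hs.fixes hs'.fixes, hs'.isotropyMap_eq, hs.isotropyMap_eq, neg_neg]
  calc s = s * (s' * s') := by rw [hs'.involutive, mul_one]
    _ = s' := by rw [← mul_assoc, h, one_mul]

theorem conj_geodesicSymmetry (E : Type u) [NormedAddCommGroup E] [NormedSpace ℝ E]
    [FiniteDimensional ℝ E]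
    {M : Type*} [MetricSpace M] [ChartedSpace E M] [IsManifold 𝓘(ℝ, E) ∞ M]
    [Bundle.RiemannianBundle (fun x : M => TangentSpace 𝓘(ℝ, E) x)]
    [IsContMDiffRiemannianBundle 𝓘(ℝ, E) ∞ E (fun x : M => TangentSpace 𝓘(ℝ, E) x)]
    [IsRiemannianManifold 𝓘(ℝ, E) M]
    [ConnectedSpace M] [IsSymmetricSpace M] (g : M ≃ᵢ M) (o : M) :
    g * geodesicSymmetry o * g⁻¹ = geodesicSymmetry (g o) :=
  IsGeodesicSymmetry.unique E ((isGeodesicSymmetry_geodesicSymmetry o).conj g)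
    (isGeodesicSymmetry_geodesicSymmetry (g o))

/-- Points in a normal ball are exchanged with the centre by the symmetry at the midpoint. -/
theorem exists_geodesicSymmetry_map_eq (E : Type u) [NormedAddCommGroup E] [NormedSpace ℝ E]
    [FiniteDimensional ℝ E]
    {M : Type*} [MetricSpace M] [ChartedSpace E M] [IsManifold 𝓘(ℝ, E) ∞ M]
    [Bundle.RiemannianBundle (fun x : M => TangentSpace 𝓘(ℝ, E) x)]
    [IsContMDiffRiemannianBundle 𝓘(ℝ, E) ∞ E (fun x : M => TangentSpace 𝓘(ℝ, E) x)]
    [IsRiemannianManifold 𝓘(ℝ, E) M]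
    [IsSymmetricSpace M] {x y : M} (hxy : dist x y < normalRadius E x) :
    ∃ m : M, geodesicSymmetry m x = y := by
  obtain ⟨h1, h2⟩ := expAt_normalChart hxy
  set v := normalChart E x y
  set γ : ℝ → M := fun s => expAt x (s • v) with hγdef
  have hγ : ∀ s ∈ Icc (0 : ℝ) 1, ∀ s' ∈ Icc (0 : ℝ) 1,
      dist (γ s) (γ s') = normAt x v * |s - s'| := fun s hs s' hs' => by
    rw [mul_comm]
    exact (isNormalChart_normalChart x).dist_radial (by rwa [h2]) hs hs'
  set m := γ (1 / 2) with hm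
  have hσ := isGeodesicSymmetry_geodesicSymmetry m
  obtain ⟨w, -, hw⟩ := exists_expAt_of_minimizing_nhds E (γ := γ) (t := 1 / 2) (half_pos one_pos)
    fun s hs s' hs' => hγ s ⟨by linarith [hs.1], by linarith [hs.2]⟩ s'
      ⟨by linarith [hs'.1], by linarith [hs'.2]⟩
  have hlim : Tendsto (fun s : ℝ => -s) (𝓝 0) (𝓝 0) := by
    have : Continuous fun s : ℝ => -s := by fun_prop
    simpa using this.tendsto 0
  -- The symmetry at the midpoint reverses the segment near the midpoint; unique continuation of
  -- minimizing curves carries this to the endpoints.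
  have hev : ∀ᶠ s in 𝓝 (0 : ℝ), γ (1 / 2 + s) = geodesicSymmetry m (γ (1 / 2 - s)) := by
    filter_upwards [hw, hlim.eventually hw, hlim.eventually
      (eventually_normAt_smul_lt m w (normalRadius_pos (E := E) m))] with s h3 h4 h5
    rw [sub_eq_add_neg, h3, h4, map_expAt hσ.fixes h5, hσ.isotropyMap_eq, neg_smul, neg_neg]
  obtain ⟨δ, hδ, hball⟩ := Metric.eventually_nhds_iff_ball.1 hev
  have hmain := minimizing_unique E (α := fun s => γ (1 / 2 + s))
    (β := fun s => geodesicSymmetry m (γ (1 / 2 - s))) (a := 1 / 2) (c := normAt x v)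
    (fun s hs s' hs' => by
      rw [hγ _ ⟨by linarith [hs.1], by linarith [hs.2]⟩ _
        ⟨by linarith [hs'.1], by linarith [hs'.2]⟩, add_sub_add_left_eq_sub])
    (fun s hs s' hs' => by
      rw [(geodesicSymmetry m).isometry.dist_eq, hγ _ ⟨by linarith [hs.2], by linarith [hs.1]⟩ _
        ⟨by linarith [hs'.2], by linarith [hs'.1]⟩, sub_sub_sub_cancel_left, abs_sub_comm])
    (half_pos hδ) (fun s hs => hball s (by
      rw [Metric.mem_ball, dist_zero_right, Real.norm_eq_abs, abs_of_nonneg hs.1]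
      linarith [hs.2])) (1 / 2) ⟨by norm_num, le_rfl⟩
  refine ⟨m, ?_⟩
  simp only [hγdef, sub_self, zero_smul, expAt_zero, add_halves, one_smul, h1] at hmain
  exact hmain.symm

/-- Symmetric spaces are homogeneous. -/
theorem exists_isometryEquiv_map_eq (E : Type u) [NormedAddCommGroup E] [NormedSpace ℝ E]
    [FiniteDimensional ℝ E]
    {M : Type*} [MetricSpace M] [ChartedSpace E M] [IsManifold 𝓘(ℝ, E) ∞ M]
    [Bundle.RiemannianBundle (fun x : M => TangentSpace 𝓘(ℝ, E) x)]
    [IsContMDiffRiemannianBundle 𝓘(ℝ, E) ∞ E (fun x : M => TangentSpace 𝓘(ℝ, E) x)]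
    [IsRiemannianManifold 𝓘(ℝ, E) M]
    [ConnectedSpace M] [IsSymmetricSpace M] (p q : M) : ∃ g : M ≃ᵢ M, g p = q := by
  let T : Set M := {y | ∃ g : M ≃ᵢ M, g p = y}
  have hnear : ∀ x y : M, dist x y < normalRadius E x → (x ∈ T ↔ y ∈ T) := by
    intro x y hxy
    obtain ⟨m, hm⟩ := exists_geodesicSymmetry_map_eq E hxy
    constructor
    · rintro ⟨g, rfl⟩
      exact ⟨geodesicSymmetry m * g, hm⟩
    · rintro ⟨g, hg⟩
      refine ⟨(geodesicSymmetry m)⁻¹ * g, ?_⟩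
      rw [IsometryEquiv.mul_apply, hg, ← hm, IsometryEquiv.inv_apply_self]
  have hopen : IsOpen T := isOpen_iff_mem_nhds.2 fun x hx => by
    filter_upwards [Metric.ball_mem_nhds x (normalRadius_pos (E := E) x)] with y hy
    rw [Metric.mem_ball, dist_comm] at hy
    exact (hnear x y hy).1 hx
  have hclosed : IsClosed T := isOpen_compl_iff.1 <| isOpen_iff_mem_nhds.2 fun x hx => by
    filter_upwards [Metric.ball_mem_nhds x (normalRadius_pos (E := E) x)] with y hy
    rw [Metric.mem_ball, dist_comm] at hy
    exact fun h => hx ((hnear x y hy).2 h)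
  have huniv : T = univ := IsClopen.eq_univ ⟨hclosed, hopen⟩ ⟨p, 1, rfl⟩
  have hq : q ∈ T := huniv ▸ mem_univ q
  exact hq

/-- At one point, v and -v in normal coordinates are 2|v| apart up to a factor 1/2; homogeneity
transports the estimate to all points. This uniform isolation of the fixed point survives limits of
symmetries. -/
theorem exists_le_dist_geodesicSymmetry (E : Type u) [NormedAddCommGroup E] [NormedSpace ℝ E]
    [FiniteDimensional ℝ E]
    {M : Type*} [MetricSpace M] [ChartedSpace E M] [IsManifold 𝓘(ℝ, E) ∞ M]
    [Bundle.RiemannianBundle (fun x : M => TangentSpace 𝓘(ℝ, E) x)]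
    [IsContMDiffRiemannianBundle 𝓘(ℝ, E) ∞ E (fun x : M => TangentSpace 𝓘(ℝ, E) x)]
    [IsRiemannianManifold 𝓘(ℝ, E) M]
    [ConnectedSpace M] [IsSymmetricSpace M] :
    ∃ r > 0, ∀ p x : M, dist p x < r → dist p x ≤ dist x (geodesicSymmetry p x) := by
  obtain ⟨o⟩ : Nonempty M := inferInstance
  have hσ := isGeodesicSymmetry_geodesicSymmetry o
  obtain ⟨δ, hδ, hδR, h⟩ := (isNormalChart_normalChart (E := E) o).dist_infinitesimal
    (ε := 1 / 2) (by norm_num) (by norm_num)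
  refine ⟨δ, hδ, fun p x hpx => ?_⟩
  obtain ⟨g, rfl⟩ := exists_isometryEquiv_map_eq E o p
  obtain ⟨y, rfl⟩ : ∃ y, g y = x := ⟨g⁻¹ x, g.apply_inv_self x⟩
  rw [← conj_geodesicSymmetry E, IsometryEquiv.mul_apply, IsometryEquiv.mul_apply,
    IsometryEquiv.inv_apply_self, g.isometry.dist_eq, g.isometry.dist_eq]
  rw [g.isometry.dist_eq] at hpx
  obtain ⟨h1, h2⟩ := expAt_normalChart (hpx.trans_le hδR)
  set v := normalChart E o y
  have hn : normAt o (-v) = normAt o v := by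
    rw [← neg_one_smul ℝ v, normAt_smul, abs_neg, abs_one, one_mul]
  have h3 := (h v (-v) (by rwa [h2]) (by rwa [hn, h2])).1
  rw [← neg_add', ← two_smul ℝ v, ← neg_smul, normAt_smul, abs_neg, abs_two, h2] at h3
  rw [← h1, map_expAt hσ.fixes (by rw [h2]; exact hpx.trans_le hδR), hσ.isotropyMap_eq, h1]
  have h4 : dist (expAt o v) (expAt o (-v)) ≥ (1 - 1 / 2) * (2 * dist o y) := h3
  rw [h1] at h4
  linarith

/-- The geodesic symmetry depends continuously on the point. -/
theorem continuous_geodesicSymmetry (E : Type u) [NormedAddCommGroup E] [NormedSpace ℝ E]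
    [FiniteDimensional ℝ E]
    {M : Type*} [MetricSpace M] [ChartedSpace E M] [IsManifold 𝓘(ℝ, E) ∞ M]
    [Bundle.RiemannianBundle (fun x : M => TangentSpace 𝓘(ℝ, E) x)]
    [IsContMDiffRiemannianBundle 𝓘(ℝ, E) ∞ E (fun x : M => TangentSpace 𝓘(ℝ, E) x)]
    [IsRiemannianManifold 𝓘(ℝ, E) M]
    [ConnectedSpace M] [IsSymmetricSpace M] [CompactSpace M] :
    Continuous (geodesicSymmetry : M → M ≃ᵢ M) := by
  obtain ⟨r, hr, hdist⟩ := exists_le_dist_geodesicSymmetry E (M := M)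
  have hσ : ∀ o : M, IsGeodesicSymmetry o (geodesicSymmetry o) :=
    isGeodesicSymmetry_geodesicSymmetry
  have hσσ : ∀ o x : M, geodesicSymmetry o (geodesicSymmetry o x) = x := fun o x =>
    DFunLike.congr_fun (hσ o).involutive x
  refine continuous_isometryEquiv_of_pointwise fun x => ?_
  rw [continuous_iff_continuousAt]
  intro p
  rw [ContinuousAt, tendsto_iff_ultrafilter]
  intro 𝒰 h𝒰
  obtain ⟨h, hh⟩ := exists_isometryEquiv_tendsto 𝒰 (geodesicSymmetry : M → M ≃ᵢ M)
  have hp : Tendsto (fun q => q) 𝒰 (𝓝 p) := h𝒰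
  -- Every ultrafilter limit of the symmetries at q → p is a symmetry at `p`, so uniqueness
  -- identifies it with that of `p`.
  have hsym : IsGeodesicSymmetry p h := by
    refine ⟨?_, ?_, ?_⟩
    · ext y
      refine tendsto_nhds_unique (hh (h y)) (tendsto_iff_dist_tendsto_zero.2 ?_)
      refine (tendsto_iff_dist_tendsto_zero.1 (hh y)).congr fun q => ?_
      have := (geodesicSymmetry q).isometry.dist_eq (geodesicSymmetry q y) (h y)
      rw [hσσ] at this
      rw [← this, dist_comm]
      rfl
    · refine tendsto_nhds_unique (hh p) (tendsto_iff_dist_tendsto_zero.2 ?_)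
      have h1 : Tendsto (fun q => dist p q + dist q p) 𝒰 (𝓝 0) := by
        simpa using ((tendsto_const_nhds (x := p)).dist hp).add
          (hp.dist (tendsto_const_nhds (x := p)))
      refine squeeze_zero (fun _ => dist_nonneg) (fun q => ?_) h1
      have h2 := (geodesicSymmetry q).isometry.dist_eq p q
      rw [(hσ q).fixes] at h2
      rw [← h2]
      exact dist_triangle _ q _
    · have hball : Metric.ball p r ∈ 𝓝[≠] p := nhdsWithin_le_nhds (Metric.ball_mem_nhds p hr)
      filter_upwards [hball, self_mem_nhdsWithin] with y hy hne hfix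
      have hy' : dist p y < r := by rw [dist_comm]; exact hy
      have h1 : Tendsto (fun q => dist q y) 𝒰 (𝓝 (dist p y)) := hp.dist tendsto_const_nhds
      have h2 : Tendsto (fun q : M => dist y (geodesicSymmetry q y)) 𝒰 (𝓝 (dist y (h y))) :=
        tendsto_const_nhds.dist (hh y)
      have h3 := le_of_tendsto_of_tendsto h1 h2
        ((h1.eventually_lt_const hy').mono fun q hq => hdist q y hq)
      rw [hfix, dist_self] at h3
      exact hne (dist_le_zero.1 h3).symm
  rw [IsGeodesicSymmetry.unique E (hσ p) hsym]
  exact hh x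

/-- Multiplication by products of two geodesic symmetries preserves the identity component. -/
theorem mul_mem_isometryIdComponent (E : Type u) [NormedAddCommGroup E] [NormedSpace ℝ E]
    [FiniteDimensional ℝ E]
    {M : Type*} [MetricSpace M] [ChartedSpace E M] [IsManifold 𝓘(ℝ, E) ∞ M]
    [Bundle.RiemannianBundle (fun x : M => TangentSpace 𝓘(ℝ, E) x)]
    [IsContMDiffRiemannianBundle 𝓘(ℝ, E) ∞ E (fun x : M => TangentSpace 𝓘(ℝ, E) x)]
    [IsRiemannianManifold 𝓘(ℝ, E) M]
    [ConnectedSpace M] [IsSymmetricSpace M] [CompactSpace M] {a : M ≃ᵢ M}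
    (ha : a ∈ isometryIdComponent M) (p q : M) :
    a * (geodesicSymmetry p * geodesicSymmetry q) ∈ isometryIdComponent M := by
  -- As q varies over the connected space `M`, the product traces a connected set, which contains
  -- `a` at q = p.
  have hcont : Continuous fun q : M => a * (geodesicSymmetry p * geodesicSymmetry q) :=
    (continuous_isometryEquiv_mul_left a).comp
      ((continuous_isometryEquiv_mul_left _).comp (continuous_geodesicSymmetry E))
  have h1 : a ∈ range fun q : M => a * (geodesicSymmetry p * geodesicSymmetry q) :=
    ⟨p, by simp only [(isGeodesicSymmetry_geodesicSymmetry p).involutive, mul_one]⟩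
  have h2 := (isPreconnected_range hcont).subset_connectedComponent h1 ⟨q, rfl⟩
  rwa [← connectedComponent_eq ha] at h2

/-- Elements of the glide group can thus be told apart from the symmetries of an outer space. -/
theorem glideGroup_subset_isometryIdComponent (E : Type u) [NormedAddCommGroup E] [NormedSpace ℝ E]
    [FiniteDimensional ℝ E]
    {M : Type*} [MetricSpace M] [ChartedSpace E M] [IsManifold 𝓘(ℝ, E) ∞ M]
    [Bundle.RiemannianBundle (fun x : M => TangentSpace 𝓘(ℝ, E) x)]
    [IsContMDiffRiemannianBundle 𝓘(ℝ, E) ∞ E (fun x : M => TangentSpace 𝓘(ℝ, E) x)]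
    [IsRiemannianManifold 𝓘(ℝ, E) M]
    [ConnectedSpace M] [IsSymmetricSpace M] [CompactSpace M] (S : Set M) {g : M ≃ᵢ M}
    (hg : g ∈ glideGroup S) : g ∈ isometryIdComponent M := by
  refine Subgroup.closure_induction_right (p := fun g _ => g ∈ isometryIdComponent M)
    mem_connectedComponent ?_ ?_ hg
  · rintro x hx _ ⟨p, -, q, -, rfl⟩ h
    exact mul_mem_isometryIdComponent E h p q
  · rintro x hx _ ⟨p, -, q, -, rfl⟩ h
    have h1 : (geodesicSymmetry p * geodesicSymmetry q)⁻¹ =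
        geodesicSymmetry q * geodesicSymmetry p := by
      rw [inv_eq_iff_mul_eq_one, mul_assoc, ← mul_assoc (geodesicSymmetry q),
        (isGeodesicSymmetry_geodesicSymmetry q).involutive, one_mul,
        (isGeodesicSymmetry_geodesicSymmetry p).involutive]
    rw [h1]
    exact mul_mem_isometryIdComponent E h q p

/-- In an outer symmetric space, no geodesic symmetry lies in the identity component. -/
theorem IsOuterSymmetricSpace.geodesicSymmetry_notMem
    (E : Type u) [NormedAddCommGroup E] [NormedSpace ℝ E]
    [FiniteDimensional ℝ E]
    {M : Type*} [MetricSpace M] [ChartedSpace E M] [IsManifold 𝓘(ℝ, E) ∞ M]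
    [Bundle.RiemannianBundle (fun x : M => TangentSpace 𝓘(ℝ, E) x)]
    [IsContMDiffRiemannianBundle 𝓘(ℝ, E) ∞ E (fun x : M => TangentSpace 𝓘(ℝ, E) x)]
    [IsRiemannianManifold 𝓘(ℝ, E) M]
    [ConnectedSpace M] [IsSymmetricSpace M] [CompactSpace M] (h : IsOuterSymmetricSpace M)
    (o : M) : geodesicSymmetry o ∉ isometryIdComponent M := by
  intro ho
  refine h fun p => ⟨?_, (isGeodesicSymmetry_geodesicSymmetry p).fixes⟩
  -- Since σ_o(σ_o σ_p) = σ_p, one symmetry in the identity component would put all of them there.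
  have := mul_mem_isometryIdComponent E ho o p
  rwa [← mul_assoc, (isGeodesicSymmetry_geodesicSymmetry o).involutive, one_mul] at this

end Symmetries

/-! ## Rotation vectors of orthogonal maps -/

section Rotation

open Filter

/-- The symmetric operator T + T* preserves the orthogonal complement of the fixed vectors, so it
has an eigenvector w there, with eigenvalue μ = 2cos θ. Then T²w = μTw - w, and ⟨Tⁿw, w⟩ satisfies
the same recurrence as cos(nθ). -/
theorem exists_rotation_vector {X : Type*} [NormedAddCommGroup X] [InnerProductSpace ℝ X]
    [FiniteDimensional ℝ X] (T : X →ₗ[ℝ] X) (hT : ∀ v w, inner ℝ (T v) (T w) = inner ℝ v w)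
    (hne : ∃ v, T v ≠ v) :
    ∃ w ≠ 0, ∃ θ : ℝ, (∀ x, T x = x → inner ℝ x w = 0) ∧
      ∀ n : ℕ, inner ℝ ((T ^ n) w) w = Real.cos (n * θ) * inner ℝ w w := by
  set K : Submodule ℝ X := LinearMap.ker (T - LinearMap.id)
  have hK : ∀ x, x ∈ K ↔ T x = x := fun x => by
    rw [LinearMap.mem_ker, LinearMap.sub_apply, LinearMap.id_apply, sub_eq_zero]
  have hW : Kᗮ ≠ ⊥ := by
    rw [Ne, Submodule.orthogonal_eq_bot_iff]
    intro h
    obtain ⟨v, hv⟩ := hne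
    exact hv ((hK v).1 (h ▸ Submodule.mem_top))
  have : Nontrivial Kᗮ := (Submodule.nontrivial_iff_ne_bot).2 hW
  have hadj : LinearMap.adjoint T * T = 1 := by
    ext v
    refine ext_inner_right ℝ fun w => ?_
    rw [Module.End.mul_apply, LinearMap.adjoint_inner_left, hT]
    rfl
  have hadj' : ∀ v, T (LinearMap.adjoint T v) = v := fun v =>
    LinearMap.congr_fun (mul_eq_one_comm.1 hadj) v
  set A : X →ₗ[ℝ] X := T + LinearMap.adjoint T
  have hA : A.IsSymmetric := fun v w => by
    rw [LinearMap.add_apply, LinearMap.add_apply, inner_add_left, inner_add_right,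
      LinearMap.adjoint_inner_left, LinearMap.adjoint_inner_right, add_comm]
  have hAW : ∀ v ∈ Kᗮ, A v ∈ Kᗮ := by
    intro v hv
    rw [Submodule.mem_orthogonal] at hv ⊢
    intro x hx
    have h1 := (hK x).1 hx
    rw [LinearMap.add_apply, inner_add_right, LinearMap.adjoint_inner_right, h1, hv x hx, add_zero]
    conv_lhs => rw [← h1]
    rw [hT, hv x hx]
  obtain ⟨⟨w, hwK⟩, hw⟩ :=
    ((hA.restrict_invariant hAW).hasEigenvalue_iSup_of_finiteDimensional).exists_hasEigenvector
  obtain ⟨μ, hμ⟩ : ∃ μ : ℝ, A w = μ • w := ⟨_, congrArg Subtype.val hw.apply_eq_smul⟩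
  have hw0 : w ≠ 0 := fun h => hw.2 (Subtype.ext h)
  have hww : 0 < inner ℝ w w := by rw [real_inner_self_eq_norm_sq]; positivity
  have h1 : 2 * inner ℝ (T w) w = μ * inner ℝ w w := by
    have h : inner ℝ (A w) w = 2 * inner ℝ (T w) w := by
      rw [LinearMap.add_apply, inner_add_left, LinearMap.adjoint_inner_left,
        real_inner_comm (T w) w]
      ring
    rw [← h, hμ, real_inner_smul_left]
  have hTn : ‖T w‖ = ‖w‖ := by
    have := hT w w
    rw [real_inner_self_eq_norm_sq, real_inner_self_eq_norm_sq] at this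
    exact (sq_eq_sq₀ (norm_nonneg _) (norm_nonneg _)).1 this
  have h2 : |inner ℝ (T w) w| ≤ inner ℝ w w := by
    have := abs_real_inner_le_norm (T w) w
    rwa [hTn, ← sq, ← real_inner_self_eq_norm_sq] at this
  obtain ⟨h3, h4⟩ := abs_le.1 h2
  have hcos : Real.cos (Real.arccos (μ / 2)) = μ / 2 := by
    refine Real.cos_arccos ?_ ?_ <;> by_contra! h <;> nlinarith
  refine ⟨w, hw0, Real.arccos (μ / 2), fun x hx => (Submodule.mem_orthogonal _ _).1 hwK x
    ((hK x).2 hx), ?_⟩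
  have hrec : ∀ n : ℕ, inner ℝ ((T ^ (n + 2)) w) w =
      μ * inner ℝ ((T ^ (n + 1)) w) w - inner ℝ ((T ^ n) w) w := by
    intro n
    have h5 : T (T w) = μ • T w - w := by
      have := congrArg T hμ
      rw [LinearMap.add_apply, map_add, hadj', map_smul] at this
      exact eq_sub_of_add_eq this
    rw [pow_add, Module.End.mul_apply, pow_two, Module.End.mul_apply, h5, map_sub, map_smul,
      inner_sub_left, real_inner_smul_left, pow_succ, Module.End.mul_apply]
  have key : ∀ n : ℕ, inner ℝ ((T ^ n) w) w = Real.cos (n * Real.arccos (μ / 2)) * inner ℝ w w ∧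
      inner ℝ ((T ^ (n + 1)) w) w =
        Real.cos ((n + 1 : ℕ) * Real.arccos (μ / 2)) * inner ℝ w w := by
    intro n
    induction n with
    | zero =>
      constructor
      · simp
      · rw [zero_add, pow_one, Nat.cast_one, one_mul, hcos]
        linarith
    | succ n ih =>
      refine ⟨ih.2, ?_⟩
      rw [hrec, ih.1, ih.2]
      set θ := Real.arccos (μ / 2)
      have e1 : ((n + 1 + 1 : ℕ) : ℝ) * θ = ((n + 1 : ℕ) : ℝ) * θ + θ := by push_cast; ring
      have e2 : (n : ℝ) * θ = ((n + 1 : ℕ) : ℝ) * θ - θ := by push_cast; ring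
      rw [e1, e2, Real.cos_add, Real.cos_sub, hcos]
      ring
  exact fun n => (key n).1

/-- The cosines of the multiples of an angle which is not commensurable with `2π` accumulate at
`-1`. -/
theorem exists_cos_nat_mul_lt {θ : ℝ} (h : ∀ n : ℕ, 0 < n → Real.cos (n * θ) ≠ 1) {ε : ℝ}
    (hε : 0 < ε) : ∃ n : ℕ, |Real.cos (n * θ) + 1| < ε := by
  have hirr : Irrational (θ / (2 * Real.pi)) := by
    rintro ⟨q, hq⟩
    have hπ : (2 * Real.pi) ≠ 0 := by positivity
    rw [eq_div_iff hπ] at hq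
    refine h q.den q.den_pos ?_
    rw [Real.cos_eq_one_iff]
    refine ⟨q.num, ?_⟩
    have h1 : (q.num : ℝ) = q.den * q := by exact_mod_cast (Rat.den_mul_eq_num q).symm
    rw [h1, ← hq]
    ring
  have hdense := dense_addSubgroupClosure_pair_iff.2 hirr
  -- For irrational θ/2π the group generated by θ and 2π is dense, so it meets every neighbourhood
  -- of π.
  have hopen : IsOpen {x : ℝ | |Real.cos x + 1| < ε} :=
    isOpen_lt (by fun_prop) continuous_const
  obtain ⟨x, hx, hmem⟩ := hdense.exists_mem_open hopen ⟨Real.pi, by simpa using hε⟩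
  obtain ⟨m, k, rfl⟩ := AddSubgroup.mem_closure_pair.1 hx
  -- The coefficient of θ may be negative; cosine is even, so its absolute value serves.
  refine ⟨m.natAbs, ?_⟩
  have h1 : Real.cos ((m.natAbs : ℝ) * θ) = Real.cos (m • θ + k • (2 * Real.pi)) := by
    rw [zsmul_eq_mul, zsmul_eq_mul, Real.cos_add_int_mul_two_pi]
    rcases Int.natAbs_eq m with h2 | h2
    · conv_rhs => rw [h2]
      simp
    · conv_rhs => rw [h2]
      simp
  rw [h1]
  exact hmem

end Rotation

/-! ### Involutions fixing a maximal totally geodesic submanifold -/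

section Reflective

open Set Filter

set_option synthInstance.maxHeartbeats 200000
set_option linter.unusedSectionVars false

universe u

variable {E : Type u} [NormedAddCommGroup E] [NormedSpace ℝ E]
  {M : Type*} [MetricSpace M] [ChartedSpace E M]
  [Bundle.RiemannianBundle (fun x : M => TangentSpace 𝓘(ℝ, E) x)]
  [FiniteDimensional ℝ E] [IsManifold 𝓘(ℝ, E) ∞ M] [IsRiemannianManifold 𝓘(ℝ, E) M]
  [IsContMDiffRiemannianBundle 𝓘(ℝ, E) ∞ E (fun x : M => TangentSpace 𝓘(ℝ, E) x)]

theorem exists_rotation_vector_isotropyMap {p : M} {g : M ≃ᵢ M}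
    (hne : ∃ v : E, isotropyMap E p g v ≠ v) :
    ∃ w : E, w ≠ 0 ∧ ∃ θ : ℝ, (∀ x ∈ fixedVectors E p g, metricAt p x w = 0) ∧
      ∀ n : ℕ, metricAt p ((isotropyMap E p g ^ n) w) w = Real.cos (n * θ) * metricAt p w w := by
  have : FiniteDimensional ℝ (TangentSpace 𝓘(ℝ, E) p) := inferInstanceAs (FiniteDimensional ℝ E)
  let T : TangentSpace 𝓘(ℝ, E) p →ₗ[ℝ] TangentSpace 𝓘(ℝ, E) p :=
    { toFun := fun v => toTangent p (isotropyMap E p g v)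
      map_add' := fun v w => map_add (isotropyMap E p g) v w
      map_smul' := fun k v => map_smul (isotropyMap E p g) k v }
  have hTn : ∀ (n : ℕ) (v : E), (T ^ n) (toTangent p v) =
      toTangent p ((isotropyMap E p g ^ n) v) := by
    intro n
    induction n with
    | zero => exact fun v => rfl
    | succ n ih =>
      intro v
      rw [pow_succ, pow_succ, Module.End.mul_apply, Module.End.mul_apply]
      exact ih (isotropyMap E p g v)
  have hin : ∀ v w : E, metricAt p (isotropyMap E p g v) (isotropyMap E p g w) = metricAt p v w :=
    fun v w => by
      rw [← metricForm_apply, ← metricForm_apply, metricForm_isotropyMap]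
  obtain ⟨w, hw, θ, h1, h2⟩ := exists_rotation_vector T (fun v w => hin v w) hne
  refine ⟨w, hw, θ, fun x hx => h1 x ((mem_fixedVectors (E := E)).1 hx), fun n => ?_⟩
  have := h2 n
  rw [show (T ^ n) w = toTangent p ((isotropyMap E p g ^ n) w) from hTn n w] at this
  exact this

/-- The distance from `-w` to a vector obtained from `w` by a rotation with cosine `c`. -/
theorem normAt_add_sq_eq {p : M} {w u : E} {c : ℝ} (hn : normAt p u = normAt p w)
    (h : metricAt p u w = c * metricAt p w w) :
    normAt p (u + w) ^ 2 = 2 * (c + 1) * normAt p w ^ 2 := by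
  rw [metricAt_self] at h
  rw [← metricAt_self, ← metricForm_apply]
  simp only [map_add, add_apply, metricForm_apply, metricAt_comm p w u, h, metricAt_self, hn]
  ring

/-- If all isometries `k ≠ 1` that fix `S` pointwise have the same
fixed vectors at `o`, and no odd power of such an isometry `g ≠ 1` is trivial, then there is
an involution that fixes `S` pointwise. -/
theorem exists_involution_fixing [CompactSpace M] [ConnectedSpace M] {S : Set M} {o : M}
    (ho : o ∈ S) {g : M ≃ᵢ M} (hg : ∀ x ∈ S, g x = x) (hg1 : g ≠ 1)
    (hodd : ∀ n : ℕ, Odd n → g ^ n ≠ 1)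
    (hfix : ∀ k : M ≃ᵢ M, (∀ x ∈ S, k x = x) → k ≠ 1 → fixedVectors E o k = fixedVectors E o g) :
    ∃ h : M ≃ᵢ M, h * h = 1 ∧ h ≠ 1 ∧ ∀ x ∈ S, h x = x := by
  have hgo := hg o ho
  obtain ⟨w, hw, θ, horth, hcos⟩ := exists_rotation_vector_isotropyMap (E := E) (p := o)
    (g := g) (by
    by_contra! h
    exact hg1 (eq_one_of_isotropyMap hgo h))
  have hw2 : 0 < normAt o w ^ 2 :=
    pow_pos (lt_of_le_of_ne (normAt_nonneg o w) fun h => hw (normAt_eq_zero.1 h.symm)) 2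
  -- The vector `w` is orthogonal to the common space of fixed vectors, so only the identity can fix
  -- both `S` pointwise and `w`.
  have hone : ∀ k : M ≃ᵢ M, (∀ x ∈ S, k x = x) → isotropyMap E o k w = w → k = 1 := by
    intro k hk hkw
    by_contra hk1
    have h1 := horth w (hfix k hk hk1 ▸ mem_fixedVectors.2 hkw)
    rw [metricAt_self] at h1
    exact hw2.ne' h1
  have hpow : ∀ (n : ℕ), ∀ x ∈ S, (g ^ n) x = x := by
    intro n x hx
    induction n with
    | zero => rfl
    | succ n ih => rw [pow_succ, IsometryEquiv.mul_apply, hg x hx, ih]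
  have hnorm : ∀ n : ℕ, normAt o ((isotropyMap E o g ^ n) w) = normAt o w := fun n => by
    rw [← (isotropyMap_pow hgo n).2, normAt_isotropyMap]
  by_cases hper : ∃ n : ℕ, 0 < n ∧ Real.cos (n * θ) = 1
  · obtain ⟨n, hn, hcn⟩ := hper
    -- With -w in place of w, the cosine 1 becomes -1 and the sum in `normAt_add_sq_eq` becomes a
    -- difference of norm zero.
    have h1 : (isotropyMap E o g ^ n) w = w := by
      have h2 := normAt_add_sq_eq (p := o) (w := -w) (u := (isotropyMap E o g ^ n) w) (c := -1)
        (by rw [hnorm, ← neg_one_smul ℝ w, normAt_smul]; simp)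
        (by
          have h3 := hcos n
          rw [← metricForm_apply, ← metricForm_apply, hcn] at h3
          rw [← metricForm_apply, ← metricForm_apply]
          simp only [map_neg, neg_apply, h3]
          ring)
      rw [neg_add_cancel, mul_zero, zero_mul, ← sub_eq_add_neg] at h2
      exact sub_eq_zero.1 (normAt_eq_zero.1 (pow_eq_zero_iff two_ne_zero |>.1 h2))
    have hgn : g ^ n = 1 := hone _ (hpow n) (by rw [(isotropyMap_pow hgo n).2, h1])
    have hfin : 0 < orderOf g := orderOf_pos_iff.2 (isOfFinOrder_iff_pow_eq_one.2 ⟨n, hn, hgn⟩)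
    rcases Nat.even_or_odd (orderOf g) with ⟨k, hk⟩ | h
    -- The order of `g` is 2k, so the k-th power is a nontrivial involution.
    · refine ⟨g ^ k, ?_, pow_ne_one_of_lt_orderOf (by omega) (by omega), hpow k⟩
      rw [← pow_add, ← hk, pow_orderOf_eq_one]
    · exact absurd (pow_orderOf_eq_one g) (hodd _ h)
  · push Not at hper
    -- Powers of `g` along which the cosine tends to -1 converge to an isometry whose differential
    -- sends `w` to -w. Its square fixes `w`, hence is trivial, and it is not the identity itself.
    have : ((𝓝 (-1 : ℝ)).comap fun n : ℕ => Real.cos (n * θ)).NeBot := by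
      refine comap_neBot fun t ht => ?_
      obtain ⟨ε, hε, hball⟩ := Metric.mem_nhds_iff.1 ht
      obtain ⟨n, hn⟩ := exists_cos_nat_mul_lt hper hε
      exact ⟨n, hball (by rwa [Metric.mem_ball, Real.dist_eq, sub_neg_eq_add])⟩
    set 𝒰 := Ultrafilter.of ((𝓝 (-1 : ℝ)).comap fun n : ℕ => Real.cos (n * θ))
    have h𝒰 : Tendsto (fun n : ℕ => Real.cos (n * θ)) 𝒰 (𝓝 (-1)) :=
      tendsto_iff_comap.2 (Ultrafilter.of_le _)
    obtain ⟨h, hh⟩ := exists_isometryEquiv_tendsto 𝒰 fun n : ℕ => g ^ n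
    have hhS : ∀ x ∈ S, h x = x := fun x hx =>
      tendsto_nhds_unique (hh x) (by simp only [hpow _ x hx]; exact tendsto_const_nhds)
    have hTw : Tendsto (fun n : ℕ => (isotropyMap E o g ^ n) w) 𝒰 (𝓝 (-w)) := by
      obtain ⟨C, hC, hCa⟩ := exists_norm_sq_le_normAt_sq (E := E) o
      rw [tendsto_iff_norm_sub_tendsto_zero]
      have h1 : Tendsto (fun n : ℕ => √(C * (2 * (Real.cos (n * θ) + 1) * normAt o w ^ 2))) 𝒰
          (𝓝 0) := by
        have h2 := ((((h𝒰.add_const 1).const_mul 2).mul_const (normAt o w ^ 2)).const_mul C).sqrt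
        simpa using h2
      refine squeeze_zero (fun _ => norm_nonneg _) (fun n => ?_) h1
      rw [sub_neg_eq_add]
      refine Real.le_sqrt_of_sq_le ?_
      rw [← normAt_add_sq_eq (hnorm n) (hcos n)]
      exact hCa _
    have hLw : isotropyMap E o h w = -w := by
      refine isotropyMap_apply_eq (hhS o ho) (Eventually.frequently ?_)
      filter_upwards [eventually_normAt_smul_lt_right o w (normalRadius_pos (E := E) o)]
        with s hs
      have hlt : normAt o (s • -w) < normalRadius E o := by
        rw [normAt_smul, ← neg_one_smul ℝ w, normAt_smul, abs_neg, abs_one, one_mul,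
          ← normAt_smul]
        exact hs.2
      have hcont : ContinuousAt (expAt o : E → M) (s • -w) := (continuousOn_expAt o).continuousAt
        ((isOpen_lt (continuous_normAt o) continuous_const).mem_nhds hlt)
      refine tendsto_nhds_unique (hh _) ((hcont.tendsto.comp (hTw.const_smul s)).congr fun n => ?_)
      rw [map_expAt (isotropyMap_pow (E := E) hgo n).1 hs.2, (isotropyMap_pow hgo n).2, map_smul]
      rfl
    refine ⟨h, hone _ (fun x hx => ?_) ?_, ?_, hhS⟩
    · rw [IsometryEquiv.mul_apply, hhS x hx, hhS x hx]
    · rw [isotropyMap_mul (hhS o ho) (hhS o ho), hLw, map_neg, hLw, neg_neg]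
    · rintro rfl
      rw [isotropyMap_one, eq_neg_iff_add_eq_zero, ← two_smul ℝ w, smul_eq_zero] at hLw
      exact hLw.elim two_ne_zero hw

/-- A maximal totally geodesic submanifold is a component of the fixed point set of each nontrivial
isometry that fixes its points. -/
theorem IsMaximalTotallyGeodesic.eq_connectedComponentIn {S : Set M}
    (hS : IsMaximalTotallyGeodesic E S) {o : M} (ho : o ∈ S) {k : M ≃ᵢ M}
    (hk : ∀ x ∈ S, k x = x) (hk1 : k ≠ 1) : S = connectedComponentIn {x | k x = x} o := by
  have h1 := hS.maximal _ (isTotallyGeodesicSubmanifold_connectedComponentIn_fixed E (hk o ho))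
    (hS.totallyGeodesic.connected.isPreconnected.subset_connectedComponentIn ho hk)
  refine (h1.resolve_right fun huniv => hk1 ?_).symm
  ext x
  have hx : x ∈ connectedComponentIn {x | k x = x} o := huniv ▸ mem_univ x
  exact connectedComponentIn_subset {x | k x = x} o hx

theorem IsMaximalTotallyGeodesic.mem_tangentVectors_iff {S : Set M}
    (hS : IsMaximalTotallyGeodesic E S) {o : M} (ho : o ∈ S) {k : M ≃ᵢ M}
    (hk : ∀ x ∈ S, k x = x) (hk1 : k ≠ 1) (v : E) :
    v ∈ tangentVectors E S o ↔ isotropyMap E o k v = v := by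
  have h1 := hS.eq_connectedComponentIn ho hk hk1
  have h2 := tangentVectors_connectedComponentIn_fixed E (h1 ▸ ho)
  rw [← h1] at h2
  rw [h2]
  exact mem_fixedVectors (E := E)

/-- Components of the fixed point sets of involutions have totally geodesic normal spaces. -/
theorem isReflective_of_involution [ConnectedSpace M] [IsSymmetricSpace M] {S : Set M}
    (hS : IsMaximalTotallyGeodesic E S) {h : M ≃ᵢ M} (hh : h * h = 1) (hh1 : h ≠ 1)
    (hhS : ∀ x ∈ S, h x = x) : IsReflective E S where
  totallyGeodesic := hS.totallyGeodesic
  normal := by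
    intro o ho
    have hσ := isGeodesicSymmetry_geodesicSymmetry o
    have hho := hhS o ho
    have hk : (geodesicSymmetry o * h) o = o := by
      rw [IsometryEquiv.mul_apply, hho, hσ.fixes]
    have hmem : o ∈ connectedComponentIn {x | (geodesicSymmetry o * h) x = x} o :=
      mem_connectedComponentIn hk
    -- The differential of σ_o h at `o` is -dh, so its fixed vectors are the (-1)-eigenvectors of
    -- dh. For an orthogonal involution these form the complement of the fixed vectors, which are
    -- the tangent space of `S`.
    refine ⟨_, isTotallyGeodesicSubmanifold_connectedComponentIn_fixed E hk, hmem, ?_⟩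
    rw [tangentVectors_connectedComponentIn_fixed E hmem]
    have key : ∀ v : E, v ∈ fixedVectors E o (geodesicSymmetry o * h) ↔
        ∀ w : E, w ∈ tangentVectors E S o → metricAt o v w = 0 := by
      intro v
      set L := isotropyMap E o h
      have hL : ∀ v, L (L v) = v := fun v => by
        rw [← isotropyMap_mul hho hho, hh, isotropyMap_one]
      rw [mem_fixedVectors, isotropyMap_mul hσ.fixes hho, hσ.isotropyMap_eq]
      constructor
      · intro hv w hw
        rw [hS.mem_tangentVectors_iff ho hhS hh1] at hw
        have h1 := metricForm_isotropyMap o h v w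
        rw [hw, neg_eq_iff_eq_neg.1 hv, map_neg, neg_apply, metricForm_apply] at h1
        linarith
      · intro hv
        have h1 : ∀ u, L u = u → metricForm o v u = 0 := fun u hu =>
          (metricForm_apply o v u).trans
            (hv u ((hS.mem_tangentVectors_iff ho hhS hh1 u).2 hu))
        -- The vector v + Lv is tangent to `S`, hence orthogonal to v and, since L is orthogonal and
        -- fixes it, to Lv. Being orthogonal to itself, it is zero.
        have h2 : L (v + L v) = v + L v := by rw [map_add, hL, add_comm]
        have h3 := h1 _ h2
        have h4 : metricForm o (L v) (v + L v) = 0 := by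
          rw [← h2, metricForm_isotropyMap, h3]
        have h5 : normAt o (v + L v) ^ 2 = 0 := by
          have h7 : metricForm o (v + L v) = metricForm o v + metricForm o (L v) := map_add _ _ _
          rw [← metricAt_self, ← metricForm_apply, h7, add_apply, h3, h4, add_zero]
        have h6 := normAt_eq_zero.1 (pow_eq_zero_iff two_ne_zero |>.1 h5)
        exact (eq_neg_of_add_eq_zero_left h6).symm
    exact key

end Reflective

/-! ### The main theorem -/

theorem proposition4p3
    {E : Type*} [NormedAddCommGroup E] [NormedSpace ℝ E] [FiniteDimensional ℝ E]
    {M : Type*} [MetricSpace M] [ConnectedSpace M] [ChartedSpace E M] [IsManifold 𝓘(ℝ, E) ∞ M]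
    [Bundle.RiemannianBundle (fun x : M => TangentSpace 𝓘(ℝ, E) x)]
    [IsContMDiffRiemannianBundle 𝓘(ℝ, E) ∞ E (fun x : M => TangentSpace 𝓘(ℝ, E) x)]
    [IsRiemannianManifold 𝓘(ℝ, E) M]
    [IsSymmetricSpace M]
    (hirr : IsIrreducibleSymmetricSpace E M)
    (hcpt : IsOfCompactType M)
    (hout : IsOuterSymmetricSpace M)
    (S : Set M) (hmax : IsMaximalTotallyGeodesic E S)
    (hinn : IsInnerSubmanifold S) :
    IsReflective E S ∧
    ∀ o ∈ S,
      (∃ τ : M ≃ᵢ M, τ * τ = 1 ∧ RestrictsToGeodesicSymmetry τ S o ∧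
        (geodesicSymmetry o * τ) * (geodesicSymmetry o * τ) = 1 ∧
        S = connectedComponentIn {x | (geodesicSymmetry o * τ) x = x} o) ∧
      (∀ τ ∈ glideIsotropyGroup S o, RestrictsToGeodesicSymmetry τ S o →
        S = connectedComponentIn {x | (geodesicSymmetry o * τ) x = x} o) := by
  have := hcpt.compact
  have hσ : ∀ o : M, geodesicSymmetry o * geodesicSymmetry o = 1 := fun o =>
    (isGeodesicSymmetry_geodesicSymmetry o).involutive
  have hnotMem : ∀ o, geodesicSymmetry o ∉ glideGroup S := fun o h =>
    hout.geodesicSymmetry_notMem E o (glideGroup_subset_isometryIdComponent E S h)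
  have hfixes : ∀ o, ∀ τ : M ≃ᵢ M, RestrictsToGeodesicSymmetry τ S o →
      ∀ x ∈ S, (geodesicSymmetry o * τ) x = x := fun o τ hτ x hx => by
    rw [IsometryEquiv.mul_apply, hτ x hx, ← IsometryEquiv.mul_apply, hσ]
    rfl
  have hodd : ∀ o, ∀ τ ∈ glideIsotropyGroup S o, ∀ n : ℕ, Odd n →
      (geodesicSymmetry o * τ) ^ n ≠ 1 := by
    rintro o τ ⟨hτ, hτo⟩ n ⟨k, rfl⟩ h
    have hcomm : Commute (geodesicSymmetry o) τ := by
      have h1 := conj_geodesicSymmetry E τ o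
      rw [hτo, mul_inv_eq_iff_eq_mul] at h1
      exact h1.symm
    -- For odd n the commuting product has n-th power σ_o τⁿ. If this were 1, σ_o would be a power
    -- of τ⁻¹ and lie in the glide group.
    rw [hcomm.mul_pow, pow_succ, pow_mul, sq, hσ, one_pow, one_mul] at h
    refine hnotMem o ?_
    rw [eq_inv_of_mul_eq_one_left h]
    exact inv_mem (pow_mem hτ _)
  have hne : ∀ o, ∀ τ ∈ glideIsotropyGroup S o, geodesicSymmetry o * τ ≠ 1 := fun o τ hτ h =>
    hodd o τ hτ 1 odd_one (by rw [pow_one, h])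
  obtain ⟨h, hh, hh1, hhS⟩ : ∃ h : M ≃ᵢ M, h * h = 1 ∧ h ≠ 1 ∧ ∀ x ∈ S, h x = x := by
    obtain ⟨o, ho, τ, hτ, hres⟩ := hinn
    refine exists_involution_fixing (E := E) ho (hfixes o τ hres) (hne o τ hτ) (hodd o τ hτ)
      fun k hk hk1 => ?_
    ext v
    rw [mem_fixedVectors, mem_fixedVectors, ← hmax.mem_tangentVectors_iff ho hk hk1,
      ← hmax.mem_tangentVectors_iff ho (hfixes o τ hres) (hne o τ hτ)]
  refine ⟨isReflective_of_involution hmax hh hh1 hhS, fun o ho => ⟨?_, fun τ hτ hres =>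
    hmax.eq_connectedComponentIn ho (hfixes o τ hres) (hne o τ hτ)⟩⟩
  have hcomm : Commute (geodesicSymmetry o) h := by
    have h1 := conj_geodesicSymmetry E h o
    rw [hhS o ho, mul_inv_eq_iff_eq_mul] at h1
    exact h1.symm
  have hστ : geodesicSymmetry o * (geodesicSymmetry o * h) = h := by
    rw [← mul_assoc, hσ, one_mul]
  -- The involution `h` was found at one point, but it fixes all of `S`, so it commutes with σ_o at
  -- every o ∈ S and the same `h` serves each of them.
  refine ⟨geodesicSymmetry o * h, ?_, fun x hx => ?_, ?_, ?_⟩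
  · rw [← sq, hcomm.mul_pow, sq, sq, hσ, hh, one_mul]
  · rw [IsometryEquiv.mul_apply, hhS x hx]
  · rw [hστ, hh]
  · rw [hστ]
    exact hmax.eq_connectedComponentIn ho hhS hh1
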